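/- Conventions. A real superalgebra is an associative unital $\mathbb R$-algebra $A=A_0\oplus A_1$ with $A_iA_j\subseteq A_{i+j}$ ($i,j\in\mathbb Z_2$); $A\cong B$ means isomorphism by an even algebra isomorphism; $\mathrm{Gr}\,A$ is the category of $\mathbb Z_2$-graded left $A$-modules and even homomorphisms. The skew tensor product $A\widehat\otimes B$ has the multiplication $(a_1\otimes b_1)(a_2\otimes b_2)=(-1)^{|b_1||a_2|}a_1a_2\otimes b_1b_2$. The shifts $\pi,\sigma$ of $\mathrm{Gr}\,A$ are given by $\pi(M)_i=\sigma(M)_i=M_{i+1}$ with actions $a\,\pi(m)=(-1)^{|a|}\pi(am)$ and $a\,\sigma(m)=\sigma(am)$. For $S\in\{\pi,\sigma\}$ put $\mathrm{Hom}^S_A(M,N)=\mathrm{Hom}_{\mathrm{Gr}A}(M,N)\oplus\mathrm{Hom}_{\mathrm{Gr}A}(S(M),N)$, the morphisms of the category $\mathrm{Mod}^S A$, and let $\mathrm{End}^S_A(M)=\mathrm{Hom}^S_A(M,M)$, a superalgebra in which $fg$ means first $f$, then $g$ (so that $\mathrm{End}_A^\sigma(A)\cong A$). Finite dimensional superalgebras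 $A$ and $B$ are $S$-graded equivalent, $A\approx_S B$, if the ($\mathbb R$-linear) categories $\mathrm{Gr}\,A$ and $\mathrm{Gr}\,B$ are equivalent and $B\cong\mathrm{End}^S_A(P)$ for some finitely generated projective graded $A$-module $P$. A finite dimensional superalgebra $A$ is $S$-graded basic if in every decomposition $A=\bigoplus_{i=1}^nP_i$ into indecomposable projective graded modules $P_i$ and $P_j$ are not isomorphic in $\mathrm{Mod}^S A$ for $i\ne j$. For $p,q,r\ge 0$ let $\mathbb R_{p,q,r}$ be the real Clifford superalgebra generated by $p+q+r$ pairwise anticommuting odd elements, $p$ of them with square $1$, $q$ with square $-1$ and $r$ with square $0$. Let $\bigwedge_{\mathbb R}(r)=\mathbb R_{0,0,r}$ be the Grassmann superalgebra, $\mathbb H$ the quaternions concentrated in degree $0$, $\mathbb D_+=\mathbb R_{1,0,0}$ and $\mathbb D_-=\mathbb R_{0,1,0}$ (one odd generator with square $1$, respectively $-1$), and $\mathbb D_\pm^i=\mathbb D_\pm\widehat\otimes\cdots\widehat\otimes\mathbb D_\pm$ ($i$ factors). Theorem. Let $p,q,r\ge0$ be integers. (i) $\mathbb R_{p,q,r}$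 is $\sigma$-graded equivalent to $\bigwedge_{\mathbb R}(r)$ if $p-q\equiv0\pmod 8$; $\mathbb H\widehat\otimes\bigwedge_{\mathbb R}(r)$ if $p-q\equiv4\pmod 8$; $\mathbb D_+^i\widehat\otimes\bigwedge_{\mathbb R}(r)$ if $p-q\equiv i\pmod 8$ with $1\le i\le3$; $\mathbb D_-^i\widehat\otimes\bigwedge_{\mathbb R}(r)$ if $p-q\equiv -i\pmod 8$ with $1\le i\le3$. (ii) $\mathbb R_{p,q,r}$ is $\pi$-graded equivalent to $\bigwedge_{\mathbb R}(r)$ if $p-q\equiv0\pmod 8$; $\mathbb H\widehat\otimes\bigwedge_{\mathbb R}(r)$ if $p-q\equiv4\pmod 8$; $\mathbb D_+^i\widehat\otimes\bigwedge_{\mathbb R}(r)$ if $p-q\equiv -i\pmod 8$ with $1\le i\le3$; $\mathbb D_-^i\widehat\otimes\bigwedge_{\mathbb R}(r)$ if $p-q\equiv i\pmod 8$ with $1\le i\le3$. Moreover, all the superalgebras $\bigwedge_{\mathbb R}(r)$, $\mathbb H\widehat\otimes\bigwedge_{\mathbb R}(r)$ and $\mathbb D_\pm^i\widehat\otimes\bigwedge_{\mathbb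 R}(r)$ ($1\le i\le 3$) are both $\sigma$-graded basic and $\pi$-graded basic. -/

import Mathlib

open CategoryTheory
open scoped TensorProduct

universe u

/-- A superalgebra over `K`: an associative unital `K`-algebra with a vector space decomposition
`A = A₀ ⊕ A₁` such that `Aᵢ Aⱼ ⊆ Aᵢ₊ⱼ`. -/
structure SuperAlg (K : Type u) [Field K] where
  carrier : Type u
  [ring : Ring carrier]
  [algebra : Algebra K carrier]
  part : ZMod 2 → Submodule K carrier
  isCompl : IsCompl (part 0) (part 1)
  one_mem : (1 : carrier) ∈ part 0
  mul_mem : ∀ {i j : ZMod 2} {a b : carrier}, a ∈ part i → b ∈ part j → a * b ∈ part (i + j)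

namespace SuperAlg

variable {K : Type u} [Field K]

instance : CoeSort (SuperAlg K) (Type u) := ⟨carrier⟩

instance (A : SuperAlg K) : Ring A := A.ring

instance (A : SuperAlg K) : Algebra K A := A.algebra

theorem isInternal_of_isCompl {V : Type*} [AddCommGroup V] [Module K V]
    {p : ZMod 2 → Submodule K V} (h : IsCompl (p 0) (p 1)) : DirectSum.IsInternal p :=
  (DirectSum.isInternal_submodule_iff_isCompl p (i := 0) (j := 1) (by decide)
    (by ext i; revert i; simp; decide)).mpr h

theorem isCompl_of_isInternal {V : Type*} [AddCommGroup V] [Module K V]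
    {p : ZMod 2 → Submodule K V} (h : DirectSum.IsInternal p) : IsCompl (p 0) (p 1) :=
  (DirectSum.isInternal_submodule_iff_isCompl p (i := 0) (j := 1) (by decide)
    (by ext i; revert i; simp; decide)).mp h

instance (A : SuperAlg K) : SetLike.GradedMonoid A.part where
  one_mem := A.one_mem
  mul_mem _ _ _ _ ha hb := A.mul_mem ha hb

noncomputable instance (A : SuperAlg K) : GradedAlgebra A.part :=
  (isInternal_of_isCompl A.isCompl).gradedAlgebra

/-- Two superalgebras are isomorphic if there is an isomorphism of algebras that is even
(its inverse is then even as well). -/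
def Isomorphic (A B : SuperAlg K) : Prop :=
  ∃ e : A ≃ₐ[K] B, ∀ i, ∀ a ∈ A.part i, e a ∈ B.part i

/-- An ungraded algebra, viewed as a superalgebra concentrated in degree `0`. -/
def concentrated (K : Type u) [Field K] (E : Type u) [Ring E] [Algebra K E] : SuperAlg K where
  carrier := E
  part i := if i = 0 then ⊤ else ⊥
  isCompl := by simpa using isCompl_top_bot
  one_mem := by simp
  mul_mem {i j a b} ha hb := by
    by_cases hi : i = 0
    · by_cases hj : j = 0
      · rw [hi, hj]; simp
      · rw [if_neg hj, Submodule.mem_bot] at hb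
        rw [hb, mul_zero]; exact zero_mem _
    · rw [if_neg hi, Submodule.mem_bot] at ha
      rw [ha, zero_mul]; exact zero_mem _

/-! ### Skew tensor products -/

/-- The homogeneous projection of degree `i`. -/
noncomputable def proj (A : SuperAlg K) (i : ZMod 2) : A →ₗ[K] A := GradedAlgebra.proj A.part i

theorem proj_mem (A : SuperAlg K) (i : ZMod 2) (a : A) : A.proj i a ∈ A.part i :=
  SetLike.coe_mem _

theorem proj_of_mem (A : SuperAlg K) {i : ZMod 2} {a : A} (h : a ∈ A.part i) :
    A.proj i a = a := DirectSum.decompose_of_mem_same _ h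

theorem proj_of_mem_ne (A : SuperAlg K) {i j : ZMod 2} {a : A} (h : a ∈ A.part i) (hij : i ≠ j) :
    A.proj j a = 0 := DirectSum.decompose_of_mem_ne _ h hij

theorem proj_add_proj (A : SuperAlg K) (a : A) : A.proj 0 a + A.proj 1 a = a := by
  have h : a ∈ A.part 0 ⊔ A.part 1 := A.isCompl.sup_eq_top ▸ Submodule.mem_top
  obtain ⟨x, hx, y, hy, rfl⟩ := Submodule.mem_sup.mp h
  rw [map_add, map_add, A.proj_of_mem hx, A.proj_of_mem hy, A.proj_of_mem_ne hx (by decide),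
    A.proj_of_mem_ne hy (by decide)]
  simp

/-- The degree `i` part of `A ⊗ B`, the sum of the `Aⱼ ⊗ Bₖ` with `j + k = i`, inside Mathlib's
skew tensor product, where `(a₁ ⊗ b₁)(a₂ ⊗ b₂) = (-1) ^ (|b₁| |a₂|) (a₁ a₂ ⊗ b₁ b₂)`. -/
noncomputable def tensorPart (A B : SuperAlg K) (i : ZMod 2) :
    Submodule K (GradedTensorProduct K A.part B.part) :=
  Submodule.span K {x | ∃ (j k : ZMod 2) (a : A) (b : B), j + k = i ∧ a ∈ A.part j ∧
    b ∈ B.part k ∧ x = GradedTensorProduct.tmul K a b}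

theorem tensorPart_isCompl (A B : SuperAlg K) :
    IsCompl (tensorPart A B 0) (tensorPart A B 1) := by
  constructor
  · rw [Submodule.disjoint_def]
    intro x h0 h1
    let P : A ⊗[K] B →ₗ[K] A ⊗[K] B :=
      TensorProduct.map (A.proj 0) (B.proj 0) + TensorProduct.map (A.proj 1) (B.proj 1)
    have e0 : ∀ y ∈ tensorPart A B 0, P y = y := by
      intro y hy
      induction hy using Submodule.span_induction with
      | mem y hy =>
        obtain ⟨j, k, a, b, hjk, ha, hb, rfl⟩ := hy
        change A.proj 0 a ⊗ₜ B.proj 0 b + A.proj 1 a ⊗ₜ B.proj 1 b = a ⊗ₜ[K] b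
        have : (j = 0 ∧ k = 0) ∨ (j = 1 ∧ k = 1) := by
          clear ha hb; revert j k; decide
        rcases this with ⟨rfl, rfl⟩ | ⟨rfl, rfl⟩
        · rw [A.proj_of_mem ha, B.proj_of_mem hb, A.proj_of_mem_ne ha (by decide)]; simp
        · rw [A.proj_of_mem ha, B.proj_of_mem hb, A.proj_of_mem_ne ha (by decide)]; simp
      | zero => exact map_zero P
      | add y z _ _ hy hz => exact (map_add P y z).trans (congrArg₂ (· + ·) hy hz)
      | smul c y _ hy => exact (map_smul P c y).trans (congrArg (c • ·) hy)
    have e1 : ∀ y ∈ tensorPart A B 1, P y = 0 := by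
      intro y hy
      induction hy using Submodule.span_induction with
      | mem y hy =>
        obtain ⟨j, k, a, b, hjk, ha, hb, rfl⟩ := hy
        change A.proj 0 a ⊗ₜ B.proj 0 b + A.proj 1 a ⊗ₜ B.proj 1 b = (0 : A ⊗[K] B)
        have : (j = 0 ∧ k = 1) ∨ (j = 1 ∧ k = 0) := by
          clear ha hb; revert j k; decide
        rcases this with ⟨rfl, rfl⟩ | ⟨rfl, rfl⟩
        · rw [B.proj_of_mem_ne (j := 0) hb (by decide), A.proj_of_mem_ne (j := 1) ha (by decide)]
          simp
        · rw [B.proj_of_mem_ne (j := 1) hb (by decide), A.proj_of_mem_ne (j := 0) ha (by decide)]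
          simp
      | zero => exact map_zero P
      | add y z _ _ hy hz =>
        exact (map_add P y z).trans ((congrArg₂ (· + ·) hy hz).trans (add_zero _))
      | smul c y _ hy => exact (map_smul P c y).trans ((congrArg (c • ·) hy).trans (smul_zero c))
    exact (e0 x h0).symm.trans (e1 x h1)
  · rw [codisjoint_iff, eq_top_iff]
    intro x _
    have hx : ∀ x : A ⊗[K] B, GradedTensorProduct.of K A.part B.part x ∈
        tensorPart A B 0 ⊔ tensorPart A B 1 := by
      intro x
      induction x using TensorProduct.induction_on with
      | zero => simp
      | add x y hx hy => rw [map_add]; exact add_mem hx hy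
      | tmul a b =>
        rw [← A.proj_add_proj a, ← B.proj_add_proj b]
        simp only [TensorProduct.add_tmul, TensorProduct.tmul_add, map_add]
        refine add_mem (add_mem ?_ ?_) (add_mem ?_ ?_)
        · exact Submodule.mem_sup_left (Submodule.subset_span
            ⟨0, 0, _, _, by decide, A.proj_mem _ _, B.proj_mem _ _, rfl⟩)
        · exact Submodule.mem_sup_right (Submodule.subset_span
            ⟨1, 0, _, _, by decide, A.proj_mem _ _, B.proj_mem _ _, rfl⟩)
        · exact Submodule.mem_sup_right (Submodule.subset_span
            ⟨0, 1, _, _, by decide, A.proj_mem _ _, B.proj_mem _ _, rfl⟩)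
        · exact Submodule.mem_sup_left (Submodule.subset_span
            ⟨1, 1, _, _, by decide, A.proj_mem _ _, B.proj_mem _ _, rfl⟩)
    exact hx x

theorem tensorPart_mul_mem (A B : SuperAlg K) {i j : ZMod 2}
    {x y : GradedTensorProduct K A.part B.part}
    (hx : x ∈ tensorPart A B i) (hy : y ∈ tensorPart A B j) : x * y ∈ tensorPart A B (i + j) := by
  induction hx using Submodule.span_induction with
  | zero => rw [zero_mul]; exact zero_mem _
  | add x z _ _ hx hz => rw [add_mul]; exact add_mem hx hz
  | smul c x _ hx => rw [smul_mul_assoc]; exact Submodule.smul_mem _ _ hx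
  | mem x hx =>
    obtain ⟨j₁, k₁, a₁, b₁, rfl, ha₁, hb₁, rfl⟩ := hx
    induction hy using Submodule.span_induction with
    | zero => rw [mul_zero]; exact zero_mem _
    | add x z _ _ hx hz => rw [mul_add]; exact add_mem hx hz
    | smul c x _ hx => rw [mul_smul_comm]; exact Submodule.smul_mem _ _ hx
    | mem y hy =>
      obtain ⟨j₂, k₂, a₂, b₂, rfl, ha₂, hb₂, rfl⟩ := hy
      have h := GradedTensorProduct.tmul_coe_mul_coe_tmul (R := K) A.part B.part a₁
        ⟨b₁, hb₁⟩ ⟨a₂, ha₂⟩ b₂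
      have hm : GradedTensorProduct.tmul K (a₁ * a₂) (b₁ * b₂) ∈
          tensorPart A B (j₁ + k₁ + (j₂ + k₂)) :=
        Submodule.subset_span ⟨_, _, _, _, by ring, A.mul_mem ha₁ ha₂, B.mul_mem hb₁ hb₂, rfl⟩
      rw [h]
      rcases Int.units_eq_one_or ((-1 : ℤˣ) ^ (k₁ * j₂)) with hs | hs <;> rw [hs]
      · rw [one_smul]; exact hm
      · rw [Units.neg_smul, one_smul]; exact neg_mem hm

/-- The skew tensor product of superalgebras. -/
noncomputable def tensor (A B : SuperAlg K) : SuperAlg K where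
  carrier := GradedTensorProduct K A.part B.part
  part := tensorPart A B
  isCompl := tensorPart_isCompl A B
  one_mem := Submodule.subset_span ⟨0, 0, 1, 1, by decide, A.one_mem, B.one_mem, rfl⟩
  mul_mem := tensorPart_mul_mem A B

/-- The skew tensor power `A ⊗ ⋯ ⊗ A` (`n` factors); for `n = 0` it is `K`. -/
noncomputable def tensorPow (A : SuperAlg K) : ℕ → SuperAlg K
  | 0 => concentrated K K
  | 1 => A
  | n + 2 => tensor (tensorPow A (n + 1)) A

/-! ### Shifts -/

/-- The parity involution `a ↦ (-1) ^ |a| a`. -/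
noncomputable def parity (A : SuperAlg K) : A →+* A where
  toFun a := A.proj 0 a - A.proj 1 a
  map_zero' := by simp
  map_one' := by rw [A.proj_of_mem A.one_mem, A.proj_of_mem_ne A.one_mem (by decide), sub_zero]
  map_add' a b := by simp only [map_add]; abel
  map_mul' a b := by
    have h0 : A.proj 0 (a * b) = A.proj 0 a * A.proj 0 b + A.proj 1 a * A.proj 1 b := by
      conv_lhs => rw [← A.proj_add_proj a, ← A.proj_add_proj b]
      simp only [add_mul, mul_add, map_add]
      rw [A.proj_of_mem (i := 0) (A.mul_mem (A.proj_mem 0 a) (A.proj_mem 0 b)),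
        A.proj_of_mem (i := 0) (A.mul_mem (A.proj_mem 1 a) (A.proj_mem 1 b)),
        A.proj_of_mem_ne (A.mul_mem (A.proj_mem 1 a) (A.proj_mem 0 b)) (by decide),
        A.proj_of_mem_ne (A.mul_mem (A.proj_mem 0 a) (A.proj_mem 1 b)) (by decide)]
      simp
    have h1 : A.proj 1 (a * b) = A.proj 0 a * A.proj 1 b + A.proj 1 a * A.proj 0 b := by
      conv_lhs => rw [← A.proj_add_proj a, ← A.proj_add_proj b]
      simp only [add_mul, mul_add, map_add]
      rw [A.proj_of_mem_ne (A.mul_mem (A.proj_mem 0 a) (A.proj_mem 0 b)) (by decide),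
        A.proj_of_mem_ne (A.mul_mem (A.proj_mem 1 a) (A.proj_mem 1 b)) (by decide),
        A.proj_of_mem (i := 1) (A.mul_mem (A.proj_mem 1 a) (A.proj_mem 0 b)),
        A.proj_of_mem (i := 1) (A.mul_mem (A.proj_mem 0 a) (A.proj_mem 1 b))]
      simp [add_comm]
    rw [h0, h1]
    noncomm_ring

theorem parity_of_mem_zero (A : SuperAlg K) {a : A} (h : a ∈ A.part 0) : A.parity a = a := by
  change A.proj 0 a - A.proj 1 a = a
  rw [A.proj_of_mem h, A.proj_of_mem_ne h (by decide), sub_zero]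

theorem parity_of_mem_one (A : SuperAlg K) {a : A} (h : a ∈ A.part 1) : A.parity a = -a := by
  change A.proj 0 a - A.proj 1 a = -a
  rw [A.proj_of_mem h, A.proj_of_mem_ne h (by decide), zero_sub]

theorem parity_parity (A : SuperAlg K) (a : A) : A.parity (A.parity a) = a := by
  conv_lhs => rw [← A.proj_add_proj a]
  simp only [map_add]
  rw [A.parity_of_mem_zero (A.proj_mem 0 a), A.parity_of_mem_one (A.proj_mem 1 a), map_neg,
    A.parity_of_mem_zero (A.proj_mem 0 a), A.parity_of_mem_one (A.proj_mem 1 a), neg_neg,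
    A.proj_add_proj]

/-- The two shifts of the category of graded modules: the parity change `π` and the
suspension `σ`. -/
inductive Shift
  | pi
  | sigma

/-- The automorphism by which a shift changes the action: `a ↦ (-1) ^ |a| a` for `π` and the
identity for `σ`. -/
noncomputable def twist (A : SuperAlg K) : Shift → (A →+* A)
  | .pi => A.parity
  | .sigma => RingHom.id A

theorem twist_twist (A : SuperAlg K) (S : Shift) (a : A) : A.twist S (A.twist S a) = a := by
  cases S
  · exact A.parity_parity a
  · rfl

theorem twist_mem (A : SuperAlg K) (S : Shift) {i : ZMod 2} {a : A} (h : a ∈ A.part i) :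
    A.twist S a ∈ A.part i := by
  cases S
  · change A.parity a ∈ _
    fin_cases i
    · rw [A.parity_of_mem_zero h]; exact h
    · rw [A.parity_of_mem_one h]; exact neg_mem h
  · exact h

theorem twist_smul (A : SuperAlg K) (S : Shift) (c : K) (a : A) :
    A.twist S (c • a) = c • A.twist S a := by
  cases S
  · change A.proj 0 (c • a) - A.proj 1 (c • a) = c • (A.proj 0 a - A.proj 1 a)
    rw [map_smul, map_smul, smul_sub]
  · rfl

end SuperAlg

open SuperAlg (Shift)

/-! ### Graded modules -/

/-- A graded (left) module `M = M₀ ⊕ M₁` over a superalgebra, with `Aᵢ Mⱼ ⊆ Mᵢ₊ⱼ`. -/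
structure GrMod {K : Type u} [Field K] (A : SuperAlg K) where
  carrier : Type u
  [addCommGroup : AddCommGroup carrier]
  [moduleBase : Module K carrier]
  [module : Module A carrier]
  [isScalarTower : IsScalarTower K A carrier]
  part : ZMod 2 → Submodule K carrier
  isCompl : IsCompl (part 0) (part 1)
  smul_mem : ∀ {i j : ZMod 2} {a : A} {m : carrier},
    a ∈ A.part i → m ∈ part j → a • m ∈ part (i + j)

namespace GrMod

variable {K : Type u} [Field K] {A : SuperAlg K}

instance : CoeSort (GrMod A) (Type u) := ⟨carrier⟩

instance (M : GrMod A) : AddCommGroup M := M.addCommGroup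

instance (M : GrMod A) : Module K M := M.moduleBase

instance (M : GrMod A) : Module A M := M.module

instance (M : GrMod A) : IsScalarTower K A M := M.isScalarTower

/-- The even homomorphisms `M → N`: the linear maps with `f (Mᵢ) ⊆ Nᵢ` and `f (a m) = a f m`. -/
def evenHom (M N : GrMod A) : Submodule K (M →ₗ[K] N) where
  carrier := {f | (∀ i, ∀ m ∈ M.part i, f m ∈ N.part i) ∧ ∀ (a : A) (m : M), f (a • m) = a • f m}
  zero_mem' := ⟨fun _ _ _ => zero_mem _, fun a _ => (smul_zero a).symm⟩
  add_mem' hf hg := ⟨fun i m hm => add_mem (hf.1 i m hm) (hg.1 i m hm), fun a m => by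
    rw [LinearMap.add_apply, LinearMap.add_apply, hf.2, hg.2, smul_add]⟩
  smul_mem' c f hf := ⟨fun i m hm => Submodule.smul_mem _ c (hf.1 i m hm), fun a m => by
    rw [LinearMap.smul_apply, LinearMap.smul_apply, hf.2,
      ← algebraMap_smul A c (a • f m), ← algebraMap_smul A c (f m), smul_smul, smul_smul,
      Algebra.commutes]⟩

/-- The category `Gr A` of graded `A`-modules and even homomorphisms. -/
instance : Category (GrMod A) where
  Hom M N := evenHom M N
  id M := ⟨LinearMap.id, fun _ _ h => h, fun _ _ => rfl⟩
  comp f g := ⟨g.1 ∘ₗ f.1, fun i m h => g.2.1 i _ (f.2.1 i m h), fun a m => by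
    rw [LinearMap.comp_apply, LinearMap.comp_apply, f.2.2, g.2.2]⟩

instance : Preadditive (GrMod A) where
  homGroup M N := inferInstanceAs (AddCommGroup (evenHom M N))
  add_comp _ _ _ f f' g := Subtype.ext (LinearMap.comp_add f.1 f'.1 g.1)
  comp_add _ _ _ f g g' := Subtype.ext (LinearMap.add_comp f.1 g'.1 g.1)

instance : Linear K (GrMod A) where
  homModule M N := inferInstanceAs (Module K (evenHom M N))
  smul_comp _ _ _ c f g := Subtype.ext (LinearMap.comp_smul g.1 c f.1)
  comp_smul _ _ _ f c g := Subtype.ext (LinearMap.smul_comp c g.1 f.1)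

/-- `A` as a graded module over itself. -/
abbrev regular (A : SuperAlg K) : GrMod A where
  carrier := A
  part := A.part
  isCompl := A.isCompl
  smul_mem := A.mul_mem

/-- The shifted module `S(M)`: the vector space `M` with the grading `S(M)ᵢ = Mᵢ₊₁` and, for
homogeneous `a`, the action `a • S(m) = (-1) ^ |a| S(a m)` if `S = π`, and `a • S(m) = S(a m)` if
`S = σ`. -/
noncomputable abbrev shift (S : Shift) (M : GrMod A) : GrMod A where
  carrier := M
  module := Module.compHom M (A.twist S)
  isScalarTower := by
    refine @IsScalarTower.mk K A M _ (Module.compHom M (A.twist S)).toSMul _ fun c a m => ?_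
    change A.twist S (c • a) • m = c • (A.twist S a • m)
    rw [A.twist_smul, smul_assoc]
  part i := M.part (i + 1)
  isCompl := by
    have : (1 + 1 : ZMod 2) = 0 := by decide
    rw [zero_add, this]
    exact M.isCompl.symm
  smul_mem {i j a m} ha hm := by
    rw [add_assoc]
    exact M.smul_mem (A.twist_mem S ha) hm

/-- `Hom_{Gr A}(S(M), N)`, as a space of linear maps between the vector spaces underlying
`M` and `N`. -/
noncomputable def oddHom (S : Shift) (M N : GrMod A) : Submodule K (M →ₗ[K] N) :=
  evenHom (shift S M) N

theorem mem_evenHom {M N : GrMod A} {f : M →ₗ[K] N} : f ∈ evenHom M N ↔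
    (∀ i, ∀ m ∈ M.part i, f m ∈ N.part i) ∧ ∀ (a : A) (m : M), f (a • m) = a • f m :=
  Iff.rfl

theorem mem_oddHom {S : Shift} {M N : GrMod A} {f : M →ₗ[K] N} : f ∈ oddHom S M N ↔
    (∀ i, ∀ m ∈ M.part (i + 1), f m ∈ N.part i) ∧
      ∀ (a : A) (m : M), f (A.twist S a • m) = a • f m :=
  Iff.rfl

/-- The homogeneous parts of `Hom^S_A(M, N) = Hom_{Gr A}(M, N) ⊕ Hom_{Gr A}(S(M), N)`. -/
noncomputable def twistedHomPart (S : Shift) (M N : GrMod A) (i : ZMod 2) :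
    Submodule K (M →ₗ[K] N) :=
  if i = 0 then evenHom M N else oddHom S M N

/-- `Hom^S_A(M, N)`, the space of morphisms from `M` to `N` in `Mod^S A`. -/
noncomputable def twistedHom (S : Shift) (M N : GrMod A) : Submodule K (M →ₗ[K] N) :=
  evenHom M N ⊔ oddHom S M N

/-- `M` and `N` are isomorphic in the category `Mod^S A`. -/
def IsomorphicTwisted (S : Shift) (M N : GrMod A) : Prop :=
  ∃ f ∈ twistedHom S M N, ∃ g ∈ twistedHom S N M,
    g ∘ₗ f = LinearMap.id ∧ f ∘ₗ g = LinearMap.id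

theorem twistedHomPart_disjoint (S : Shift) (M N : GrMod A) :
    Disjoint (evenHom M N) (oddHom S M N) := by
  rw [Submodule.disjoint_def]
  intro f h0 h1
  rw [mem_evenHom] at h0
  rw [mem_oddHom] at h1
  have key : ∀ i, ∀ m ∈ M.part i, f m = 0 := by
    intro i m hm
    have hN := Submodule.disjoint_def.mp N.isCompl.disjoint
    have a := h0.1 i m hm
    have b := h1.1 (i + 1) m (by
      rwa [show i + 1 + 1 = i from (by decide : ∀ k : ZMod 2, k + 1 + 1 = k) i])
    fin_cases i
    · exact hN _ a b
    · exact hN _ b a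
  ext m
  have h : m ∈ M.part 0 ⊔ M.part 1 := M.isCompl.sup_eq_top ▸ Submodule.mem_top
  obtain ⟨x, hx, y, hy, rfl⟩ := Submodule.mem_sup.mp h
  rw [map_add, key 0 x hx, key 1 y hy]
  simp

theorem comp_mem_twistedHomPart (S : Shift) {L M N : GrMod A} {i j : ZMod 2}
    {f : L →ₗ[K] M} {g : M →ₗ[K] N} (hf : f ∈ twistedHomPart S L M i)
    (hg : g ∈ twistedHomPart S M N j) : g ∘ₗ f ∈ twistedHomPart S L N (i + j) := by
  have two : ∀ k : ZMod 2, k + 1 + 1 = k := by decide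
  have e0 : ∀ P Q : GrMod A, twistedHomPart S P Q 0 = evenHom P Q := fun _ _ => rfl
  have e1 : ∀ P Q : GrMod A, twistedHomPart S P Q 1 = oddHom S P Q := fun _ _ => rfl
  have zero_or_one : ∀ k : ZMod 2, k = 0 ∨ k = 1 := by decide
  have hi := zero_or_one i
  have hj := zero_or_one j
  rcases hi with rfl | rfl <;> rcases hj with rfl | rfl
  · rw [e0, mem_evenHom] at hf hg
    rw [add_zero, e0, mem_evenHom]
    exact ⟨fun i m hm => hg.1 _ _ (hf.1 i m hm), fun a m => by
      rw [LinearMap.comp_apply, LinearMap.comp_apply, hf.2, hg.2]⟩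
  · rw [e0, mem_evenHom] at hf
    rw [e1, mem_oddHom] at hg
    rw [zero_add, e1, mem_oddHom]
    exact ⟨fun i m hm => hg.1 _ _ (hf.1 _ m hm), fun a m => by
      rw [LinearMap.comp_apply, LinearMap.comp_apply, hf.2, hg.2]⟩
  · rw [e0, mem_evenHom] at hg
    rw [e1, mem_oddHom] at hf
    rw [add_zero, e1, mem_oddHom]
    exact ⟨fun i m hm => hg.1 _ _ (hf.1 _ m hm), fun a m => by
      rw [LinearMap.comp_apply, LinearMap.comp_apply, hf.2, hg.2]⟩
  · rw [e1, mem_oddHom] at hf hg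
    have : (1 + 1 : ZMod 2) = 0 := by decide
    rw [this, e0, mem_evenHom]
    refine ⟨fun i m hm => hg.1 _ _ (hf.1 _ m (by rwa [two])), fun a m => ?_⟩
    rw [LinearMap.comp_apply, LinearMap.comp_apply, ← A.twist_twist S a, hf.2, hg.2,
      A.twist_twist]

/-- The algebra underlying `End^S_A(M)`, inside the opposite of the algebra of linear
endomorphisms of `M`. -/
noncomputable def twistedEndSubalgebra (S : Shift) (M : GrMod A) :
    Subalgebra K (Module.End K M)ᵐᵒᵖ where
  carrier := {f | f.unop ∈ twistedHom S M M}
  zero_mem' := zero_mem (twistedHom S M M)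
  one_mem' := Submodule.mem_sup_left ⟨fun _ _ h => h, fun _ _ => rfl⟩
  add_mem' hf hg := (twistedHom S M M).add_mem hf hg
  algebraMap_mem' c := Submodule.mem_sup_left <|
    (evenHom M M).smul_mem c (x := LinearMap.id) ⟨fun _ _ h => h, fun _ _ => rfl⟩
  mul_mem' {f g} hf hg := by
    obtain ⟨f0, hf0, f1, hf1, hf⟩ := Submodule.mem_sup.mp hf
    obtain ⟨g0, hg0, g1, hg1, hg⟩ := Submodule.mem_sup.mp hg
    have h00 := comp_mem_twistedHomPart S (i := 0) (j := 0) hf0 hg0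
    have h01 := comp_mem_twistedHomPart S (i := 0) (j := 1) hf0 hg1
    have h10 := comp_mem_twistedHomPart S (i := 1) (j := 0) hf1 hg0
    have h11 := comp_mem_twistedHomPart S (i := 1) (j := 1) hf1 hg1
    change g.unop ∘ₗ f.unop ∈ twistedHom S M M
    rw [← hf, ← hg, LinearMap.add_comp, LinearMap.comp_add, LinearMap.comp_add]
    exact add_mem (add_mem (Submodule.mem_sup_left h00) (Submodule.mem_sup_right h10))
      (add_mem (Submodule.mem_sup_right h01) (Submodule.mem_sup_left h11))

/-- The `S`-twisted endomorphism superalgebra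
`End^S_A(M) = Hom_{Gr A}(M, M) ⊕ Hom_{Gr A}(S(M), M)`. Module homomorphisms of left modules are
multiplied in the order in which a left module is acted on from the right: `f * g` is "first `f`,
then `g`". With this order `Hom^S_A(M, N)` is a left `End^S_A(M)`-module under composition, and
right multiplications identify `End^σ_A(A)` with `A`. -/
noncomputable def twistedEnd (S : Shift) (M : GrMod A) : SuperAlg K where
  carrier := twistedEndSubalgebra S M
  part i := ((twistedHomPart S M M i).comap
    (MulOpposite.opLinearEquiv K).symm.toLinearMap).comap (twistedEndSubalgebra S M).val.toLinearMap
  isCompl := by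
    constructor
    · rw [Submodule.disjoint_def]
      intro f h0 h1
      have h := Submodule.disjoint_def.mp (twistedHomPart_disjoint S M M) f.1.unop h0 h1
      exact Subtype.ext (MulOpposite.unop_injective h)
    · rw [codisjoint_iff, eq_top_iff]
      intro f _
      obtain ⟨f0, hf0, f1, hf1, hf⟩ := Submodule.mem_sup.mp
        (show f.1.unop ∈ evenHom M M ⊔ oddHom S M M from f.2)
      refine Submodule.mem_sup.mpr ⟨⟨MulOpposite.op f0, Submodule.mem_sup_left hf0⟩, hf0,
        ⟨MulOpposite.op f1, Submodule.mem_sup_right hf1⟩, hf1, ?_⟩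
      exact Subtype.ext (MulOpposite.unop_injective hf)
  one_mem := ⟨fun _ _ h => h, fun _ _ => rfl⟩
  mul_mem hf hg := comp_mem_twistedHomPart S hf hg

/-- `M` is gr-indecomposable: it is nonzero, and whenever `M` is the direct sum of two graded
modules (via even homomorphisms), one of them is zero. -/
def IsIndecomposable (M : GrMod A) : Prop :=
  Nontrivial M ∧ ∀ (N₁ N₂ : GrMod A) (f₁ : N₁ ⟶ M) (f₂ : N₂ ⟶ M),
    Function.Bijective (fun x : N₁ × N₂ => f₁.1 x.1 + f₂.1 x.2) →
      Subsingleton N₁ ∨ Subsingleton N₂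

end GrMod

namespace SuperAlg

variable {K : Type u} [Field K]

/-- `A` and `B` are `S`-graded equivalent: they are finite dimensional, the (`K`-linear)
categories `Gr A` and `Gr B` are equivalent, and `B ≅ End^S_A(P)` for some finitely generated
projective graded `A`-module `P`. -/
def GradedEquivalent (S : Shift) (A B : SuperAlg K) : Prop :=
  Module.Finite K A ∧ Module.Finite K B ∧
  (∃ e : GrMod A ≌ GrMod B, e.functor.Additive ∧ e.functor.Linear K) ∧
  ∃ P : GrMod A, Module.Finite A P ∧ Module.Projective A P ∧ Isomorphic B (P.twistedEnd S)

/-- `A` is `S`-graded basic: it is finite dimensional and, in any decomposition `A = ⨁ Pᵢ` into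
indecomposable (automatically projective) graded modules, no two different summands are isomorphic
in `Mod^S A`. -/
def IsGradedBasic (S : Shift) (A : SuperAlg K) : Prop :=
  Module.Finite K A ∧
  ∀ (n : ℕ) (P : Fin n → GrMod A) (f : ∀ i, P i ⟶ GrMod.regular A),
    (∀ i, (P i).IsIndecomposable) →
    Function.Bijective (fun x : (∀ i, P i) => ∑ i, (f i).1 (x i)) →
    ∀ i j, i ≠ j → ¬ GrMod.IsomorphicTwisted S (P i) (P j)

end SuperAlg

/-! ### Clifford superalgebras -/

/-- The Clifford algebra of a quadratic form, with its even and odd parts. -/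
noncomputable def cliffordSuperAlg {V : Type} [AddCommGroup V] [Module ℝ V]
    (Q : QuadraticForm ℝ V) : SuperAlg ℝ where
  carrier := CliffordAlgebra Q
  part := CliffordAlgebra.evenOdd Q
  isCompl := SuperAlg.isCompl_of_isInternal (DirectSum.Decomposition.isInternal _)
  one_mem := SetLike.GradedOne.one_mem
  mul_mem ha hb := SetLike.GradedMul.mul_mem ha hb

/-- The form `x₁² + ⋯ + x_p² - x_{p+1}² - ⋯ - x_{p+q}²` on `ℝ^{p+q+r}`. -/
noncomputable def diagForm (p q r : ℕ) : QuadraticForm ℝ (Fin p ⊕ Fin q ⊕ Fin r → ℝ) :=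
  QuadraticMap.weightedSumSquares ℝ
    (Sum.elim (fun _ => 1) (Sum.elim (fun _ => -1) (fun _ => 0)) : Fin p ⊕ Fin q ⊕ Fin r → ℝ)

/-- The Clifford superalgebra `ℝ_{p,q,r}`: anticommuting odd generators, of which `p` have square
`1`, `q` have square `-1`, and `r` have square `0`. -/
noncomputable def realClifford (p q r : ℕ) : SuperAlg ℝ := cliffordSuperAlg (diagForm p q r)

/-- The Grassmann superalgebra `Λ_ℝ(r)` on `r` odd generators (Mathlib's exterior algebra is the
Clifford algebra of the zero form). -/
noncomputable def grassmann (r : ℕ) : SuperAlg ℝ :=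
  cliffordSuperAlg (0 : QuadraticForm ℝ (Fin r → ℝ))

/-- `𝔻₊`, generated by one odd element of square `1`. -/
noncomputable def dPlus : SuperAlg ℝ := realClifford 1 0 0

/-- `𝔻₋`, generated by one odd element of square `-1`. -/
noncomputable def dMinus : SuperAlg ℝ := realClifford 0 1 0

/-- The quaternions, concentrated in degree `0`. -/
noncomputable def quaternionSuperAlg : SuperAlg ℝ := SuperAlg.concentrated ℝ (Quaternion ℝ)

/-!
Both kinds of graded equivalence come from corners. If `e` is an even idempotent of `A` that is full
in the graded sense (`1` is a sum of products `x e y` with `x` and `y` homogeneous of the same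
degree), then `M ↦ e M` is an equivalence from graded `A`-modules to graded `e A e`-modules, with
inverse the coinduction `N ↦ Hom_{eAe} (e A, N)`, and right multiplications identify `e A e` with
`End^σ_A (A e)`. Hence `A` is `σ`-graded equivalent to each of its full corners
(`CornerEmbedding.equivalence`, `CornerEmbedding.gradedEquivalent_sigma`). For `π`, right
multiplications compose according to a twisted multiplication on `A`, in which a product of two odd
elements changes sign; graded modules over `A` and over its twist are the same up to the action of
odd elements through the parity involution, so `A` is `π`-graded equivalent to each full corner of
its twist (`Twist.gradedEquivalent_pi`). The twist of `ℝ_{p,q,r}` is `ℝ_{q,p,r}` (`cliffTwist`),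
which accounts for the exchange of the signs between the two lists.

It remains to find the prescribed superalgebras as full corners. Full corners are stable under
composition and under skew tensor products with a fixed factor, and Clifford superalgebras turn
orthogonal sums into skew tensor products. Three facts suffice: `ℝ_{1,1,0}` has the full corner `ℝ`
(`nonempty_corner_hyperbolic`); `ℝ_{4,0,0}` and `ℝ_{0,4,0}` are isomorphic, by multiplying each
generator by the product of all four (`nonempty_cornerEmbedding_neg_four`); and `ℝ_{4,0,0}` has the
full corner `ℍ` (`nonempty_corner_four`). Cancelling hyperbolic planes and moving generators in
groups of four brings `p - q` into the range from `-3` to `4` without a change modulo `8`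
(`exists_corner_reduced`).

The superalgebras in the lists are basic because their only even idempotents are `0` and `1`
(`IsEvenConnected.isGradedBasic`): a decomposition of the graded module `A` into indecomposables
then has a single summand. The even part of `ℝ_{3,0,0}` and of `ℝ_{0,3,0}` is the division algebra
`ℍ`, adjoining an odd generator of square zero creates no even idempotent
(`IsEvenConnected.tensor_dual`), and the property passes to subalgebras and corners, among which all
the superalgebras in the lists are found.
-/

/-! ### Gradings by `ℤ/2` -/

theorem ZMod.two_cases (i : ZMod 2) : i = 0 ∨ i = 1 := by revert i; decide

theorem ZMod.two_add_self (i : ZMod 2) : i + i = 0 := by revert i; decide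

section Grading

variable {K V W : Type*} [Ring K] [AddCommGroup V] [Module K V] [AddCommGroup W] [Module K W]
  {p : ZMod 2 → Submodule K V} {q : ZMod 2 → Submodule K W}

theorem IsCompl.eq_zero_of_mem (hp : IsCompl (p 0) (p 1)) {i : ZMod 2} {v : V} (h : v ∈ p i)
    (h' : v ∈ p (i + 1)) : v = 0 := by
  have := Submodule.disjoint_def.mp hp.disjoint
  rcases ZMod.two_cases i with rfl | rfl
  · exact this v h (by simpa using h')
  · exact this v h' h

theorem IsCompl.exists_add (hp : IsCompl (p 0) (p 1)) (i : ZMod 2) (v : V) :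
    ∃ x ∈ p i, ∃ y ∈ p (i + 1), x + y = v := by
  obtain ⟨x, hx, y, hy, h⟩ := Submodule.mem_sup.mp
    (hp.sup_eq_top ▸ Submodule.mem_top : v ∈ p 0 ⊔ p 1)
  rcases ZMod.two_cases i with rfl | rfl
  · exact ⟨x, hx, y, by simpa using hy, h⟩
  · exact ⟨y, hy, x, by simpa [ZMod.two_add_self] using hx, by rw [add_comm, h]⟩

theorem IsCompl.induction (hp : IsCompl (p 0) (p 1)) {C : V → Prop}
    (hom : ∀ i, ∀ v ∈ p i, C v) (add : ∀ v w, C v → C w → C (v + w)) (v : V) : C v := by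
  obtain ⟨x, hx, y, hy, rfl⟩ := hp.exists_add 0 v
  exact add _ _ (hom _ _ hx) (hom _ _ hy)

/-- An injective even map reflects degrees. -/
theorem IsCompl.mem_of_map_mem (hp : IsCompl (p 0) (p 1)) (hq : IsCompl (q 0) (q 1))
    {f : V →+ W} (hf : Function.Injective f) (he : ∀ i, ∀ v ∈ p i, f v ∈ q i) {i : ZMod 2} {v : V}
    (h : f v ∈ q i) : v ∈ p i := by
  obtain ⟨x, hx, y, hy, rfl⟩ := hp.exists_add i v
  have h1 : f y ∈ q i := by
    have := sub_mem h (he _ _ hx)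
    rwa [map_add, add_sub_cancel_left] at this
  have h2 : y = 0 := hf (by rw [map_zero]; exact hq.eq_zero_of_mem h1 (he _ _ hy))
  rwa [h2, add_zero]

end Grading

namespace GrMod

variable {K : Type u} [Field K] {A : SuperAlg K}

instance (M : GrMod A) : SMulCommClass K A M := IsScalarTower.to_smulCommClass

instance (M : GrMod A) : SMulCommClass A K M := IsScalarTower.to_smulCommClass'

@[ext]
theorem hom_ext {M N : GrMod A} {f g : M ⟶ N} (h : ∀ m, f.1 m = g.1 m) : f = g :=
  Subtype.ext (LinearMap.ext h)

/-- A bijective even homomorphism is an isomorphism of graded modules. -/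
noncomputable def isoOfBijective {M N : GrMod A} (f : M ⟶ N) (hf : Function.Bijective f.1) :
    M ≅ N where
  hom := f
  inv := ⟨((LinearEquiv.ofBijective f.1 hf).symm : N →ₗ[K] M), by
    constructor
    · intro i n hn
      refine M.isCompl.mem_of_map_mem N.isCompl (f := (f.1 : M →+ N)) hf.1 f.2.1 ?_
      change f.1 ((LinearEquiv.ofBijective f.1 hf).symm n) ∈ _
      rwa [← LinearEquiv.ofBijective_apply f.1 (hf := hf), LinearEquiv.apply_symm_apply]
    · intro a n
      apply hf.1
      change f.1 ((LinearEquiv.ofBijective f.1 hf).symm (a • n)) =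
        f.1 (a • (LinearEquiv.ofBijective f.1 hf).symm n)
      rw [f.2.2, ← LinearEquiv.ofBijective_apply f.1 (hf := hf),
        ← LinearEquiv.ofBijective_apply f.1 (hf := hf), LinearEquiv.apply_symm_apply,
        LinearEquiv.apply_symm_apply]⟩
  hom_inv_id := by
    ext m
    exact (LinearEquiv.ofBijective f.1 hf).symm_apply_apply m
  inv_hom_id := by
    ext m
    exact (LinearEquiv.ofBijective f.1 hf).apply_symm_apply m

/-- The homogeneous projection of degree `i` of a graded module. -/
noncomputable def proj (M : GrMod A) (i : ZMod 2) : M →ₗ[K] M :=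
  if i = 0 then (M.part 0).projection (M.part 1) M.isCompl
  else (M.part 1).projection (M.part 0) M.isCompl.symm

theorem proj_mem (M : GrMod A) (i : ZMod 2) (m : M) : M.proj i m ∈ M.part i := by
  rcases ZMod.two_cases i with rfl | rfl
  · exact Submodule.projection_apply_mem M.isCompl m
  · exact Submodule.projection_apply_mem M.isCompl.symm m

theorem proj_of_mem (M : GrMod A) {i : ZMod 2} {m : M} (h : m ∈ M.part i) : M.proj i m = m := by
  rcases ZMod.two_cases i with rfl | rfl
  · exact Submodule.projection_apply_left M.isCompl ⟨m, h⟩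
  · exact Submodule.projection_apply_left M.isCompl.symm ⟨m, h⟩

theorem proj_of_mem_ne (M : GrMod A) {i j : ZMod 2} {m : M} (h : m ∈ M.part i) (hij : i ≠ j) :
    M.proj j m = 0 := by
  rcases ZMod.two_cases i with rfl | rfl <;> rcases ZMod.two_cases j with rfl | rfl
  · exact absurd rfl hij
  · exact (Submodule.projection_apply_eq_zero_iff M.isCompl.symm).mpr h
  · exact (Submodule.projection_apply_eq_zero_iff M.isCompl).mpr h
  · exact absurd rfl hij

theorem proj_add_proj (M : GrMod A) (i : ZMod 2) (m : M) :
    M.proj i m + M.proj (i + 1) m = m := by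
  obtain ⟨x, hx, y, hy, rfl⟩ := M.isCompl.exists_add i m
  rw [map_add, map_add, M.proj_of_mem hx, M.proj_of_mem hy, M.proj_of_mem_ne hx (by simp),
    M.proj_of_mem_ne hy (by simp)]
  simp

theorem proj_smul (M : GrMod A) {i : ZMod 2} (j : ZMod 2) {a : A} (h : a ∈ A.part i) (m : M) :
    M.proj (i + j) (a • m) = a • M.proj j m := by
  obtain ⟨x, hx, y, hy, rfl⟩ := M.isCompl.exists_add j m
  rw [smul_add, map_add, map_add, M.proj_of_mem hx, M.proj_of_mem_ne hy (by simp),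
    M.proj_of_mem (M.smul_mem h hx), M.proj_of_mem_ne (M.smul_mem h hy) (by simp)]
  simp

end GrMod

namespace SuperAlg

variable {K : Type u} [Field K]

/-! ### Full corners and the equivalence of module categories -/

/-- A presentation of the superalgebra `B` as a full corner `e A e` of `A`: an injective even
multiplicative linear map `B → A`, not preserving the unit, whose image is `e A e` for the
idempotent `e`, the image of `1`, such that `1` is a sum of products `x e y` of even elements with
`x`, `y` homogeneous of the same degree. -/
structure CornerEmbedding (A B : SuperAlg K) where
  toHom : B →ₙₐ[K] A
  injective : Function.Injective toHom
  map_mem : ∀ i, ∀ b ∈ B.part i, toHom b ∈ A.part i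
  exists_eq : ∀ a : A, ∃ b : B, toHom b = toHom 1 * a * toHom 1
  full : (1 : A) ∈ Submodule.span K
    {z : A | ∃ i, ∃ x ∈ A.part i, ∃ y ∈ A.part i, z = x * toHom 1 * y}

namespace CornerEmbedding

variable {A B C : SuperAlg K} (c : CornerEmbedding A B)

/-- The idempotent of a corner. -/
def idem : A := c.toHom 1

theorem idem_mul (b : B) : c.idem * c.toHom b = c.toHom b := by
  rw [idem, ← map_mul, one_mul]

theorem mul_idem (b : B) : c.toHom b * c.idem = c.toHom b := by
  rw [idem, ← map_mul, mul_one]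

theorem idem_mul_idem : c.idem * c.idem = c.idem := c.idem_mul 1

theorem idem_mem : c.idem ∈ A.part 0 := c.map_mem 0 1 B.one_mem

theorem map_smul' (k : K) (b : B) : c.toHom (k • b) = k • c.toHom b := map_smul c.toHom k b

/-- An even isomorphism is a corner embedding with idempotent `1`. -/
noncomputable def ofIso (f : B ≃ₐ[K] A) (hf : ∀ i, ∀ b ∈ B.part i, f b ∈ A.part i) :
    CornerEmbedding A B where
  toHom := (f : B →ₙₐ[K] A)
  injective := f.injective
  map_mem := hf
  exists_eq a := ⟨f.symm a, by
    change f _ = f 1 * a * f 1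
    simp⟩
  full := Submodule.subset_span ⟨0, 1, A.one_mem, 1, A.one_mem, by
    change 1 = 1 * f 1 * 1
    simp⟩

/-- A full corner of a full corner is a full corner. -/
def trans (c : CornerEmbedding A B) (d : CornerEmbedding B C) : CornerEmbedding A C where
  toHom := c.toHom.comp d.toHom
  injective := c.injective.comp d.injective
  map_mem i x hx := c.map_mem i _ (d.map_mem i x hx)
  exists_eq a := by
    obtain ⟨b, hb⟩ := c.exists_eq a
    obtain ⟨x, hx⟩ := d.exists_eq b
    refine ⟨x, ?_⟩
    change c.toHom (d.toHom x) = c.toHom (d.toHom 1) * a * c.toHom (d.toHom 1)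
    rw [hx, map_mul, map_mul, hb]
    have h1 : c.toHom (d.toHom 1) * c.toHom 1 = c.toHom (d.toHom 1) := c.mul_idem _
    have h2 : c.toHom 1 * c.toHom (d.toHom 1) = c.toHom (d.toHom 1) := c.idem_mul _
    calc _ = (c.toHom (d.toHom 1) * c.toHom 1) * a * (c.toHom 1 * c.toHom (d.toHom 1)) := by
          noncomm_ring
      _ = _ := by rw [h1, h2]
  full := by
    change (1 : A) ∈ Submodule.span K {z : A | ∃ i, ∃ x ∈ A.part i, ∃ y ∈ A.part i,
      z = x * c.toHom (d.toHom 1) * y}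
    have key : ∀ b ∈ Submodule.span K {z : B | ∃ i, ∃ x ∈ B.part i, ∃ y ∈ B.part i,
        z = x * d.toHom 1 * y}, ∀ i, ∀ x ∈ A.part i, ∀ y ∈ A.part i, x * c.toHom b * y ∈
        Submodule.span K {z : A | ∃ i, ∃ x ∈ A.part i, ∃ y ∈ A.part i,
          z = x * c.toHom (d.toHom 1) * y} := by
      intro b hb i x hx y hy
      induction hb using Submodule.span_induction with
      | zero => simp
      | add b b' _ _ h h' => rw [map_add, mul_add, add_mul]; exact add_mem h h'
      | smul k b _ h =>
        rw [c.map_smul', mul_smul_comm, smul_mul_assoc]; exact Submodule.smul_mem _ _ h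
      | mem b hb =>
        obtain ⟨j, x', hx', y', hy', rfl⟩ := hb
        refine Submodule.subset_span ⟨i + j, x * c.toHom x', A.mul_mem hx (c.map_mem _ _ hx'),
          c.toHom y' * y, ?_, ?_⟩
        · rw [add_comm]; exact A.mul_mem (c.map_mem _ _ hy') hy
        · rw [map_mul, map_mul]; noncomm_ring
    have := c.full
    refine Submodule.span_le.mpr ?_ this
    rintro _ ⟨i, x, hx, y, hy, rfl⟩
    exact key 1 d.full i x hx y hy

/-- The subspace `e M` of a graded `A`-module. -/
def fixed (M : GrMod A) : Submodule K M where
  carrier := {m | c.idem • m = m}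
  zero_mem' := smul_zero _
  add_mem' {m n} hm hn := by
    change c.idem • (m + n) = m + n
    rw [smul_add, hm, hn]
  smul_mem' k m hm := by
    change c.idem • k • m = k • m
    rw [smul_comm, hm]

theorem mem_fixed {M : GrMod A} {m : M} : m ∈ c.fixed M ↔ c.idem • m = m := Iff.rfl

theorem toHom_smul_mem (M : GrMod A) (b : B) (m : M) : c.toHom b • m ∈ c.fixed M := by
  rw [mem_fixed, smul_smul, idem_mul]

theorem idem_smul_mem (M : GrMod A) (m : M) : c.idem • m ∈ c.fixed M := c.toHom_smul_mem M 1 m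

/-- The action of `B` on `e M`. -/
abbrev fixedModule (M : GrMod A) : Module B (c.fixed M) where
    smul := fun b m => ⟨c.toHom b • (m : M), c.toHom_smul_mem M b m⟩
    one_smul := fun m => Subtype.ext m.2
    mul_smul := fun b b' m => Subtype.ext <| by
      change c.toHom (b * b') • (m : M) = c.toHom b • c.toHom b' • (m : M)
      rw [map_mul, mul_smul]
    smul_zero := fun b => Subtype.ext (smul_zero _)
    smul_add := fun b m n => Subtype.ext (smul_add _ _ _)
    add_smul := fun b b' m => Subtype.ext <| by
      change c.toHom (b + b') • (m : M) = c.toHom b • (m : M) + c.toHom b' • (m : M)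
      rw [map_add, add_smul]
    zero_smul := fun m => Subtype.ext <| by
      change c.toHom 0 • (m : M) = 0
      rw [map_zero, zero_smul]

/-- The graded `B`-module `e M`. -/
noncomputable abbrev fixedMod (M : GrMod A) : GrMod B where
  carrier := c.fixed M
  module := c.fixedModule M
  isScalarTower := by
    refine @IsScalarTower.mk K B (c.fixed M) _ (c.fixedModule M).toSMul _ fun k b m =>
      Subtype.ext ?_
    change c.toHom (k • b) • (m : M) = k • c.toHom b • (m : M)
    rw [c.map_smul', smul_assoc]
  part i := (M.part i).comap (c.fixed M).subtype
  isCompl := by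
    constructor
    · rw [Submodule.disjoint_def]
      intro m h0 h1
      exact Subtype.ext (M.isCompl.eq_zero_of_mem h0 (by simpa using h1))
    · rw [codisjoint_iff, eq_top_iff]
      intro m _
      obtain ⟨x, hx, y, hy, h⟩ := M.isCompl.exists_add 0 (m : M)
      refine Submodule.mem_sup.mpr ⟨⟨c.idem • x, c.idem_smul_mem M x⟩,
        zero_add (0 : ZMod 2) ▸ M.smul_mem c.idem_mem hx,
        ⟨c.idem • y, c.idem_smul_mem M y⟩, M.smul_mem c.idem_mem hy,
        Subtype.ext ?_⟩
      change c.idem • x + c.idem • y = m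
      rw [← smul_add, h]
      exact m.2
  smul_mem {i j b m} hb hm := M.smul_mem (c.map_mem i b hb) hm

/-- The functor `M ↦ e M` from graded `A`-modules to graded `B`-modules. -/
noncomputable def fixedFunctor : GrMod A ⥤ GrMod B where
  obj M := c.fixedMod M
  map {M N} f := ⟨f.1.restrict (p := c.fixed M) (q := c.fixed N) (fun m hm => by
      rw [mem_fixed, ← f.2.2, c.mem_fixed.mp hm]),
    fun i m hm => f.2.1 i _ hm, fun b m => Subtype.ext (f.2.2 _ _)⟩
  map_id M := rfl
  map_comp f g := rfl

/-- The space of `B`-linear maps from `A` (with `B` acting from the left through the corner) to a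
graded `B`-module. Such maps vanish on `(1 - e) A`, so these are the `B`-linear maps `e A → N`. -/
def coind (N : GrMod B) : Submodule K (A →ₗ[K] N) where
  carrier := {f | ∀ (b : B) (x : A), f (c.toHom b * x) = b • f x}
  zero_mem' b x := by simp
  add_mem' {f g} hf hg b x := by simp [hf b x, hg b x]
  smul_mem' k f hf b x := by
    rw [LinearMap.smul_apply, LinearMap.smul_apply, hf b x, smul_comm]

theorem coind_apply_idem_mul (N : GrMod B) (f : c.coind N) (x : A) :
    f.1 (c.idem * x) = f.1 x := by
  rw [idem, f.2, one_smul]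

/-- The degree `k` part of the coinduced module: the maps that raise degrees by `k`. -/
def coindPart (N : GrMod B) (k : ZMod 2) : Submodule K (c.coind N) where
  carrier := {f | ∀ i, ∀ x ∈ A.part i, f.1 x ∈ N.part (i + k)}
  zero_mem' _ _ _ := zero_mem _
  add_mem' hf hg i x hx := add_mem (hf i x hx) (hg i x hx)
  smul_mem' r _ hf i x hx := Submodule.smul_mem _ r (hf i x hx)

/-- The degree `k` component of a linear map `A → N`. -/
noncomputable def homProj (N : GrMod B) (k : ZMod 2) (f : A →ₗ[K] N) : A →ₗ[K] N :=
  N.proj k ∘ₗ f ∘ₗ A.proj 0 + N.proj (1 + k) ∘ₗ f ∘ₗ A.proj 1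

theorem homProj_apply (N : GrMod B) (k : ZMod 2) (f : A →ₗ[K] N) {i : ZMod 2} {x : A}
    (hx : x ∈ A.part i) : homProj N k f x = N.proj (i + k) (f x) := by
  change N.proj k (f (A.proj 0 x)) + N.proj (1 + k) (f (A.proj 1 x)) = _
  rcases ZMod.two_cases i with rfl | rfl
  · rw [A.proj_of_mem_ne (j := 1) hx (by decide), A.proj_of_mem hx, map_zero, map_zero, add_zero,
      zero_add]
  · rw [A.proj_of_mem_ne (j := 0) hx (by decide), A.proj_of_mem hx, map_zero, map_zero, zero_add]

theorem homProj_mem (N : GrMod B) (k : ZMod 2) (f : c.coind N) : homProj N k f.1 ∈ c.coind N := by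
  intro b x
  induction b using B.isCompl.induction with
  | add b b' hb hb' => rw [map_add, add_mul, map_add, hb, hb', add_smul]
  | hom i b hb =>
    induction x using A.isCompl.induction with
    | add x x' hx hx' => rw [mul_add, map_add, hx, hx', map_add, smul_add]
    | hom j x hx =>
      rw [homProj_apply N k _ (A.mul_mem (c.map_mem i b hb) hx), homProj_apply N k _ hx, f.2,
        add_assoc, N.proj_smul _ hb]

/-- The degree `k` component of an element of the coinduced module. -/
noncomputable def coindProj (N : GrMod B) (k : ZMod 2) (f : c.coind N) : c.coind N :=
  ⟨homProj N k f.1, c.homProj_mem N k f⟩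

theorem coindProj_mem (N : GrMod B) (k : ZMod 2) (f : c.coind N) :
    c.coindProj N k f ∈ c.coindPart N k := by
  intro i x hx
  change homProj N k f.1 x ∈ _
  rw [homProj_apply N k _ hx]
  exact N.proj_mem _ _

theorem coindProj_add (N : GrMod B) (f : c.coind N) :
    c.coindProj N 0 f + c.coindProj N 1 f = f := by
  refine Subtype.ext (LinearMap.ext fun x => ?_)
  change homProj N 0 f.1 x + homProj N 1 f.1 x = f.1 x
  induction x using A.isCompl.induction with
  | add x y hx hy => rw [map_add, map_add, map_add, add_add_add_comm, hx, hy]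
  | hom i x hx => rw [homProj_apply N _ _ hx, homProj_apply N _ _ hx, add_zero, N.proj_add_proj]

/-- The action of `A` on coinduced modules, `(a f)(x) = f (x a)`. -/
abbrev coindModule (N : GrMod B) : Module A (c.coind N) where
    smul := fun a f => ⟨f.1 ∘ₗ LinearMap.mulRight K a, fun b x => by
      change f.1 (c.toHom b * x * a) = b • f.1 (x * a)
      rw [mul_assoc, f.2]⟩
    one_smul := fun f => Subtype.ext (LinearMap.ext fun x => congrArg f.1 (mul_one x))
    mul_smul := fun a a' f => Subtype.ext (LinearMap.ext fun x =>
      congrArg f.1 (mul_assoc x a a').symm)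
    smul_zero := fun a => rfl
    smul_add := fun a f g => rfl
    add_smul := fun a a' f => Subtype.ext (LinearMap.ext fun x => by
      change f.1 (x * (a + a')) = f.1 (x * a) + f.1 (x * a')
      rw [mul_add, map_add])
    zero_smul := fun f => Subtype.ext (LinearMap.ext fun x => by
      change f.1 (x * 0) = 0
      rw [mul_zero, map_zero])

/-- The graded `A`-module coinduced from a graded `B`-module, with `(a f)(x) = f (x a)`. -/
noncomputable abbrev coindMod (N : GrMod B) : GrMod A where
  carrier := c.coind N
  module := c.coindModule N
  isScalarTower := by
    refine @IsScalarTower.mk K A (c.coind N) _ (c.coindModule N).toSMul _ fun k a f =>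
      Subtype.ext (LinearMap.ext fun x => ?_)
    change f.1 (x * k • a) = k • f.1 (x * a)
    rw [mul_smul_comm, map_smul]
  part := c.coindPart N
  isCompl := by
    constructor
    · rw [Submodule.disjoint_def]
      intro f h0 h1
      refine Subtype.ext (LinearMap.ext fun x => ?_)
      induction x using A.isCompl.induction with
      | add x y hx hy => rw [map_add, map_add, hx, hy]
      | hom i x hx =>
        exact N.isCompl.eq_zero_of_mem (by simpa using h0 i x hx) (h1 i x hx)
    · rw [codisjoint_iff, eq_top_iff]
      intro f _
      exact Submodule.mem_sup.mpr ⟨_, c.coindProj_mem N 0 f, _, c.coindProj_mem N 1 f,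
        c.coindProj_add N f⟩
  smul_mem {i j a f} ha hf k x hx := by
    have := hf _ _ (A.mul_mem hx ha)
    rwa [add_assoc] at this

/-- Coinduction as a functor from graded `B`-modules to graded `A`-modules. -/
noncomputable def coindFunctor : GrMod B ⥤ GrMod A where
  obj N := c.coindMod N
  map {N N'} g := ⟨(LinearMap.compRight K g.1).restrict (p := c.coind N) (q := c.coind N')
      (fun f hf b x => by
        change g.1 (f (c.toHom b * x)) = b • g.1 (f x)
        rw [hf, g.2.2]),
    fun k f hf i x hx => g.2.1 _ _ (hf i x hx), fun a f => rfl⟩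
  map_id N := rfl
  map_comp f g := rfl

/-- The canonical map `M → Hom_B (e A, e M)`, sending `m` to `x ↦ (e x) m`. -/
noncomputable def unitHom (M : GrMod A) : M ⟶ c.coindFunctor.obj (c.fixedFunctor.obj M) :=
  ⟨{ toFun := fun m => ⟨
      { toFun := fun x => ⟨(c.idem * x) • m, by rw [mul_smul]; exact c.idem_smul_mem M _⟩
        map_add' := fun x y => Subtype.ext (by
          change (c.idem * (x + y)) • m = (c.idem * x) • m + (c.idem * y) • m
          rw [mul_add, add_smul])
        map_smul' := fun k x => Subtype.ext (by
          change (c.idem * (k • x)) • m = k • (c.idem * x) • m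
          rw [mul_smul_comm, smul_assoc]) },
      fun b x => Subtype.ext (by
        change (c.idem * (c.toHom b * x)) • m = c.toHom b • (c.idem * x) • m
        rw [smul_smul, ← mul_assoc, ← mul_assoc, idem_mul, mul_idem])⟩
     map_add' := fun m n => Subtype.ext (LinearMap.ext fun x => Subtype.ext (smul_add _ _ _))
     map_smul' := fun k m => Subtype.ext (LinearMap.ext fun x => Subtype.ext (smul_comm _ _ _)) },
   fun i m hm j x hx => M.smul_mem (by simpa using A.mul_mem c.idem_mem hx) hm,
   fun a m => Subtype.ext (LinearMap.ext fun x => Subtype.ext (by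
     change (c.idem * x) • a • m = (c.idem * (x * a)) • m
     rw [smul_smul, mul_assoc]))⟩

theorem unitHom_apply (M : GrMod A) (m : M) (x : A) :
    (c.fixed M).subtype (((c.unitHom M).1 m).1 x) = (c.idem * x) • m := rfl

/-- The canonical map `M → Hom_B (e A, e M)` is bijective because `e` is full. -/
theorem unitHom_bijective (M : GrMod A) : Function.Bijective (c.unitHom M).1 := by
  constructor
  · rw [← LinearMap.ker_eq_bot, LinearMap.ker_eq_bot']
    intro m hm
    have h1 : ∀ x : A, (c.idem * x) • m = 0 := fun x => by
      rw [← c.unitHom_apply M m x, hm]; rfl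
    have h2 : ∀ z ∈ Submodule.span K {z : A | ∃ i, ∃ x ∈ A.part i, ∃ y ∈ A.part i,
        z = x * c.toHom 1 * y}, z • m = 0 := by
      intro z hz
      induction hz using Submodule.span_induction with
      | zero => exact zero_smul _ _
      | add y z _ _ hy hz => rw [add_smul, hy, hz, add_zero]
      | smul k z _ hz => rw [smul_assoc, hz, smul_zero]
      | mem z hz =>
        obtain ⟨_, x, _, y, _, rfl⟩ := hz
        rw [mul_assoc, mul_smul]
        exact (congrArg (x • ·) (h1 y)).trans (smul_zero x)
    simpa using h2 1 c.full
  · intro f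
    -- for `z = x e y`, the map `w ↦ f (w z)` comes from the element `x f(y)` of `M`
    have key : ∀ z ∈ Submodule.span K {z : A | ∃ i, ∃ x ∈ A.part i, ∃ y ∈ A.part i,
        z = x * c.toHom 1 * y}, ∃ m : M, ∀ x : A, (c.fixed M).subtype (f.1 (x * z)) =
          (c.idem * x) • m := by
      intro z hz
      induction hz using Submodule.span_induction with
      | zero => exact ⟨0, fun x => by rw [mul_zero, map_zero, smul_zero]; rfl⟩
      | add y z _ _ hy hz =>
        obtain ⟨m, hm⟩ := hy
        obtain ⟨n, hn⟩ := hz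
        exact ⟨m + n, fun x => by rw [mul_add, map_add, smul_add, ← hm, ← hn]; rfl⟩
      | smul k z _ hz =>
        obtain ⟨m, hm⟩ := hz
        exact ⟨k • m, fun x => by rw [mul_smul_comm, map_smul, smul_comm, ← hm]; rfl⟩
      | mem z hz =>
        obtain ⟨_, x, _, y, _, rfl⟩ := hz
        refine ⟨x • (c.fixed M).subtype (f.1 y), fun w => ?_⟩
        obtain ⟨b, hb⟩ := c.exists_eq (w * x)
        have h1 : f.1 (w * (x * c.toHom 1 * y)) = b • f.1 y := by
          rw [← f.2, hb, ← c.coind_apply_idem_mul _ f, idem]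
          congr 1
          noncomm_ring
        have h2 : c.idem • (c.fixed M).subtype (f.1 y) = (c.fixed M).subtype (f.1 y) :=
          Subtype.property (p := (· ∈ c.fixed M)) (f.1 y)
        calc (c.fixed M).subtype (f.1 (w * (x * c.toHom 1 * y)))
            = c.toHom b • (c.fixed M).subtype (f.1 y) := by rw [h1]; rfl
          _ = (c.idem * (w * x)) • c.idem • (c.fixed M).subtype (f.1 y) := by
            rw [hb, mul_smul]; rfl
          _ = (c.idem * w) • x • (c.fixed M).subtype (f.1 y) := by
            rw [h2, ← mul_assoc, mul_smul]
    obtain ⟨m, hm⟩ := key 1 c.full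
    refine ⟨m, Subtype.ext (LinearMap.ext fun x => Subtype.ext ?_)⟩
    have h := hm x
    rw [mul_one] at h
    exact h.symm

/-- The canonical map `e Hom_B (e A, N) → N`, the evaluation at `1`. -/
noncomputable def counitHom (N : GrMod B) : c.fixedFunctor.obj (c.coindFunctor.obj N) ⟶ N :=
  ⟨(LinearMap.applyₗ (1 : A)) ∘ₗ (c.coind N).subtype ∘ₗ (c.fixed (c.coindMod N)).subtype,
   fun i f hf => by
    have := hf 0 1 A.one_mem
    rwa [zero_add] at this,
   fun b f => by
    change f.1.1 (1 * c.toHom b) = b • f.1.1 1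
    rw [← f.1.2, one_mul, mul_one]⟩

/-- An element of `e Hom_B (e A, N)` is a `B`-linear map on `e A e`, and this is `B`. -/
theorem counitHom_bijective (N : GrMod B) : Function.Bijective (c.counitHom N).1 := by
  -- a map fixed by `e` is determined by its values on `e A e`, the image of `B`
  have fix : ∀ (f : c.fixed (c.coindMod N)) (x : A) (b : B),
      c.toHom b = c.toHom 1 * x * c.toHom 1 → f.1.1 x = b • f.1.1 1 := by
    intro f x b hb
    have h1 : f.1.1 x = f.1.1 (x * c.idem) := by
      have := congrArg (fun g : c.coind N => g.1 x) (c.mem_fixed.mp f.2)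
      exact this.symm
    rw [h1, ← c.coind_apply_idem_mul, ← f.1.2, hb, ← mul_assoc, mul_one]
    rfl
  constructor
  · rw [← LinearMap.ker_eq_bot, LinearMap.ker_eq_bot']
    intro f hf
    refine Subtype.ext (Subtype.ext (LinearMap.ext fun x => ?_))
    obtain ⟨b, hb⟩ := c.exists_eq x
    rw [fix f x b hb]
    have : f.1.1 1 = 0 := hf
    rw [this, smul_zero]
    rfl
  · intro n
    choose β hβ using c.exists_eq
    have add : ∀ x y, β (x + y) = β x + β y := fun x y => c.injective (by
      rw [map_add, hβ, hβ, hβ]; noncomm_ring)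
    have smul : ∀ (k : K) x, β (k • x) = k • β x := fun k x => c.injective (by
      rw [c.map_smul', hβ, hβ, mul_smul_comm, smul_mul_assoc])
    let f : A →ₗ[K] N :=
      { toFun := fun x => β x • n
        map_add' := fun x y => by rw [add, add_smul]
        map_smul' := fun k x => by rw [smul, smul_assoc, RingHom.id_apply] }
    have hf : f ∈ c.coind N := fun b x => by
      change β _ • n = b • β x • n
      rw [smul_smul]
      congr 1
      apply c.injective
      rw [hβ, map_mul, hβ]
      have h1 : c.toHom 1 * c.toHom b = c.toHom b := c.idem_mul b
      have h2 : c.toHom b * c.toHom 1 = c.toHom b := c.mul_idem b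
      simp only [← mul_assoc, h1, h2]
    have hf' : (⟨f, hf⟩ : c.coind N) ∈ c.fixed (c.coindMod N) := by
      refine Subtype.ext (LinearMap.ext fun x => ?_)
      change β (x * c.idem) • n = β x • n
      congr 1
      apply c.injective
      rw [hβ, hβ, ← mul_assoc, mul_assoc _ c.idem, ← idem, idem_mul_idem]
    refine ⟨⟨⟨f, hf⟩, hf'⟩, ?_⟩
    change β 1 • n = n
    have : β 1 = 1 := c.injective (by rw [hβ, mul_one]; exact c.idem_mul_idem)
    rw [this, one_smul]

/-- Graded modules over a superalgebra are equivalent to graded modules over a full corner. -/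
noncomputable def equivalence : GrMod A ≌ GrMod B :=
  CategoryTheory.Equivalence.mk c.fixedFunctor c.coindFunctor
    (NatIso.ofComponents
      (fun M => GrMod.isoOfBijective (c.unitHom M) (c.unitHom_bijective M))
      (fun {M N} f => by
        ext m
        refine Subtype.ext (LinearMap.ext fun x => Subtype.ext ?_)
        exact (f.2.2 _ _).symm))
    (NatIso.ofComponents
      (fun N => GrMod.isoOfBijective (c.counitHom N) (c.counitHom_bijective N))
      (fun {M N} f => by ext m; rfl))

theorem equivalence_functor_additive : c.equivalence.functor.Additive where
  map_add := rfl

theorem equivalence_functor_linear :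
    letI := c.equivalence_functor_additive
    c.equivalence.functor.Linear K where
  map_smul _ _ := rfl

end CornerEmbedding

end SuperAlg

namespace SuperAlg

variable {K : Type u} [Field K]

/-! ### Twisting a superalgebra by a shift -/

theorem twist_of_mem_zero (A : SuperAlg K) (S : Shift) {a : A} (h : a ∈ A.part 0) :
    A.twist S a = a := by
  cases S
  · exact A.parity_of_mem_zero h
  · rfl

theorem proj_zero_mul (A : SuperAlg K) (a b : A) :
    A.proj 0 (a * b) = A.proj 0 a * A.proj 0 b + A.proj 1 a * A.proj 1 b := by
  conv_lhs => rw [← A.proj_add_proj a, ← A.proj_add_proj b]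
  simp only [add_mul, mul_add, map_add]
  rw [A.proj_of_mem (i := 0) (A.mul_mem (A.proj_mem 0 a) (A.proj_mem 0 b)),
    A.proj_of_mem (i := 0) (A.mul_mem (A.proj_mem 1 a) (A.proj_mem 1 b)),
    A.proj_of_mem_ne (A.mul_mem (A.proj_mem 1 a) (A.proj_mem 0 b)) (by decide),
    A.proj_of_mem_ne (A.mul_mem (A.proj_mem 0 a) (A.proj_mem 1 b)) (by decide)]
  simp

theorem proj_one_mul (A : SuperAlg K) (a b : A) :
    A.proj 1 (a * b) = A.proj 0 a * A.proj 1 b + A.proj 1 a * A.proj 0 b := by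
  conv_lhs => rw [← A.proj_add_proj a, ← A.proj_add_proj b]
  simp only [add_mul, mul_add, map_add]
  rw [A.proj_of_mem_ne (A.mul_mem (A.proj_mem 0 a) (A.proj_mem 0 b)) (by decide),
    A.proj_of_mem_ne (A.mul_mem (A.proj_mem 1 a) (A.proj_mem 1 b)) (by decide),
    A.proj_of_mem (i := 1) (A.mul_mem (A.proj_mem 1 a) (A.proj_mem 0 b)),
    A.proj_of_mem (i := 1) (A.mul_mem (A.proj_mem 0 a) (A.proj_mem 1 b))]
  simp [add_comm]

/-- An even linear isomorphism that identifies `A'` with `A` carrying the multiplication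
`a ⋆ c = a c₀ + S(a) c₁`, where `S(a)` is `a` for `σ` and `(-1) ^ |a| a` for `π`. This is the
multiplication of `End^S_A(A)`: for `σ` it is that of `A`, and for `π` the product of two odd
elements changes its sign. -/
structure Twist (S : Shift) (A A' : SuperAlg K) where
  toEquiv : A ≃ₗ[K] A'
  map_mem : ∀ i, ∀ a ∈ A.part i, toEquiv a ∈ A'.part i
  map_mul : ∀ a c, toEquiv a * toEquiv c = toEquiv (a * A.proj 0 c + A.twist S a * A.proj 1 c)

namespace Twist

variable {S : Shift} {A A' : SuperAlg K}

/-- For `σ` nothing changes. -/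
def sigmaRefl (A : SuperAlg K) : Twist .sigma A A where
  toEquiv := LinearEquiv.refl K A
  map_mem _ _ h := h
  map_mul a c := by
    change a * c = a * A.proj 0 c + a * A.proj 1 c
    rw [← mul_add, A.proj_add_proj]

variable (t : Twist S A A')

theorem map_mul_of_even (a : A) {c : A} (hc : c ∈ A.part 0) :
    t.toEquiv (a * c) = t.toEquiv a * t.toEquiv c := by
  rw [t.map_mul, A.proj_of_mem hc, A.proj_of_mem_ne hc (by decide), mul_zero, add_zero]

theorem map_twist_mul_of_odd (a : A) {c : A} (hc : c ∈ A.part 1) :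
    t.toEquiv (A.twist S a * c) = t.toEquiv a * t.toEquiv c := by
  rw [t.map_mul, A.proj_of_mem hc, A.proj_of_mem_ne hc (by decide), mul_zero, zero_add]

theorem map_one : t.toEquiv 1 = 1 := by
  have h := t.map_mul_of_even (t.toEquiv.symm 1) A.one_mem
  rwa [mul_one, LinearEquiv.apply_symm_apply, one_mul, eq_comm] at h

theorem symm_mem {i : ZMod 2} {a : A'} (h : a ∈ A'.part i) : t.toEquiv.symm a ∈ A.part i := by
  refine A.isCompl.mem_of_map_mem A'.isCompl (f := (t.toEquiv : A →+ A')) t.toEquiv.injective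
    t.map_mem ?_
  change t.toEquiv (t.toEquiv.symm a) ∈ _
  rwa [LinearEquiv.apply_symm_apply]

theorem map_proj (i : ZMod 2) (a : A) : t.toEquiv (A.proj i a) = A'.proj i (t.toEquiv a) := by
  induction a using A.isCompl.induction with
  | add a b ha hb => simp only [map_add, ha, hb]
  | hom j a ha =>
    by_cases h : j = i
    · subst h
      rw [A.proj_of_mem ha, A'.proj_of_mem (t.map_mem _ _ ha)]
    · rw [A.proj_of_mem_ne ha h, A'.proj_of_mem_ne (t.map_mem _ _ ha) h, map_zero]

end Twist

end SuperAlg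

namespace GrMod

variable {K : Type u} [Field K] {A : SuperAlg K}

/-- The left ideal `A e` of an idempotent `e`. -/
def leftIdeal (e : A) : Submodule A A where
  carrier := {x | x * e = x}
  zero_mem' := zero_mul e
  add_mem' {x y} hx hy := by
    change (x + y) * e = x + y
    rw [add_mul, hx, hy]
  smul_mem' a x hx := by
    change a * x * e = a * x
    rw [mul_assoc, hx]

theorem mem_leftIdeal {e x : A} : x ∈ leftIdeal e ↔ x * e = x := Iff.rfl

/-- The graded `A`-module `A e`, for an even idempotent `e`. -/
noncomputable abbrev idealMod (e : A) (he : IsIdempotentElem e) (h0 : e ∈ A.part 0) :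
    GrMod A where
  carrier := leftIdeal e
  part i := (A.part i).comap ((leftIdeal e).subtype.restrictScalars K)
  isCompl := by
    constructor
    · rw [Submodule.disjoint_def]
      intro m h0 h1
      exact Subtype.ext (A.isCompl.eq_zero_of_mem h0 (by rwa [zero_add]))
    · rw [codisjoint_iff, eq_top_iff]
      intro m _
      obtain ⟨x, hx, y, hy, h⟩ := A.isCompl.exists_add 0 (m : A)
      refine Submodule.mem_sup.mpr ⟨⟨x * e, by rw [mem_leftIdeal, mul_assoc, he]⟩,
        A.mul_mem hx h0, ⟨y * e, by rw [mem_leftIdeal, mul_assoc, he]⟩,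
        A.mul_mem hy h0, Subtype.ext ?_⟩
      change x * e + y * e = m
      rw [← add_mul, h]
      exact m.2
  smul_mem {i j a m} hb hm := A.mul_mem hb hm

/-- Right multiplication by `e`, as a retraction of `A` onto `A e`. -/
def leftIdealRetraction (e : A) (he : IsIdempotentElem e) : A →ₗ[A] leftIdeal e where
  toFun x := ⟨x * e, by rw [mem_leftIdeal, mul_assoc, he]⟩
  map_add' x y := Subtype.ext (add_mul x y e)
  map_smul' a x := Subtype.ext (mul_assoc a x e)

theorem leftIdealRetraction_comp (e : A) (he : IsIdempotentElem e) :
    leftIdealRetraction e he ∘ₗ (leftIdeal e).subtype = LinearMap.id :=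
  LinearMap.ext fun x => Subtype.ext x.2

theorem projective_leftIdeal (e : A) (he : IsIdempotentElem e) :
    Module.Projective A (leftIdeal e) :=
  Module.Projective.of_split _ _ (leftIdealRetraction_comp e he)

theorem finite_leftIdeal (e : A) (he : IsIdempotentElem e) : Module.Finite A (leftIdeal e) :=
  Module.Finite.of_surjective (leftIdealRetraction e he) fun x =>
    ⟨x, LinearMap.congr_fun (leftIdealRetraction_comp e he) x⟩

end GrMod

namespace SuperAlg

variable {K : Type u} [Field K]

namespace Twist

variable {S : Shift} {A A' B : SuperAlg K} (t : Twist S A A') (c : CornerEmbedding A' B)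

/-- The idempotent of a corner of `A'`, transported to `A`. -/
def idem : A := t.toEquiv.symm c.idem

theorem map_idem : t.toEquiv (t.idem c) = c.idem := t.toEquiv.apply_symm_apply _

theorem idem_mem : t.idem c ∈ A.part 0 := t.symm_mem c.idem_mem

theorem isIdempotentElem_idem : IsIdempotentElem (t.idem c) := t.toEquiv.injective <| by
  rw [t.map_mul_of_even _ (t.idem_mem c), t.map_idem, c.idem_mul_idem]

theorem mem_leftIdeal_iff {x : A} :
    x ∈ GrMod.leftIdeal (t.idem c) ↔ t.toEquiv x * c.idem = t.toEquiv x := by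
  rw [GrMod.mem_leftIdeal, ← t.toEquiv.injective.eq_iff, t.map_mul_of_even _ (t.idem_mem c),
    t.map_idem]

/-- The graded `A`-module `A e`. -/
noncomputable abbrev mod : GrMod A :=
  GrMod.idealMod (t.idem c) (t.isIdempotentElem_idem c) (t.idem_mem c)

/-- Right multiplication by an element of `B` on `A e`, with respect to the twisted
multiplication. -/
noncomputable def mulRight (b : B) : t.mod c →ₗ[K] t.mod c where
  toFun x := ⟨t.toEquiv.symm (t.toEquiv x.1 * c.toHom b), by
    rw [mem_leftIdeal_iff, LinearEquiv.apply_symm_apply, mul_assoc, c.mul_idem]⟩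
  map_add' x y := Subtype.ext (by
    change t.toEquiv.symm (t.toEquiv (x.1 + y.1) * _) = t.toEquiv.symm _ + t.toEquiv.symm _
    rw [map_add, add_mul, map_add])
  map_smul' k x := Subtype.ext (by
    change t.toEquiv.symm (t.toEquiv (k • x.1) * _) = k • t.toEquiv.symm _
    rw [map_smul, smul_mul_assoc, map_smul])

theorem map_mulRight (b : B) (x : t.mod c) :
    t.toEquiv (t.mulRight c b x).1 = t.toEquiv x.1 * c.toHom b := t.toEquiv.apply_symm_apply _

theorem mulRight_of_even {b : B} (hb : b ∈ B.part 0) (x : t.mod c) :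
    (t.mulRight c b x).1 = x.1 * t.toEquiv.symm (c.toHom b) := by
  apply t.toEquiv.injective
  rw [map_mulRight, t.map_mul_of_even _ (t.symm_mem (c.map_mem _ _ hb)),
    LinearEquiv.apply_symm_apply]

theorem mulRight_of_odd {b : B} (hb : b ∈ B.part 1) (x : t.mod c) :
    (t.mulRight c b x).1 = A.twist S x.1 * t.toEquiv.symm (c.toHom b) := by
  apply t.toEquiv.injective
  rw [map_mulRight, t.map_twist_mul_of_odd _ (t.symm_mem (c.map_mem _ _ hb)),
    LinearEquiv.apply_symm_apply]

theorem mulRight_mem {i : ZMod 2} {b : B} (hb : b ∈ B.part i) :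
    t.mulRight c b ∈ GrMod.twistedHomPart S (t.mod c) (t.mod c) i := by
  rcases ZMod.two_cases i with rfl | rfl
  · refine ⟨fun i x hx => ?_, fun a x => Subtype.ext ?_⟩
    · change (t.mulRight c b x).1 ∈ A.part i
      rw [t.mulRight_of_even c hb]
      exact add_zero i ▸ A.mul_mem hx (t.symm_mem (c.map_mem _ _ hb))
    · change (t.mulRight c b (a • x)).1 = a * (t.mulRight c b x).1
      rw [t.mulRight_of_even c hb, t.mulRight_of_even c hb]
      exact mul_assoc _ _ _
  · refine GrMod.mem_oddHom.mpr ⟨fun i x hx => ?_, fun a x => Subtype.ext ?_⟩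
    · change (t.mulRight c b x).1 ∈ A.part i
      rw [t.mulRight_of_odd c hb]
      have := A.mul_mem (A.twist_mem S hx) (t.symm_mem (c.map_mem _ _ hb))
      rwa [add_assoc, ZMod.two_add_self, add_zero] at this
    · change (t.mulRight c b (A.twist S a • x)).1 = a * (t.mulRight c b x).1
      rw [t.mulRight_of_odd c hb, t.mulRight_of_odd c hb]
      change A.twist S (A.twist S a * x.1) * _ = _
      rw [_root_.map_mul, A.twist_twist, mul_assoc]

theorem mulRight_add (b b' : B) :
    t.mulRight c (b + b') = t.mulRight c b + t.mulRight c b' :=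
  LinearMap.ext fun x => Subtype.ext (t.toEquiv.injective (by
    change t.toEquiv (t.mulRight c _ x).1 =
      t.toEquiv ((t.mulRight c _ x).1 + (t.mulRight c _ x).1)
    rw [map_add, map_mulRight, map_mulRight, map_mulRight, map_add, mul_add]))

theorem mulRight_smul (k : K) (b : B) : t.mulRight c (k • b) = k • t.mulRight c b :=
  LinearMap.ext fun x => Subtype.ext (t.toEquiv.injective (by
    change t.toEquiv (t.mulRight c _ x).1 = t.toEquiv (k • (t.mulRight c _ x).1)
    rw [map_smul, map_mulRight, map_mulRight, c.map_smul', mul_smul_comm]))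

theorem mulRight_one : t.mulRight c 1 = LinearMap.id :=
  LinearMap.ext fun x => Subtype.ext (t.toEquiv.injective (by
    rw [map_mulRight]
    exact (t.mem_leftIdeal_iff c).mp x.2))

theorem mulRight_mul (b b' : B) : t.mulRight c (b * b') = t.mulRight c b' ∘ₗ t.mulRight c b :=
  LinearMap.ext fun x => Subtype.ext (t.toEquiv.injective (by
    rw [LinearMap.comp_apply, map_mulRight, map_mulRight, map_mulRight, _root_.map_mul,
      mul_assoc]))

theorem mulRight_mem_twistedHom (b : B) :
    t.mulRight c b ∈ GrMod.twistedHom S (t.mod c) (t.mod c) := by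
  rw [← B.proj_add_proj b, mulRight_add]
  exact add_mem (Submodule.mem_sup_left (t.mulRight_mem c (B.proj_mem 0 b)))
    (Submodule.mem_sup_right (t.mulRight_mem c (B.proj_mem 1 b)))

/-- The action of `B` on `A e` by right multiplications, as a homomorphism into the twisted
endomorphism algebra. -/
noncomputable def endHom : B →ₐ[K] (t.mod c).twistedEnd S :=
  AlgHom.ofLinearMap
    (A := B) (B := ((t.mod c).twistedEnd S).carrier)
    { toFun := fun b => ⟨MulOpposite.op (t.mulRight c b), t.mulRight_mem_twistedHom c b⟩
      map_add' := fun b b' => Subtype.ext (MulOpposite.unop_injective (t.mulRight_add c b b'))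
      map_smul' := fun k b => Subtype.ext (MulOpposite.unop_injective (t.mulRight_smul c k b)) }
    (Subtype.ext (MulOpposite.unop_injective (t.mulRight_one c)))
    (fun b b' => Subtype.ext (MulOpposite.unop_injective (t.mulRight_mul c b b')))

theorem endHom_apply (b : B) : (t.endHom c b).1.unop = t.mulRight c b := rfl

/-- The idempotent as an element of `A e`. -/
def idemMod : t.mod c := ⟨t.idem c, t.isIdempotentElem_idem c⟩

theorem endHom_injective : Function.Injective (t.endHom c) := by
  intro b b' h
  have h1 : t.mulRight c b = t.mulRight c b' := by
    rw [← endHom_apply, ← endHom_apply, h]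
  have h2 : t.toEquiv (t.mulRight c b (t.idemMod c)).1 =
      t.toEquiv (t.mulRight c b' (t.idemMod c)).1 := by rw [h1]
  rw [map_mulRight, map_mulRight] at h2
  change t.toEquiv (t.idem c) * _ = t.toEquiv (t.idem c) * _ at h2
  rw [t.map_idem, c.idem_mul, c.idem_mul] at h2
  exact c.injective h2

theorem exists_mulRight_eq {i : ZMod 2} {f : t.mod c →ₗ[K] t.mod c}
    (hf : f ∈ GrMod.twistedHomPart S (t.mod c) (t.mod c) i) : ∃ b, t.mulRight c b = f := by
  -- `f` is determined by the image of `e`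
  set d : A := (f (t.idemMod c)).1 with hd
  have he := t.isIdempotentElem_idem c
  have hde : t.toEquiv d * c.idem = t.toEquiv d :=
    (t.mem_leftIdeal_iff c).mp (f (t.idemMod c)).2
  have main : ∀ x : t.mod c, t.toEquiv (f x).1 = t.toEquiv x.1 * t.toEquiv d := by
    intro x
    have hx : x.1 • t.idemMod c = x := Subtype.ext x.2
    rcases ZMod.two_cases i with rfl | rfl
    · have hd0 : d ∈ A.part 0 := hf.1 0 (t.idemMod c) (t.idem_mem c)
      rw [← t.map_mul_of_even _ hd0]
      congr 1
      conv_lhs => rw [← hx]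
      exact congrArg Subtype.val (hf.2 x.1 (t.idemMod c))
    · have hf' := GrMod.mem_oddHom.mp hf
      have hd1 : d ∈ A.part 1 := hf'.1 1 (t.idemMod c) (t.idem_mem c)
      rw [← t.map_twist_mul_of_odd _ hd1]
      congr 1
      conv_lhs => rw [← hx, ← A.twist_twist S x.1]
      exact congrArg Subtype.val (hf'.2 (A.twist S x.1) (t.idemMod c))
  have hed : c.idem * t.toEquiv d = t.toEquiv d := by
    have := main (t.idemMod c)
    rw [← hd] at this
    rw [← t.map_idem c]
    exact this.symm
  obtain ⟨b, hb⟩ := c.exists_eq (t.toEquiv d)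
  refine ⟨b, LinearMap.ext fun x => Subtype.ext (t.toEquiv.injective ?_)⟩
  rw [map_mulRight, main, hb]
  change _ * (c.idem * _ * c.idem) = _
  rw [hed, hde]

/-- Every twisted endomorphism of `A e` is a right multiplication by an element of `B`. -/
theorem endHom_bijective : Function.Bijective (t.endHom c) := by
  refine ⟨t.endHom_injective c, fun f => ?_⟩
  obtain ⟨f0, hf0, f1, hf1, hf⟩ := Submodule.mem_sup.mp
    (show f.1.unop ∈ GrMod.evenHom _ _ ⊔ GrMod.oddHom S _ _ from f.2)
  obtain ⟨b0, rfl⟩ := t.exists_mulRight_eq c (i := 0) hf0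
  obtain ⟨b1, rfl⟩ := t.exists_mulRight_eq c (i := 1) hf1
  refine ⟨b0 + b1, Subtype.ext (MulOpposite.unop_injective ?_)⟩
  rw [← hf, _root_.map_add]
  rfl

/-- A full corner of the twist of `A` is the twisted endomorphism algebra of `A e`. -/
theorem isomorphic_twistedEnd : Isomorphic B ((t.mod c).twistedEnd S) :=
  ⟨AlgEquiv.ofBijective (t.endHom c) (t.endHom_bijective c), fun _ _ hb => t.mulRight_mem c hb⟩

theorem gradedEquivalent (t : Twist S A A') (c : CornerEmbedding A' B) (hA : Module.Finite K A)
    (h : ∃ e : GrMod A ≌ GrMod B, e.functor.Additive ∧ e.functor.Linear K) :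
    GradedEquivalent S A B := by
  have hA' : Module.Finite K A' := Module.Finite.equiv t.toEquiv
  have hB : Module.Finite K B :=
    Module.Finite.of_injective (c.toHom : B →ₗ[K] A') c.injective
  exact ⟨hA, hB, h, t.mod c, GrMod.finite_leftIdeal _ (t.isIdempotentElem_idem c),
    GrMod.projective_leftIdeal _ (t.isIdempotentElem_idem c), t.isomorphic_twistedEnd c⟩

end Twist

/-- A full corner of `A` is `σ`-graded equivalent to `A`. -/
theorem CornerEmbedding.gradedEquivalent_sigma {A B : SuperAlg K} (c : CornerEmbedding A B)
    (hA : Module.Finite K A) : GradedEquivalent .sigma A B :=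
  (Twist.sigmaRefl A).gradedEquivalent c hA
    ⟨c.equivalence, c.equivalence_functor_additive, c.equivalence_functor_linear⟩

end SuperAlg

/-! ### Modules over the twist by `π` -/

namespace GrMod

variable {K : Type u} [Field K] {A : SuperAlg K}

/-- The parity involution of a graded module. -/
noncomputable def parity (M : GrMod A) : M →ₗ[K] M := M.proj 0 - M.proj 1

theorem parity_of_mem_zero (M : GrMod A) {m : M} (h : m ∈ M.part 0) : M.parity m = m := by
  change M.proj 0 m - M.proj 1 m = m
  rw [M.proj_of_mem h, M.proj_of_mem_ne h (by decide), sub_zero]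

theorem parity_of_mem_one (M : GrMod A) {m : M} (h : m ∈ M.part 1) : M.parity m = -m := by
  change M.proj 0 m - M.proj 1 m = -m
  rw [M.proj_of_mem h, M.proj_of_mem_ne h (by decide), zero_sub]

theorem parity_mem (M : GrMod A) {i : ZMod 2} {m : M} (h : m ∈ M.part i) :
    M.parity m ∈ M.part i := by
  rcases ZMod.two_cases i with rfl | rfl
  · rwa [M.parity_of_mem_zero h]
  · rw [M.parity_of_mem_one h]; exact neg_mem h

theorem parity_parity (M : GrMod A) (m : M) : M.parity (M.parity m) = m := by
  induction m using M.isCompl.induction with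
  | add m n hm hn => rw [map_add, map_add, hm, hn]
  | hom i m hm =>
    rcases ZMod.two_cases i with rfl | rfl
    · rw [M.parity_of_mem_zero hm, M.parity_of_mem_zero hm]
    · rw [M.parity_of_mem_one hm, map_neg, M.parity_of_mem_one hm, neg_neg]

theorem parity_smul_of_even (M : GrMod A) {a : A} (ha : a ∈ A.part 0) (m : M) :
    M.parity (a • m) = a • M.parity m := by
  change M.proj 0 (a • m) - M.proj 1 (a • m) = a • (M.proj 0 m - M.proj 1 m)
  have h0 := M.proj_smul 0 ha m
  have h1 := M.proj_smul 1 ha m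
  rw [zero_add] at h0 h1
  rw [h0, h1, smul_sub]

theorem parity_smul_of_odd (M : GrMod A) {a : A} (ha : a ∈ A.part 1) (m : M) :
    M.parity (a • m) = -(a • M.parity m) := by
  change M.proj 0 (a • m) - M.proj 1 (a • m) = -(a • (M.proj 0 m - M.proj 1 m))
  have h0 := M.proj_smul 0 ha m
  have h1 := M.proj_smul 1 ha m
  rw [add_zero] at h0
  rw [ZMod.two_add_self] at h1
  rw [h0, h1, smul_sub, neg_sub]

theorem map_parity {M N : GrMod A} (f : M ⟶ N) (m : M) : f.1 (M.parity m) = N.parity (f.1 m) := by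
  induction m using M.isCompl.induction with
  | add m n hm hn => simp only [map_add, hm, hn]
  | hom i m hm =>
    rcases ZMod.two_cases i with rfl | rfl
    · rw [M.parity_of_mem_zero hm, N.parity_of_mem_zero (f.2.1 _ _ hm)]
    · rw [M.parity_of_mem_one hm, N.parity_of_mem_one (f.2.1 _ _ hm), map_neg]

end GrMod

namespace SuperAlg.Twist

variable {K : Type u} [Field K] {A A' B : SuperAlg K} (t : Twist .pi A A')

theorem map_mul_of_odd {a c : A} (ha : a ∈ A.part 1) (hc : c ∈ A.part 1) :
    t.toEquiv (a * c) = -(t.toEquiv a * t.toEquiv c) := by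
  rw [← t.map_twist_mul_of_odd _ hc]
  change _ = -t.toEquiv (A.parity a * c)
  rw [A.parity_of_mem_one ha, neg_mul, map_neg, neg_neg]

theorem map_mul_of_even_left {a : A} (c : A) (ha : a ∈ A.part 0) :
    t.toEquiv (a * c) = t.toEquiv a * t.toEquiv c := by
  rw [t.map_mul, A.twist_of_mem_zero _ ha, ← mul_add, A.proj_add_proj]

/-- Twisting by `π` is an involution. -/
def symm : Twist .pi A' A where
  toEquiv := t.toEquiv.symm
  map_mem _ _ h := t.symm_mem h
  map_mul a c := by
    apply t.toEquiv.injective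
    rw [LinearEquiv.apply_symm_apply]
    conv_lhs => rw [← A.proj_add_proj (t.toEquiv.symm c), mul_add]
    change _ = _ + (A'.proj 0 a - A'.proj 1 a) * _
    rw [map_add, t.map_mul_of_even _ (A.proj_mem 0 _), ← A.proj_add_proj (t.toEquiv.symm a),
      add_mul _ _ (A.proj 1 _), map_add, map_add,
      t.map_mul_of_even_left _ (A.proj_mem 0 _), t.map_mul_of_odd (A.proj_mem 1 _) (A.proj_mem 1 _),
      t.map_proj, t.map_proj, t.map_proj, t.map_proj, LinearEquiv.apply_symm_apply,
      LinearEquiv.apply_symm_apply, A'.proj_add_proj, sub_mul, sub_eq_add_neg]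

/-- The action of `A` on a graded `A'`-module `M`, with odd elements acting through the parity
involution of `M`. -/
noncomputable abbrev module (M : GrMod A') : Module A M where
  smul a m := t.toEquiv (A.proj 0 a) • m + t.toEquiv (A.proj 1 a) • M.parity m
  one_smul m := by
    change t.toEquiv (A.proj 0 1) • m + t.toEquiv (A.proj 1 1) • M.parity m = m
    rw [A.proj_of_mem A.one_mem, A.proj_of_mem_ne A.one_mem (by decide), t.map_one, map_zero,
      one_smul, zero_smul, add_zero]
  mul_smul a b m := by
    change t.toEquiv (A.proj 0 (a * b)) • m + t.toEquiv (A.proj 1 (a * b)) • M.parity m =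
      t.toEquiv (A.proj 0 a) • (t.toEquiv (A.proj 0 b) • m + t.toEquiv (A.proj 1 b) • M.parity m) +
      t.toEquiv (A.proj 1 a) •
        M.parity (t.toEquiv (A.proj 0 b) • m + t.toEquiv (A.proj 1 b) • M.parity m)
    rw [A.proj_zero_mul, A.proj_one_mul, map_add, map_add, map_add,
      t.map_mul_of_even_left _ (A.proj_mem 0 a), t.map_mul_of_even_left _ (A.proj_mem 0 a),
      t.map_mul_of_odd (A.proj_mem 1 a) (A.proj_mem 1 b),
      t.map_mul_of_even _ (A.proj_mem 0 b),
      M.parity_smul_of_even (t.map_mem _ _ (A.proj_mem 0 b)),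
      M.parity_smul_of_odd (t.map_mem _ _ (A.proj_mem 1 b)), M.parity_parity]
    simp only [add_smul, smul_add, neg_smul, smul_neg, mul_smul]
    abel
  smul_zero a := by
    change t.toEquiv (A.proj 0 a) • (0 : M) + t.toEquiv (A.proj 1 a) • M.parity 0 = 0
    rw [map_zero, smul_zero, smul_zero, add_zero]
  smul_add a m n := by
    change t.toEquiv (A.proj 0 a) • (m + n) + t.toEquiv (A.proj 1 a) • M.parity (m + n) =
      (t.toEquiv (A.proj 0 a) • m + t.toEquiv (A.proj 1 a) • M.parity m) +
      (t.toEquiv (A.proj 0 a) • n + t.toEquiv (A.proj 1 a) • M.parity n)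
    rw [map_add, smul_add, smul_add]
    abel
  add_smul a b m := by
    change t.toEquiv (A.proj 0 (a + b)) • m + t.toEquiv (A.proj 1 (a + b)) • M.parity m =
      (t.toEquiv (A.proj 0 a) • m + t.toEquiv (A.proj 1 a) • M.parity m) +
      (t.toEquiv (A.proj 0 b) • m + t.toEquiv (A.proj 1 b) • M.parity m)
    simp only [map_add, add_smul]
    abel
  zero_smul m := by
    change t.toEquiv (A.proj 0 0) • m + t.toEquiv (A.proj 1 0) • M.parity m = 0
    simp only [map_zero, zero_smul, add_zero]

/-- A graded `A'`-module, made into a graded `A`-module. -/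
noncomputable abbrev restrict (M : GrMod A') : GrMod A where
  carrier := M
  module := t.module M
  isScalarTower := by
    refine @IsScalarTower.mk K A M _ (t.module M).toSMul _ fun k a m => ?_
    change t.toEquiv (A.proj 0 (k • a)) • m + t.toEquiv (A.proj 1 (k • a)) • M.parity m =
      k • (t.toEquiv (A.proj 0 a) • m + t.toEquiv (A.proj 1 a) • M.parity m)
    simp only [map_smul, smul_assoc, smul_add]
  part := M.part
  isCompl := M.isCompl
  smul_mem {i j a m} ha hm := by
    change t.toEquiv (A.proj 0 a) • m + t.toEquiv (A.proj 1 a) • M.parity m ∈ _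
    have hm' := M.parity_mem hm
    rcases ZMod.two_cases i with rfl | rfl
    · rw [A.proj_of_mem ha, A.proj_of_mem_ne ha (by decide), map_zero, zero_smul, add_zero]
      exact M.smul_mem (t.map_mem _ _ ha) hm
    · rw [A.proj_of_mem ha, A.proj_of_mem_ne ha (by decide), map_zero, zero_smul, zero_add]
      exact M.smul_mem (t.map_mem _ _ ha) hm'

/-- The functor from graded `A'`-modules to graded `A`-modules that is the identity on the
underlying graded vector spaces. -/
noncomputable def restrictFunctor : GrMod A' ⥤ GrMod A where
  obj M := t.restrict M
  map {M N} f := ⟨f.1, f.2.1, fun a m => by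
    change f.1 (t.toEquiv (A.proj 0 a) • m + t.toEquiv (A.proj 1 a) • M.parity m) =
      t.toEquiv (A.proj 0 a) • f.1 m + t.toEquiv (A.proj 1 a) • N.parity (f.1 m)
    rw [map_add, f.2.2, f.2.2, GrMod.map_parity]⟩
  map_id M := rfl
  map_comp f g := rfl

/-- Twisting a module twice by `π` gives back the module. -/
noncomputable def restrictRestrictHom (M : GrMod A') :
    M ⟶ t.symm.restrictFunctor.obj (t.restrictFunctor.obj M) :=
  ⟨LinearMap.id, fun _ _ h => h, fun a m => by
    change a • m = (t.toEquiv (A.proj 0 (t.toEquiv.symm (A'.proj 0 a))) • m +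
        t.toEquiv (A.proj 1 (t.toEquiv.symm (A'.proj 0 a))) • M.parity m) +
      (t.toEquiv (A.proj 0 (t.toEquiv.symm (A'.proj 1 a))) • M.parity m +
        t.toEquiv (A.proj 1 (t.toEquiv.symm (A'.proj 1 a))) • M.parity (M.parity m))
    simp only [t.map_proj, LinearEquiv.apply_symm_apply]
    rw [A'.proj_of_mem (A'.proj_mem 0 a), A'.proj_of_mem (A'.proj_mem 1 a),
      A'.proj_of_mem_ne (A'.proj_mem 0 a) (by decide),
      A'.proj_of_mem_ne (A'.proj_mem 1 a) (by decide), zero_smul, M.parity_parity]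
    rw [add_zero, zero_add, ← add_smul, A'.proj_add_proj]⟩

/-- Graded modules over a superalgebra and over its twist by `π` are equivalent. -/
noncomputable def equivalence : GrMod A ≌ GrMod A' :=
  CategoryTheory.Equivalence.mk t.symm.restrictFunctor t.restrictFunctor
    (NatIso.ofComponents (fun M => GrMod.isoOfBijective (t.symm.restrictRestrictHom M)
      Function.bijective_id) (fun _ => rfl))
    (NatIso.ofComponents (F := 𝟭 (GrMod A')) (G := t.restrictFunctor ⋙ t.symm.restrictFunctor)
      (fun M => GrMod.isoOfBijective (t.restrictRestrictHom M) Function.bijective_id)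
      (fun _ => rfl)).symm

/-- A full corner of the `π`-twist of `A` is `π`-graded equivalent to `A`. -/
theorem gradedEquivalent_pi (t : Twist .pi A A') (c : CornerEmbedding A' B)
    (hA : Module.Finite K A) : GradedEquivalent .pi A B :=
  have hadd : (t.equivalence.trans c.equivalence).functor.Additive := ⟨rfl⟩
  t.gradedEquivalent c hA ⟨t.equivalence.trans c.equivalence, hadd, { map_smul := fun _ _ => rfl }⟩

end SuperAlg.Twist

namespace SuperAlg

variable {K : Type u} [Field K]

/-! ### Corners of skew tensor products -/

section Tensor

variable {A B C : SuperAlg K}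

/-- The element `a ⊗ c` of the skew tensor product. -/
noncomputable def tens (a : A) (c : C) : A.tensor C :=
  (GradedTensorProduct.tmul K a c : GradedTensorProduct K A.part C.part)

theorem tens_add (a : A) (c c' : C) : tens a (c + c') = tens a c + tens a c' :=
  TensorProduct.tmul_add a c c'

theorem add_tens (a a' : A) (c : C) : tens (a + a') c = tens a c + tens a' c :=
  TensorProduct.add_tmul a a' c

theorem smul_tens (k : K) (a : A) (c : C) : tens (k • a) c = k • tens a c :=
  congrArg (GradedTensorProduct.of K A.part C.part) (TensorProduct.smul_tmul' k a c).symm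

theorem tens_smul (k : K) (a : A) (c : C) : tens a (k • c) = k • tens a c :=
  TensorProduct.tmul_smul (R := K) k a c

theorem zero_tens (c : C) : tens (0 : A) c = 0 := TensorProduct.zero_tmul _ c

theorem tens_zero (a : A) : tens a (0 : C) = 0 := TensorProduct.tmul_zero _ a

theorem tens_one_one : tens (1 : A) (1 : C) = 1 := rfl

theorem tens_mem {i j : ZMod 2} {a : A} {c : C} (ha : a ∈ A.part i) (hc : c ∈ C.part j) :
    tens a c ∈ (A.tensor C).part (i + j) :=
  show (tens a c : GradedTensorProduct K A.part C.part) ∈ tensorPart A C (i + j) from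
    Submodule.subset_span ⟨i, j, a, c, rfl, ha, hc, rfl⟩

theorem tens_mul_tens {i j : ZMod 2} (a : A) {c : C} {a' : A} (c' : C) (hc : c ∈ C.part j)
    (ha : a' ∈ A.part i) :
    tens a c * tens a' c' = (-1 : ℤˣ) ^ (j * i) • tens (a * a') (c * c') :=
  GradedTensorProduct.tmul_coe_mul_coe_tmul (R := K) A.part C.part a ⟨c, hc⟩ ⟨a', ha⟩ c'

theorem tens_mul_tens_of_even_left (a : A) {c : C} (a' : A) (c' : C) (hc : c ∈ C.part 0) :
    tens a c * tens a' c' = tens (a * a') (c * c') := by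
  induction a' using A.isCompl.induction with
  | add x y hx hy => rw [add_tens, mul_add, hx, hy, mul_add, add_tens]
  | hom i a' ha => rw [tens_mul_tens a c' hc ha, zero_mul, uzpow_zero, one_smul]

theorem tens_mul_tens_of_even_right (a : A) (c : C) {a' : A} (c' : C) (ha : a' ∈ A.part 0) :
    tens a c * tens a' c' = tens (a * a') (c * c') := by
  induction c using C.isCompl.induction with
  | add x y hx hy => rw [tens_add, add_mul, hx, hy, add_mul, tens_add]
  | hom i c hc => rw [tens_mul_tens a c' hc ha, mul_zero, uzpow_zero, one_smul]

theorem tensor_induction {P : A.tensor C → Prop}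
    (hom : ∀ i j, ∀ a ∈ A.part i, ∀ c ∈ C.part j, P (tens a c))
    (add : ∀ x y, P x → P y → P (x + y)) (x : A.tensor C) : P x := by
  have h : ∀ x : A ⊗[K] C, P (GradedTensorProduct.of K A.part C.part x) := by
    intro x
    induction x using TensorProduct.induction_on with
    | zero =>
      have := hom 0 0 0 (zero_mem _) 0 (zero_mem _)
      rw [zero_tens] at this
      exact this
    | add x y hx hy => rw [map_add]; exact add _ _ hx hy
    | tmul a c =>
      change P (tens a c)
      induction a using A.isCompl.induction with
      | add x y hx hy => rw [add_tens]; exact add _ _ hx hy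
      | hom i a ha =>
        induction c using C.isCompl.induction with
        | add x y hx hy => rw [tens_add]; exact add _ _ hx hy
        | hom j c hc => exact hom i j a ha c hc
  exact h x

/-- The map `f ⊗ id` of skew tensor products. -/
noncomputable def tensorMapLeft (C : SuperAlg K) (f : B →ₗ[K] A) : B.tensor C →ₗ[K] A.tensor C :=
  (LinearMap.rTensor C f : B ⊗[K] C →ₗ[K] A ⊗[K] C)

theorem tensorMapLeft_tens (f : B →ₗ[K] A) (b : B) (c : C) :
    tensorMapLeft C f (tens b c) = tens (f b) c := rfl

theorem tensorMapLeft_injective {f : B →ₗ[K] A} (hf : Function.Injective f) :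
    Function.Injective (tensorMapLeft C f) :=
  Module.Flat.rTensor_preserves_injective_linearMap (M := C) f hf

theorem tensorMapLeft_mem {f : B →ₗ[K] A} (hf : ∀ i, ∀ b ∈ B.part i, f b ∈ A.part i) (i : ZMod 2)
    (x : B.tensor C) (hx : x ∈ (B.tensor C).part i) :
    tensorMapLeft C f x ∈ (A.tensor C).part i := by
  have h : (B.tensor C).part i ≤ ((A.tensor C).part i).comap (tensorMapLeft C f) := by
    refine Submodule.span_le.mpr ?_
    rintro _ ⟨j, k, b, c, rfl, hb, hc, rfl⟩
    exact tens_mem (hf _ _ hb) hc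
  exact h hx

theorem tensorMapLeft_mul (f : B →ₙₐ[K] A) (hf : ∀ i, ∀ b ∈ B.part i, f b ∈ A.part i)
    (x y : B.tensor C) : tensorMapLeft C (f : B →ₗ[K] A) (x * y) =
      tensorMapLeft C (f : B →ₗ[K] A) x * tensorMapLeft C (f : B →ₗ[K] A) y := by
  induction x using tensor_induction with
  | add x x' hx hx' => rw [add_mul, map_add, hx, hx', map_add, add_mul]
  | hom i j b hb c hc =>
    induction y using tensor_induction with
    | add y y' hy hy' => rw [mul_add, map_add, hy, hy', map_add, mul_add]
    | hom i' j' b' hb' c' hc' =>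
      rw [tens_mul_tens b c' hc hb', tensorMapLeft_tens, tensorMapLeft_tens]
      have := tens_mul_tens (f b) c' hc (hf _ _ hb')
      change _ = tens (f b) c * tens (f b') c'
      rw [this, ← map_mul]
      rcases Int.units_eq_one_or ((-1 : ℤˣ) ^ (j * i')) with hs | hs <;> rw [hs]
      · rw [one_smul, one_smul]; rfl
      · rw [Units.neg_smul, one_smul, Units.neg_smul, one_smul, map_neg]; rfl

/-- A full corner `B` of `A` gives the full corner `B ⊗ C` of `A ⊗ C`. -/
noncomputable def CornerEmbedding.tensor (f : CornerEmbedding A B) (C : SuperAlg K) :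
    CornerEmbedding (A.tensor C) (B.tensor C) where
  toHom :=
    { toFun := tensorMapLeft C (f.toHom : B →ₗ[K] A)
      map_smul' := map_smul _
      map_zero' := map_zero _
      map_add' := map_add _
      map_mul' := tensorMapLeft_mul f.toHom f.map_mem }
  injective := tensorMapLeft_injective f.injective
  map_mem := tensorMapLeft_mem f.map_mem
  exists_eq x := by
    induction x using tensor_induction with
    | add x y hx hy =>
      obtain ⟨b, hb⟩ := hx
      obtain ⟨b', hb'⟩ := hy
      exact ⟨b + b', by rw [map_add, hb, hb', mul_add, add_mul]⟩
    | hom i j a ha c hc =>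
      obtain ⟨b, hb⟩ := f.exists_eq a
      refine ⟨tens b c, ?_⟩
      change tens (f.toHom b) c = tens f.idem (1 : C) * tens a c * tens f.idem (1 : C)
      rw [tens_mul_tens_of_even_left _ _ _ C.one_mem, tens_mul_tens_of_even_right _ _ _ f.idem_mem,
        one_mul, mul_one, hb]
      rfl
  full := by
    have h : ∀ z ∈ Submodule.span K {z : A | ∃ i, ∃ x ∈ A.part i, ∃ y ∈ A.part i,
        z = x * f.toHom 1 * y}, tens z (1 : C) ∈ Submodule.span K {z : A.tensor C | ∃ i,
          ∃ x ∈ (A.tensor C).part i, ∃ y ∈ (A.tensor C).part i,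
            z = x * tens f.idem (1 : C) * y} := by
      intro z hz
      induction hz using Submodule.span_induction with
      | zero => rw [zero_tens]; exact zero_mem _
      | add x y _ _ hx hy => rw [add_tens]; exact add_mem hx hy
      | smul k x _ hx => rw [smul_tens]; exact Submodule.smul_mem _ _ hx
      | mem z hz =>
        obtain ⟨i, x, hx, y, hy, rfl⟩ := hz
        refine Submodule.subset_span ⟨i, tens x 1, ?_, tens y 1, ?_, ?_⟩
        · exact add_zero i ▸ tens_mem hx C.one_mem
        · exact add_zero i ▸ tens_mem hy C.one_mem
        · rw [tens_mul_tens_of_even_left _ _ _ C.one_mem,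
            tens_mul_tens_of_even_left _ _ _ (by rw [one_mul]; exact C.one_mem), one_mul, one_mul]
          rfl
    exact h 1 f.full

/-- The homomorphism `a ↦ a ⊗ 1`. -/
noncomputable def inclLeft (A C : SuperAlg K) : A →ₐ[K] A.tensor C :=
  GradedTensorProduct.includeLeft A.part C.part

/-- The homomorphism `c ↦ 1 ⊗ c`. -/
noncomputable def inclRight (A C : SuperAlg K) : C →ₐ[K] A.tensor C :=
  GradedTensorProduct.includeRight A.part C.part

theorem inclLeft_mem (i : ZMod 2) (a : A) (ha : a ∈ A.part i) :
    inclLeft A C a ∈ (A.tensor C).part i :=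
  add_zero i ▸ tens_mem ha C.one_mem

theorem inclRight_mem (i : ZMod 2) (c : C) (hc : c ∈ C.part i) :
    inclRight A C c ∈ (A.tensor C).part i :=
  zero_add i ▸ tens_mem A.one_mem hc

theorem inclRight_injective [Nontrivial A] : Function.Injective (inclRight A C) := by
  obtain ⟨g, hg⟩ := (Algebra.linearMap K A).exists_leftInverse_of_injective
    (LinearMap.ker_eq_bot.mpr (algebraMap K A).injective)
  have hg1 : g 1 = 1 := by simpa using LinearMap.congr_fun hg 1
  let r : A.tensor C →ₗ[K] C :=
    ((TensorProduct.lid K C).toLinearMap ∘ₗ LinearMap.rTensor C g : A ⊗[K] C →ₗ[K] C)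
  refine Function.LeftInverse.injective (g := r) fun c => ?_
  change g 1 • c = c
  rw [hg1, one_smul]

/-- `K ⊗ C` is `C`. -/
noncomputable def CornerEmbedding.ground (C : SuperAlg K) :
    CornerEmbedding ((concentrated K K).tensor C) C :=
  .ofIso (AlgEquiv.ofBijective (inclRight (concentrated K K) C)
    ⟨(TensorProduct.lid K C).symm.injective, (TensorProduct.lid K C).symm.surjective⟩)
    inclRight_mem

theorem finite_tensor [Module.Finite K A] [Module.Finite K C] : Module.Finite K (A.tensor C) :=
  inferInstanceAs (Module.Finite K (A ⊗[K] C))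

end Tensor

/-! ### Even idempotents and basic superalgebras -/

/-- The only even idempotents are `0` and `1`. -/
def IsEvenConnected (A : SuperAlg K) : Prop := ∀ e ∈ A.part 0, e * e = e → e = 0 ∨ e = 1

theorem IsEvenConnected.of_injective {A B : SuperAlg K} (hA : A.IsEvenConnected) (f : B →ₙₐ[K] A)
    (hf : Function.Injective f) (he : ∀ b ∈ B.part 0, f b ∈ A.part 0) : B.IsEvenConnected := by
  intro b hb hbb
  rcases hA (f b) (he b hb) (by rw [← map_mul, hbb]) with h | h
  · exact Or.inl (hf (by rw [h, map_zero]))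
  · refine Or.inr (hf ?_)
    rw [← mul_one (f 1), ← h, ← map_mul, one_mul]

/-- If `A` has no even idempotents besides `0` and `1`, then the graded module `A` cannot be split
into two nonzero summands, so that the condition on pairs of summands is void. -/
theorem IsEvenConnected.isGradedBasic {A : SuperAlg K} (hA : A.IsEvenConnected)
    (hfin : Module.Finite K A) (S : Shift) : A.IsGradedBasic S := by
  refine ⟨hfin, fun n P f hP hbij i j hij => ?_⟩
  exfalso
  set F : (∀ i, P i) → A := fun x => ∑ i, (f i).1 (x i) with hF
  have Fsmul : ∀ (a : A) x, F (a • x) = a * F x := fun a x => by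
    simp only [hF, Finset.mul_sum, Pi.smul_apply]
    exact Finset.sum_congr rfl fun k _ => (f k).2.2 a (x k)
  have Fadd : ∀ x y, F (x + y) = F x + F y := fun x y => by
    simp only [hF, Pi.add_apply, map_add, Finset.sum_add_distrib]
  have Fmem : ∀ (k : ZMod 2) x, (∀ i, x i ∈ (P i).part k) → F x ∈ A.part k := fun k x hx =>
    sum_mem fun i _ => (f i).2.1 k _ (hx i)
  have Fsingle : ∀ k (m : P k), F (Pi.single k m) = (f k).1 m := fun k m => by
    simp only [hF]
    rw [Finset.sum_eq_single k (fun l _ hl => by rw [Pi.single_eq_of_ne hl, map_zero])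
      (fun h => absurd (Finset.mem_univ k) h), Pi.single_eq_same]
  obtain ⟨x, hx⟩ := hbij.2 1
  change F x = 1 at hx
  -- the components of `1` are even
  have hxeven : ∀ k, x k ∈ (P k).part 0 := by
    have h1 : F (fun k => (P k).proj 0 (x k)) + F (fun k => (P k).proj 1 (x k)) = 1 := by
      rw [← Fadd, ← hx]
      congr 1
      funext k
      simpa using (P k).proj_add_proj 0 (x k)
    have h2 := Fmem 0 _ fun k => (P k).proj_mem 0 (x k)
    have h3 := Fmem 1 _ fun k => (P k).proj_mem 1 (x k)
    have h4 : F (fun k => (P k).proj 1 (x k)) = 0 := by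
      refine A.isCompl.eq_zero_of_mem (i := 0) ?_ (by simpa using h3)
      rw [← eq_sub_iff_add_eq'] at h1
      rw [h1]
      exact sub_mem A.one_mem h2
    have h5 : (fun k => (P k).proj 1 (x k)) = 0 := hbij.1 (by
      change F _ = F 0
      rw [h4]
      simp [hF])
    intro k
    have h6 := (P k).proj_add_proj 0 (x k)
    have h7 : (P k).proj (0 + 1) (x k) = 0 := by simpa using congrFun h5 k
    rw [h7, add_zero] at h6
    rw [← h6]
    exact (P k).proj_mem 0 _
  have single : ∀ k (m : P k), (f k).1 m • x = Pi.single k m := fun k m => hbij.1 (by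
    change F _ = F _
    rw [Fsmul, hx, mul_one, Fsingle])
  have nt : ∀ k, x k ≠ 0 := by
    intro k hk
    obtain ⟨m, hm⟩ := (nontrivial_iff_exists_ne (0 : P k)).mp (hP k).1
    have := congrFun (single k m) k
    rw [Pi.smul_apply, hk, smul_zero, Pi.single_eq_same] at this
    exact hm this.symm
  set e := (f i).1 (x i) with he
  have hee : e * e = e := by
    have h1 := congrFun (single i (x i)) i
    rw [Pi.smul_apply, Pi.single_eq_same] at h1
    have h2 := (f i).2.2 e (x i)
    rw [h1] at h2
    exact h2.symm
  rcases hA e ((f i).2.1 0 _ (hxeven i)) hee with h | h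
  · apply nt i
    have := congrFun (single i (x i)) i
    rw [← he, h, zero_smul, Pi.single_eq_same] at this
    exact this.symm
  · apply nt j
    have := congrFun (single i (x i)) j
    rwa [← he, h, one_smul, Pi.single_eq_of_ne hij.symm] at this

end SuperAlg

/-! ### Clifford superalgebras of diagonal forms -/

section Cliff

variable {n m : Type} [Fintype n] [Fintype m]

/-- The Clifford superalgebra with one generator for each index, whose square is the weight of the
index. -/
noncomputable def cliff (w : n → ℝ) : SuperAlg ℝ :=
  cliffordSuperAlg (QuadraticMap.weightedSumSquares ℝ w : QuadraticForm ℝ (n → ℝ))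

theorem grassmann_eq_cliff (r : ℕ) : grassmann r = cliff (fun _ : Fin r => 0) := by
  have h : (QuadraticMap.weightedSumSquares ℝ (fun _ : Fin r => (0 : ℝ)) :
      QuadraticForm ℝ (Fin r → ℝ)) = 0 := by
    ext v
    simp [QuadraticMap.weightedSumSquares_apply]
  rw [cliff, h]
  rfl

/-- The generators of a Clifford superalgebra. -/
noncomputable def gen [DecidableEq n] (w : n → ℝ) (i : n) : cliff w :=
  (CliffordAlgebra.ι (QuadraticMap.weightedSumSquares ℝ w : QuadraticForm ℝ (n → ℝ))
    (Pi.single i 1) : CliffordAlgebra _)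

theorem weightedSumSquares_polar [DecidableEq n] (w : n → ℝ) (i j : n) :
    QuadraticMap.polar (QuadraticMap.weightedSumSquares ℝ w : QuadraticForm ℝ (n → ℝ))
      (Pi.single i 1) (Pi.single j 1) = if i = j then 2 * w i else 0 := by
  simp only [QuadraticMap.polar, QuadraticMap.weightedSumSquares_apply, Pi.add_apply, smul_eq_mul,
    ← Finset.sum_sub_distrib]
  split_ifs with h
  · subst h
    rw [Finset.sum_eq_single i]
    · simp; ring
    · intro k _ hk; simp [hk]
    · simp
  · refine Finset.sum_eq_zero fun k _ => ?_
    by_cases hk : k = i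
    · subst hk
      simp [Pi.single_eq_of_ne h]
    · simp [Pi.single_eq_of_ne hk]

variable [DecidableEq n] [DecidableEq m] {w : n → ℝ}

theorem gen_mul_self (i : n) : gen w i * gen w i = algebraMap ℝ (cliff w) (w i) := by
  refine (CliffordAlgebra.ι_sq_scalar _ _).trans ?_
  have : (QuadraticMap.weightedSumSquares ℝ w : QuadraticForm ℝ (n → ℝ)) (Pi.single i 1) = w i := by
    rw [QuadraticMap.weightedSumSquares_apply, Finset.sum_eq_single i]
    · simp
    · intro k _ hk; simp [hk]
    · simp
  rw [this]
  rfl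

theorem gen_mul_gen {i j : n} (h : i ≠ j) : gen w i * gen w j = -(gen w j * gen w i) := by
  refine eq_neg_of_add_eq_zero_left ((CliffordAlgebra.ι_mul_ι_add_swap _ _).trans ?_)
  rw [weightedSumSquares_polar, if_neg h, map_zero]
  rfl

theorem gen_mem (i : n) : gen w i ∈ (cliff w).part 1 := CliffordAlgebra.ι_mem_evenOdd_one _ _

/-- A subspace that contains `1` and is stable under left multiplication by the generators is the
whole Clifford superalgebra. -/
theorem cliff_mem_of_stable {L : Submodule ℝ (cliff w)} (one : 1 ∈ L)
    (mul : ∀ i, ∀ x ∈ L, gen w i * x ∈ L) (x : cliff w) : x ∈ L := by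
  have h : ∀ x : CliffordAlgebra (QuadraticMap.weightedSumSquares ℝ w : QuadraticForm ℝ (n → ℝ)),
      (show cliff w from x) ∈ L := by
    intro x
    induction x using CliffordAlgebra.left_induction with
    | algebraMap r =>
      have := L.smul_mem r one
      rwa [← Algebra.algebraMap_eq_smul_one] at this
    | add x y hx hy => exact L.add_mem hx hy
    | ι_mul x v hx =>
      have hv : v = ∑ i, v i • (Pi.single i 1 : n → ℝ) := by
        ext k
        simp [Finset.sum_apply, Pi.single_apply]
      rw [hv, map_sum, Finset.sum_mul]
      refine L.sum_mem fun i _ => ?_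
      rw [map_smul, smul_mul_assoc]
      exact L.smul_mem _ (mul i x hx)
  exact h x

section Lift

variable {A : Type} [Ring A] [Algebra ℝ A]

/-- The universal property: an algebra homomorphism is given by pairwise anticommuting elements
with the prescribed squares. -/
noncomputable def cliffLift (w : n → ℝ) (g : n → A) (sq : ∀ i, g i * g i = algebraMap ℝ A (w i))
    (anti : ∀ i j, i ≠ j → g i * g j = -(g j * g i)) : cliff w →ₐ[ℝ] A :=
  CliffordAlgebra.lift (QuadraticMap.weightedSumSquares ℝ w : QuadraticForm ℝ (n → ℝ))
    ⟨Fintype.linearCombination ℝ g, by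
      have h2 : IsUnit (2 : A) := by
        have : (2 : A) = algebraMap ℝ A 2 := (map_ofNat (algebraMap ℝ A) 2).symm
        rw [this]
        exact (IsUnit.mk0 (2 : ℝ) two_ne_zero).map _
      rw [CliffordAlgebra.forall_mul_self_eq_iff h2]
      refine (Pi.basisFun ℝ n).ext fun i => (Pi.basisFun ℝ n).ext fun j => ?_
      change Fintype.linearCombination ℝ g (Pi.basisFun ℝ n i) *
          Fintype.linearCombination ℝ g (Pi.basisFun ℝ n j) +
        Fintype.linearCombination ℝ g (Pi.basisFun ℝ n j) *
          Fintype.linearCombination ℝ g (Pi.basisFun ℝ n i) =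
        algebraMap ℝ A (QuadraticMap.polar _ (Pi.basisFun ℝ n i) (Pi.basisFun ℝ n j))
      rw [Pi.basisFun_apply, Pi.basisFun_apply, weightedSumSquares_polar,
        Fintype.linearCombination_apply_single, Fintype.linearCombination_apply_single, one_smul,
        one_smul]
      split_ifs with h
      · subst h
        rw [sq, ← two_mul, map_mul, map_ofNat]
      · rw [anti i j h, map_zero, neg_add_cancel]⟩

theorem cliffLift_gen (g : n → A) (sq : ∀ i, g i * g i = algebraMap ℝ A (w i))
    (anti : ∀ i j, i ≠ j → g i * g j = -(g j * g i)) (i : n) :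
    cliffLift w g sq anti (gen w i) = g i := by
  refine (CliffordAlgebra.lift_ι_apply _ _ _).trans ?_
  rw [Fintype.linearCombination_apply_single, one_smul]

theorem cliff_hom_ext {f g : cliff w →ₐ[ℝ] A} (h : ∀ i, f (gen w i) = g (gen w i)) : f = g := by
  ext x
  refine cliff_mem_of_stable (L := LinearMap.eqLocus f.toLinearMap g.toLinearMap) ?_ ?_ x
  · exact (map_one f).trans (map_one g).symm
  · intro i x hx
    change f (gen w i * x) = g (gen w i * x)
    rw [map_mul, map_mul, h]
    exact congrArg (_ * ·) hx

end Lift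

theorem cliff_proj_zero_gen_mul (i : n) (x : cliff w) :
    (cliff w).proj 0 (gen w i * x) = gen w i * (cliff w).proj 1 x := by
  rw [(cliff w).proj_zero_mul, (cliff w).proj_of_mem (gen_mem i),
    (cliff w).proj_of_mem_ne (j := 0) (gen_mem i) (by decide), zero_mul, zero_add]

theorem cliff_proj_one_gen_mul (i : n) (x : cliff w) :
    (cliff w).proj 1 (gen w i * x) = gen w i * (cliff w).proj 0 x := by
  rw [(cliff w).proj_one_mul, (cliff w).proj_of_mem (gen_mem i),
    (cliff w).proj_of_mem_ne (j := 0) (gen_mem i) (by decide), zero_mul, zero_add]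

theorem cliff_linearMap_even {A : SuperAlg ℝ} (f : cliff w →ₗ[ℝ] A) (one : f 1 ∈ A.part 0)
    (mul : ∀ i x k, f x ∈ A.part k → f (gen w i * x) ∈ A.part (1 + k)) (k : ZMod 2) (x : cliff w)
    (hx : x ∈ (cliff w).part k) : f x ∈ A.part k := by
  have h := cliff_mem_of_stable (w := w)
    (L := (A.part 0).comap (f ∘ₗ (cliff w).proj 0) ⊓ (A.part 1).comap (f ∘ₗ (cliff w).proj 1))
    (by
      constructor
      · change f ((cliff w).proj 0 1) ∈ A.part 0
        rwa [(cliff w).proj_of_mem (cliff w).one_mem]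
      · change f ((cliff w).proj 1 1) ∈ A.part 1
        rw [(cliff w).proj_of_mem_ne (cliff w).one_mem (by decide), map_zero]
        exact zero_mem _)
    (by
      rintro i x ⟨h0, h1⟩
      constructor
      · change f ((cliff w).proj 0 (gen w i * x)) ∈ A.part 0
        rw [cliff_proj_zero_gen_mul]
        exact mul i _ 1 h1
      · change f ((cliff w).proj 1 (gen w i * x)) ∈ A.part 1
        rw [cliff_proj_one_gen_mul]
        exact mul i _ 0 h0) x
  rcases ZMod.two_cases k with rfl | rfl
  · have := h.1
    change f ((cliff w).proj 0 x) ∈ A.part 0 at this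
    rwa [(cliff w).proj_of_mem hx] at this
  · have := h.2
    change f ((cliff w).proj 1 x) ∈ A.part 1 at this
    rwa [(cliff w).proj_of_mem hx] at this

theorem cliff_hom_even {A : SuperAlg ℝ} (f : cliff w →ₐ[ℝ] A) (h : ∀ i, f (gen w i) ∈ A.part 1)
    (k : ZMod 2) (x : cliff w) (hx : x ∈ (cliff w).part k) : f x ∈ A.part k := by
  refine cliff_linearMap_even f.toLinearMap ?_ ?_ k x hx
  · change f 1 ∈ _
    rw [map_one]
    exact A.one_mem
  · intro i x k hx
    change f (gen w i * x) ∈ A.part (1 + k)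
    rw [map_mul]
    exact A.mul_mem (h i) hx

omit [DecidableEq n] in
/-- The basis of the exterior algebra shows that a Clifford superalgebra with `N` generators has
dimension `2 ^ N`. -/
theorem cliff_finrank (w : n → ℝ) : Module.Finite ℝ (cliff w) ∧
    Module.finrank ℝ (cliff w) = 2 ^ Fintype.card n := by
  let b := (Module.finBasis ℝ (n → ℝ)).ExteriorAlgebra
  let e : cliff w ≃ₗ[ℝ] ExteriorAlgebra ℝ (n → ℝ) :=
    CliffordAlgebra.equivExterior (QuadraticMap.weightedSumSquares ℝ w : QuadraticForm ℝ (n → ℝ))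
  have : Module.Finite ℝ (ExteriorAlgebra ℝ (n → ℝ)) := Module.Finite.of_basis b
  refine ⟨Module.Finite.equiv e.symm, ?_⟩
  rw [e.finrank_eq, Module.finrank_eq_card_basis b, Fintype.card_finset, Fintype.card_fin,
    Module.finrank_fintype_fun_eq_card]

instance (w : n → ℝ) : Module.Finite ℝ (cliff w) := (cliff_finrank w).1

instance (w : n → ℝ) : Nontrivial (cliff w) :=
  inferInstanceAs (Nontrivial (CliffordAlgebra
    (QuadraticMap.weightedSumSquares ℝ w : QuadraticForm ℝ (n → ℝ))))

namespace SuperAlg.CornerEmbedding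

/-- An even isomorphism, used backwards. -/
noncomputable def ofIsoSymm {K : Type u} [Field K] {A B : SuperAlg K} (f : A ≃ₐ[K] B)
    (hf : ∀ i, ∀ a ∈ A.part i, f a ∈ B.part i) : CornerEmbedding A B :=
  .ofIso f.symm fun i b hb => by
    refine A.isCompl.mem_of_map_mem B.isCompl (f := (f : A →+ B)) f.injective hf ?_
    change f (f.symm b) ∈ _
    rwa [f.apply_symm_apply]

end SuperAlg.CornerEmbedding

open SuperAlg

/-- The homomorphism of Clifford superalgebras that permutes the generators. -/
noncomputable def cliffReindexHom {w : n → ℝ} {w' : m → ℝ} (s : n ≃ m) (h : ∀ i, w' (s i) = w i) :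
    cliff w →ₐ[ℝ] cliff w' :=
  cliffLift w (fun i => gen w' (s i)) (fun i => by rw [gen_mul_self, h])
    (fun _ _ hij => gen_mul_gen (s.injective.ne hij))

theorem cliffReindexHom_gen {w : n → ℝ} {w' : m → ℝ} (s : n ≃ m) (h : ∀ i, w' (s i) = w i)
    (i : n) : cliffReindexHom s h (gen w i) = gen w' (s i) :=
  cliffLift_gen _ _ _ i

/-- Clifford superalgebras with the same weights up to order are isomorphic. -/
noncomputable def cliffReindex {w : n → ℝ} {w' : m → ℝ} (s : n ≃ m) (h : ∀ i, w' (s i) = w i) :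
    CornerEmbedding (cliff w) (cliff w') :=
  have h' : ∀ i, w (s.symm i) = w' i := fun i => by rw [← h, s.apply_symm_apply]
  .ofIsoSymm
    (AlgEquiv.ofAlgHom (cliffReindexHom s h) (cliffReindexHom s.symm h')
      (cliff_hom_ext fun i => by
        rw [AlgHom.comp_apply, cliffReindexHom_gen, cliffReindexHom_gen, s.apply_symm_apply]; rfl)
      (cliff_hom_ext fun i => by
        rw [AlgHom.comp_apply, cliffReindexHom_gen, cliffReindexHom_gen, s.symm_apply_apply]; rfl))
    (cliff_hom_even (cliffReindexHom s h)
      fun i => by rw [cliffReindexHom_gen]; exact gen_mem _)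

/-- The homomorphism from the Clifford superalgebra of an orthogonal sum to the skew tensor
product. -/
noncomputable def cliffSumHom (w : n → ℝ) (w' : m → ℝ) :
    cliff (Sum.elim w w') →ₐ[ℝ] (cliff w).tensor (cliff w') :=
  cliffLift _ (Sum.elim (fun i => tens (gen w i) 1) (fun j => tens 1 (gen w' j)))
    (by
      rintro (i | j)
      · change inclLeft (cliff w) (cliff w') _ * inclLeft (cliff w) (cliff w') _ = _
        rw [← map_mul, gen_mul_self, AlgHom.commutes]; rfl
      · change inclRight (cliff w) (cliff w') _ * inclRight (cliff w) (cliff w') _ = _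
        rw [← map_mul, gen_mul_self, AlgHom.commutes]; rfl)
    (by
      have key : ∀ i j, tens (1 : cliff w) (gen w' j) * tens (gen w i) (1 : cliff w') =
          -(tens (gen w i) (1 : cliff w') * tens (1 : cliff w) (gen w' j)) := fun i j => by
        rw [tens_mul_tens _ _ (gen_mem j) (gen_mem i),
          tens_mul_tens_of_even_left _ _ _ (cliff w').one_mem]
        simp
      rintro (i | i) (j | j) hij
      · change inclLeft (cliff w) (cliff w') _ * inclLeft (cliff w) (cliff w') _ =
          -(inclLeft (cliff w) (cliff w') _ * inclLeft (cliff w) (cliff w') _)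
        rw [← map_mul, gen_mul_gen (fun h => hij (congrArg _ h)), map_neg, map_mul]
      · change tens _ _ * tens _ _ = -(tens _ _ * tens _ _)
        rw [key, neg_neg]
      · exact key j i
      · change inclRight (cliff w) (cliff w') _ * inclRight (cliff w) (cliff w') _ =
          -(inclRight (cliff w) (cliff w') _ * inclRight (cliff w) (cliff w') _)
        rw [← map_mul, gen_mul_gen (fun h => hij (congrArg _ h)), map_neg, map_mul])

theorem cliffSumHom_surjective (w : n → ℝ) (w' : m → ℝ) :
    Function.Surjective (cliffSumHom w w') := by
  have hl : inclLeft (cliff w) (cliff w') = (cliffSumHom w w').comp (cliffLift w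
      (fun i => gen (Sum.elim w w') (Sum.inl i)) (fun i => by rw [gen_mul_self, Sum.elim_inl])
      (fun i j hij => gen_mul_gen (by simpa using hij))) :=
    cliff_hom_ext fun i => by
      rw [AlgHom.comp_apply, cliffLift_gen, cliffSumHom, cliffLift_gen]; rfl
  have hr : inclRight (cliff w) (cliff w') = (cliffSumHom w w').comp (cliffLift w'
      (fun i => gen (Sum.elim w w') (Sum.inr i)) (fun i => by rw [gen_mul_self, Sum.elim_inr])
      (fun i j hij => gen_mul_gen (by simpa using hij))) :=
    cliff_hom_ext fun i => by
      rw [AlgHom.comp_apply, cliffLift_gen, cliffSumHom, cliffLift_gen]; rfl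
  intro x
  induction x using tensor_induction with
  | add x y hx hy =>
    obtain ⟨x, rfl⟩ := hx
    obtain ⟨y, rfl⟩ := hy
    exact ⟨x + y, map_add _ _ _⟩
  | hom i j a ha c hc =>
    refine ⟨_ * _, (map_mul (cliffSumHom w w') _ _).trans ((congrArg₂ (· * ·)
      (AlgHom.congr_fun hl a).symm (AlgHom.congr_fun hr c).symm).trans ?_)⟩
    change tens _ _ * tens _ _ = _
    rw [tens_mul_tens_of_even_left _ _ _ (cliff w').one_mem, mul_one, one_mul]

theorem cliffSumHom_bijective (w : n → ℝ) (w' : m → ℝ) :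
    Function.Bijective (cliffSumHom w w') := by
  have : Module.Finite ℝ ((cliff w).tensor (cliff w')) := finite_tensor
  have h : Module.finrank ℝ (cliff (Sum.elim w w')) =
      Module.finrank ℝ ((cliff w).tensor (cliff w')) := by
    change _ = Module.finrank ℝ (cliff w ⊗[ℝ] cliff w')
    rw [Module.finrank_tensorProduct, (cliff_finrank w).2, (cliff_finrank w').2,
      (cliff_finrank _).2, Fintype.card_sum, pow_add]
  exact ⟨(LinearMap.injective_iff_surjective_of_finrank_eq_finrank
    (f := (cliffSumHom w w').toLinearMap) h).mpr (cliffSumHom_surjective w w'),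
    cliffSumHom_surjective w w'⟩

theorem cliffSumHom_mem (w : n → ℝ) (w' : m → ℝ) (i : ZMod 2) (x : cliff (Sum.elim w w'))
    (hx : x ∈ (cliff (Sum.elim w w')).part i) :
    cliffSumHom w w' x ∈ ((cliff w).tensor (cliff w')).part i := by
  refine cliff_hom_even _ ?_ i x hx
  rintro (i | j) <;> rw [cliffSumHom, cliffLift_gen]
  · exact inclLeft_mem _ _ (gen_mem i)
  · exact inclRight_mem _ _ (gen_mem j)

/-- The Clifford superalgebra of an orthogonal sum is the skew tensor product. -/
noncomputable def cliffSum (w : n → ℝ) (w' : m → ℝ) :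
    CornerEmbedding (cliff (Sum.elim w w')) ((cliff w).tensor (cliff w')) :=
  .ofIsoSymm (AlgEquiv.ofBijective _ (cliffSumHom_bijective w w')) (cliffSumHom_mem w w')

/-- The skew tensor product of Clifford superalgebras is the one of the orthogonal sum. -/
noncomputable def cliffSumSymm (w : n → ℝ) (w' : m → ℝ) :
    CornerEmbedding ((cliff w).tensor (cliff w')) (cliff (Sum.elim w w')) :=
  .ofIso (AlgEquiv.ofBijective _ (cliffSumHom_bijective w w')) (cliffSumHom_mem w w')

/-! ### The twist of a Clifford superalgebra by `π` -/

/-- The parity involution as a linear map. -/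
noncomputable def SuperAlg.parityLin {K : Type u} [Field K] (A : SuperAlg K) : A →ₗ[K] A :=
  A.proj 0 - A.proj 1

theorem SuperAlg.parity_mem {K : Type u} [Field K] (A : SuperAlg K) {i : ZMod 2} {a : A}
    (h : a ∈ A.part i) : A.parity a ∈ A.part i := A.twist_mem .pi h

theorem parity_gen (i : n) : (cliff w).parity (gen w i) = -gen w i :=
  (cliff w).parity_of_mem_one (gen_mem i)

/-- The Clifford algebra with the opposite squares acts on a Clifford algebra, a generator by
`x ↦ v x̄` with `x̄` the parity involution of `x`. -/
noncomputable def negAction (w w' : n → ℝ) (h : ∀ i, w' i = -w i) :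
    cliff w' →ₐ[ℝ] Module.End ℝ (cliff w) :=
  cliffLift w' (fun i => LinearMap.mulLeft ℝ (gen w i) ∘ₗ (cliff w).parityLin)
    (fun i => LinearMap.ext fun x => by
      change gen w i * (cliff w).parity (gen w i * (cliff w).parity x) = w' i • x
      rw [map_mul, parity_gen, (cliff w).parity_parity, neg_mul, mul_neg, ← mul_assoc,
        gen_mul_self, ← Algebra.smul_def, h, neg_smul])
    (fun i j hij => LinearMap.ext fun x => by
      change gen w i * (cliff w).parity (gen w j * (cliff w).parity x) =
        -(gen w j * (cliff w).parity (gen w i * (cliff w).parity x))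
      rw [map_mul, map_mul, parity_gen, parity_gen, (cliff w).parity_parity, neg_mul, mul_neg,
        neg_mul, mul_neg, ← mul_assoc, ← mul_assoc, gen_mul_gen hij, neg_mul])

/-- The orbit map of `1` under the action of the Clifford algebra with the opposite squares. -/
noncomputable def negMap (w w' : n → ℝ) (h : ∀ i, w' i = -w i) : cliff w' →ₗ[ℝ] cliff w :=
  LinearMap.applyₗ (1 : cliff w) ∘ₗ (negAction w w' h).toLinearMap

variable {w' : n → ℝ} (h : ∀ i, w' i = -w i)

theorem negMap_one : negMap w w' h 1 = 1 := by
  change negAction w w' h 1 1 = 1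
  rw [map_one (negAction w w' h)]
  rfl

theorem negMap_gen_mul (i : n) (x : cliff w') :
    negMap w w' h (gen w' i * x) = gen w i * (cliff w).parity (negMap w w' h x) := by
  change negAction w w' h (gen w' i * x) 1 = _
  rw [map_mul, negAction, cliffLift_gen]
  rfl

theorem negMap_mem (k : ZMod 2) (x : cliff w') (hx : x ∈ (cliff w').part k) :
    negMap w w' h x ∈ (cliff w).part k := by
  refine cliff_linearMap_even _ ?_ ?_ k x hx
  · rw [negMap_one]; exact (cliff w).one_mem
  · intro i x k hx
    rw [negMap_gen_mul]
    exact (cliff w).mul_mem (gen_mem i) ((cliff w).parity_mem hx)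

theorem negMap_parity (x : cliff w') :
    negMap w w' h ((cliff w').parity x) = (cliff w).parity (negMap w w' h x) := by
  induction x using (cliff w').isCompl.induction with
  | add x y hx hy => simp only [map_add, hx, hy]
  | hom i x hx =>
    have hm := negMap_mem h i x hx
    rcases ZMod.two_cases i with rfl | rfl
    · rw [(cliff w').parity_of_mem_zero hx, (cliff w).parity_of_mem_zero hm]
    · rw [(cliff w').parity_of_mem_one hx, (cliff w).parity_of_mem_one hm, map_neg]

theorem negMap_negMap (h' : ∀ i, w i = -w' i) (x : cliff w') :
    negMap w' w h' (negMap w w' h x) = x := by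
  refine cliff_mem_of_stable (w := w')
    (L := LinearMap.eqLocus (negMap w' w h' ∘ₗ negMap w w' h) LinearMap.id) ?_ ?_ x
  · change negMap w' w h' (negMap w w' h 1) = 1
    rw [negMap_one, negMap_one]
  · intro i x hx
    change negMap w' w h' (negMap w w' h (gen w' i * x)) = gen w' i * x
    change negMap w' w h' (negMap w w' h x) = x at hx
    rw [negMap_gen_mul, negMap_gen_mul, negMap_parity, hx, (cliff w').parity_parity]

theorem negMap_mul_of_even (a : cliff w') {c : cliff w'} (hc : c ∈ (cliff w').part 0) :
    negMap w w' h (a * c) = negMap w w' h a * negMap w w' h c := by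
  refine cliff_mem_of_stable (w := w') (L := LinearMap.eqLocus
    (negMap w w' h ∘ₗ LinearMap.mulRight ℝ c)
    (LinearMap.mulRight ℝ (negMap w w' h c) ∘ₗ negMap w w' h)) ?_ ?_ a
  · change negMap w w' h (1 * c) = negMap w w' h 1 * negMap w w' h c
    rw [one_mul, negMap_one, one_mul]
  · intro i x hx
    change negMap w w' h (gen w' i * x * c) = negMap w w' h (gen w' i * x) * negMap w w' h c
    change negMap w w' h (x * c) = negMap w w' h x * negMap w w' h c at hx
    rw [mul_assoc, negMap_gen_mul, negMap_gen_mul, hx, map_mul,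
      (cliff w).parity_of_mem_zero (negMap_mem h _ _ hc), mul_assoc]

theorem negMap_mul_of_odd (a : cliff w') {c : cliff w'} (hc : c ∈ (cliff w').part 1) :
    negMap w w' h (a * c) = negMap w w' h ((cliff w').parity a) * negMap w w' h c := by
  refine cliff_mem_of_stable (w := w') (L := LinearMap.eqLocus
    (negMap w w' h ∘ₗ LinearMap.mulRight ℝ c)
    (LinearMap.mulRight ℝ (negMap w w' h c) ∘ₗ negMap w w' h ∘ₗ (cliff w').parityLin)) ?_ ?_ a
  · change negMap w w' h (1 * c) = negMap w w' h ((cliff w').parity 1) * negMap w w' h c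
    rw [one_mul, map_one, negMap_one, one_mul]
  · intro i x hx
    change negMap w w' h (gen w' i * x * c) =
      negMap w w' h ((cliff w').parity (gen w' i * x)) * negMap w w' h c
    change negMap w w' h (x * c) = negMap w w' h ((cliff w').parity x) * negMap w w' h c at hx
    rw [mul_assoc, negMap_gen_mul, hx, map_mul,
      (cliff w).parity_of_mem_one (negMap_mem h _ _ hc), map_mul, parity_gen, neg_mul, map_neg,
      negMap_gen_mul, mul_neg, mul_neg, neg_mul, mul_assoc]

/-- The `π`-twist of a Clifford superalgebra is the Clifford superalgebra with the opposite
squares. -/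
noncomputable def cliffTwist : Twist .pi (cliff w') (cliff w) where
  toEquiv := LinearEquiv.ofLinearMap (negMap w w' h) (negMap w' w fun i => by rw [h, neg_neg])
    (LinearMap.ext (negMap_negMap _ _)) (LinearMap.ext (negMap_negMap _ _))
  map_mem := negMap_mem h
  map_mul a c := by
    change negMap w w' h a * negMap w w' h c =
      negMap w w' h (a * (cliff w').proj 0 c + (cliff w').parity a * (cliff w').proj 1 c)
    rw [map_add, negMap_mul_of_even h _ ((cliff w').proj_mem 0 c),
      negMap_mul_of_odd h _ ((cliff w').proj_mem 1 c), (cliff w').parity_parity, ← mul_add,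
      ← map_add, (cliff w').proj_add_proj]

end Cliff

open SuperAlg

/-! ### Products of anticommuting elements -/

section Anticommuting

variable {A : Type*} [Ring A]

theorem mul_left_comm_of_anticommute {x y : A} (h : y * x = -(x * y)) (z : A) :
    y * (x * z) = -(x * (y * z)) := by
  rw [← mul_assoc, h, neg_mul, mul_assoc]

theorem mul_left_of_mul_self {x s : A} (h : x * x = s) (z : A) : x * (x * z) = s * z := by
  rw [← mul_assoc, h]

variable {a b c d s : A}

/-- The product of four anticommuting elements with the same square `± 1` is an involution that
anticommutes with each of them. -/
theorem volume_mul_self (hs : s = 1 ∨ s = -1)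
    (ha : a * a = s) (hb : b * b = s) (hc : c * c = s) (hd : d * d = s)
    (ba : b * a = -(a * b)) (ca : c * a = -(a * c)) (da : d * a = -(a * d))
    (cb : c * b = -(b * c)) (db : d * b = -(b * d)) (dc : d * c = -(c * d)) :
    (a * b * c * d) * (a * b * c * d) = 1 ∧
    (a * (a * b * c * d) = -((a * b * c * d) * a) ∧
      b * (a * b * c * d) = -((a * b * c * d) * b) ∧
      c * (a * b * c * d) = -((a * b * c * d) * c) ∧
      d * (a * b * c * d) = -((a * b * c * d) * d)) ∧
    a * b * (a * b * c * d) = (a * b * c * d) * (a * b) ∧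
    b * c * (a * b * c * d) = (a * b * c * d) * (b * c) ∧
    a * d = -(b * c) * (a * b * c * d) := by
  rcases hs with rfl | rfl <;>
  simp [mul_assoc, da, db, dc, mul_left_comm_of_anticommute ba,
    mul_left_comm_of_anticommute ca, mul_left_comm_of_anticommute da,
    mul_left_comm_of_anticommute cb, mul_left_comm_of_anticommute db,
    mul_left_comm_of_anticommute dc, ha, hb, hc, hd, mul_left_of_mul_self ha,
    mul_left_of_mul_self hb, mul_left_of_mul_self hc]

/-- The quaternions acting through the products `a b` and `b c` of anticommuting elements `a`, `b`,
`c` with the same square `± 1`. -/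
def quaternionBasis [Algebra ℝ A] (hs : s = 1 ∨ s = -1)
    (ha : a * a = s) (hb : b * b = s) (hc : c * c = s)
    (ba : b * a = -(a * b)) (ca : c * a = -(a * c)) (cb : c * b = -(b * c)) :
    QuaternionAlgebra.Basis A (-1 : ℝ) 0 (-1) where
  i := a * b
  j := b * c
  k := a * b * (b * c)
  i_mul_i := by
    rcases hs with rfl | rfl <;>
    simp [mul_assoc, mul_left_comm_of_anticommute ba, ha, hb]
  j_mul_j := by
    rcases hs with rfl | rfl <;>
    simp [mul_assoc, mul_left_comm_of_anticommute cb, hb, hc]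
  i_mul_j := rfl
  j_mul_i := by
    rcases hs with rfl | rfl <;>
    simp [mul_assoc, cb, mul_left_comm_of_anticommute ba, mul_left_comm_of_anticommute ca,
      mul_left_of_mul_self hb]

/-- The homomorphism from the quaternions given by the images of `i` and `j`. -/
def quaternionHom [Algebra ℝ A] (B : QuaternionAlgebra.Basis A (-1 : ℝ) 0 (-1)) :
    Quaternion ℝ →ₐ[ℝ] A := B.liftHom

theorem quaternionHom_apply [Algebra ℝ A] (B : QuaternionAlgebra.Basis A (-1 : ℝ) 0 (-1))
    (q : Quaternion ℝ) :
    quaternionHom B q = algebraMap ℝ A q.re + q.imI • B.i + q.imJ • B.j + q.imK • B.k := rfl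

theorem exists_quaternionHom_eq [Algebra ℝ A] (B : QuaternionAlgebra.Basis A (-1 : ℝ) 0 (-1)) :
    (∃ q, quaternionHom B q = B.i) ∧ (∃ q, quaternionHom B q = B.j) ∧
      ∃ q, quaternionHom B q = B.k := by
  refine ⟨⟨(⟨0, 1, 0, 0⟩ : QuaternionAlgebra ℝ (-1) 0 (-1)), ?_⟩,
    ⟨(⟨0, 0, 1, 0⟩ : QuaternionAlgebra ℝ (-1) 0 (-1)), ?_⟩,
    ⟨(⟨0, 0, 0, 1⟩ : QuaternionAlgebra ℝ (-1) 0 (-1)), ?_⟩⟩ <;>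
  · refine (quaternionHom_apply B _).trans ?_
    simp only [map_zero, zero_smul, one_smul, zero_add, add_zero]

/-- An involution `v` that anticommutes with `u` gives the idempotent `(1 + v) / 2`, which `u`
exchanges with its complement. -/
theorem half_one_add [Algebra ℝ A] {v u : A} (hv : v * v = 1) (huv : u * v = -(v * u)) :
    ((1 / 2 : ℝ) • (1 + v)) * ((1 / 2 : ℝ) • (1 + v)) = (1 / 2 : ℝ) • (1 + v) ∧
    u * ((1 / 2 : ℝ) • (1 + v)) = (1 - (1 / 2 : ℝ) • (1 + v)) * u ∧
    v * ((1 / 2 : ℝ) • (1 + v)) = (1 / 2 : ℝ) • (1 + v) := by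
  refine ⟨?_, ?_, ?_⟩
  · rw [smul_mul_smul_comm, mul_add, add_mul, add_mul, hv, one_mul, one_mul, mul_one]
    module
  · rw [mul_smul_comm, mul_add, huv, sub_mul, smul_mul_assoc, add_mul, one_mul, mul_one]
    module
  · rw [mul_smul_comm, mul_add, hv, mul_one, add_comm]

end Anticommuting

/-! ### Corners of small Clifford superalgebras -/

theorem SuperAlg.mul_mem_zero_of_odd {K : Type u} [Field K] (A : SuperAlg K) {a b : A}
    (ha : a ∈ A.part 1) (hb : b ∈ A.part 1) : a * b ∈ A.part 0 :=
  (by decide : (1 + 1 : ZMod 2) = 0) ▸ A.mul_mem ha hb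

theorem SuperAlg.mul_mem_zero_of_even {K : Type u} [Field K] (A : SuperAlg K) {a b : A}
    (ha : a ∈ A.part 0) (hb : b ∈ A.part 0) : a * b ∈ A.part 0 :=
  add_zero (0 : ZMod 2) ▸ A.mul_mem ha hb

theorem mem_part_of_concentrated {E : Type} [Ring E] [Algebra ℝ E] {A : SuperAlg ℝ}
    {f : E →ₗ[ℝ] A} (hf : ∀ x, f x ∈ A.part 0) (i : ZMod 2) (b : concentrated ℝ E)
    (hb : b ∈ (concentrated ℝ E).part i) : f b ∈ A.part i := by
  rcases ZMod.two_cases i with rfl | rfl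
  · exact hf b
  · change (b : E) ∈ (if (1 : ZMod 2) = 0 then ⊤ else ⊥ : Submodule ℝ E) at hb
    rw [if_neg (by decide)] at hb
    have h0 : (b : E) = 0 := (Submodule.mem_bot ℝ).mp hb
    have h1 : f b = 0 := (congrArg f h0).trans (map_zero f)
    exact h1 ▸ zero_mem _

section

variable {n : Type} [Fintype n] [DecidableEq n] {w : n → ℝ} {E : Type} [DivisionRing E]
  [Algebra ℝ E]

/-- Let `v` be an even involution commuting with the division algebra `E` of even elements, and
`u` an odd generator with `u² = 1` that anticommutes with `v`. Then `e = (1 + v) / 2` is full,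
because `u` exchanges `e` and `1 - e`. If `u g` lies in `E ∪ E v` for each other generator `g`, then
`E e + u E e` is stable under the generators, hence a left ideal, and `E` is the corner of `e`. -/
theorem nonempty_cornerEmbedding_of_involution (f : E →ₐ[ℝ] cliff w)
    (hf : ∀ x, f x ∈ (cliff w).part 0) {u v : cliff w} (hu : u ∈ (cliff w).part 1)
    (huu : u * u = 1) (hv : v ∈ (cliff w).part 0) (hvv : v * v = 1) (huv : u * v = -(v * u))
    (hc : ∀ x, f x * v = v * f x)
    (hg : ∀ i, gen w i = u ∨ (gen w i * u = -(u * gen w i) ∧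
      ∃ x, u * gen w i = f x ∨ u * gen w i = f x * v)) :
    Nonempty (CornerEmbedding (cliff w) (concentrated ℝ E)) := by
  obtain ⟨hee, hue, hve⟩ := half_one_add hvv huv
  generalize he : (1 / 2 : ℝ) • (1 + v) = e at hee hue hve
  have hem : e ∈ (cliff w).part 0 := by
    rw [← he]
    exact Submodule.smul_mem _ _ (add_mem (cliff w).one_mem hv)
  have hce : ∀ x, e * f x = f x * e := fun x => by
    rw [← he, smul_mul_assoc, mul_smul_comm, add_mul, mul_add, hc, one_mul, mul_one]
  have e0 : e ≠ 0 := by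
    rintro h
    rw [h, mul_zero, sub_zero, one_mul] at hue
    rw [← hue, mul_zero] at huu
    exact zero_ne_one huu
  have heu : e * u = u - u * e := by rw [hue]; noncomm_ring
  -- since `v e = e`, products of generators with `u` act on `e` through `E`
  have h1 : ∀ i, ∃ x, u * gen w i * e = f x * e := fun i => by
    rcases hg i with h | ⟨-, x, h | h⟩
    · exact ⟨1, by rw [h, huu, map_one]⟩
    · exact ⟨x, by rw [h]⟩
    · exact ⟨x, by rw [h, mul_assoc, hve]⟩
  have h2 : ∀ i, ∃ x, gen w i * u * e = f x * e := fun i => by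
    rcases hg i with h | ⟨h, -⟩
    · exact ⟨1, by rw [h, huu, map_one]⟩
    · obtain ⟨x, hx⟩ := h1 i
      exact ⟨-x, by rw [h, neg_mul, hx, map_neg, neg_mul]⟩
  let φ : E →ₙₐ[ℝ] cliff w :=
    { toFun := fun x => f x * e
      map_smul' := fun k x => by rw [map_smul, smul_mul_assoc]; rfl
      map_zero' := by rw [map_zero, zero_mul]
      map_add' := fun x y => by rw [map_add, add_mul]
      map_mul' := fun x y => by
        rw [map_mul, mul_assoc (f x) e, ← mul_assoc e, hce, mul_assoc (f y), hee, mul_assoc] }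
  have φ1 : φ 1 = e := by
    change f 1 * e = e
    rw [map_one, one_mul]
  have hφ : Function.Injective φ := by
    refine (injective_iff_map_eq_zero φ).mpr fun x hx => ?_
    by_contra hne
    exact e0 (by rw [← φ1, ← inv_mul_cancel₀ hne, map_mul, hx, mul_zero])
  -- the `x` with `x e ∈ E e + u E e`
  let L : Submodule ℝ (cliff w) :=
    (LinearMap.range (φ : E →ₗ[ℝ] cliff w) ⊔
      (LinearMap.range (φ : E →ₗ[ℝ] cliff w)).map (LinearMap.mulLeft ℝ u)).comap
        (LinearMap.mulRight ℝ e)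
  have hL : ∀ x, ∃ y z, f y * e + u * (f z * e) = x * e := by
    intro x
    have hx : x ∈ L := by
      refine cliff_mem_of_stable ?_ ?_ x
      · refine Submodule.mem_sup_left ⟨1, φ1.trans (one_mul e).symm⟩
      · intro i x hx
        obtain ⟨_, ⟨y, rfl⟩, _, ⟨_, ⟨z, rfl⟩, rfl⟩, h⟩ := Submodule.mem_sup.mp hx
        change f y * e + u * (f z * e) = x * e at h
        obtain ⟨y', hy'⟩ := h1 i
        obtain ⟨z', hz'⟩ := h2 i
        refine Submodule.mem_sup.mpr
          ⟨_, ⟨z' * z, rfl⟩, _, ⟨_, ⟨y' * y, rfl⟩, rfl⟩, ?_⟩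
        change f (z' * z) * e + u * (f (y' * y) * e) = gen w i * x * e
        have k1 : f (z' * z) * e = gen w i * u * (f z * e) := by
          rw [map_mul, mul_assoc, ← hce, ← mul_assoc, ← hz', mul_assoc (gen w i * u)]
        have k2 : f (y' * y) * e = u * gen w i * (f y * e) := by
          rw [map_mul, mul_assoc, ← hce, ← mul_assoc, ← hy', mul_assoc (u * gen w i)]
        rw [k1, k2, mul_assoc (gen w i) x, ← h, ← mul_assoc u, ← mul_assoc u, huu, one_mul,
          mul_add, mul_assoc, add_comm]
    obtain ⟨_, ⟨y, rfl⟩, _, ⟨_, ⟨z, rfl⟩, rfl⟩, h⟩ := Submodule.mem_sup.mp hx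
    exact ⟨y, z, h⟩
  have corner : ∀ x, ∃ y, φ y = φ 1 * x * φ 1 := by
    intro x
    obtain ⟨y, z, h⟩ := hL x
    refine ⟨y, ?_⟩
    have k1 : e * (f y * e) = f y * e := by rw [← mul_assoc, hce, mul_assoc, hee]
    have k2 : e * (f z * e) = f z * e := by rw [← mul_assoc, hce, mul_assoc, hee]
    rw [φ1, mul_assoc, ← h, mul_add, k1, ← mul_assoc, heu, sub_mul, mul_assoc u, k2, sub_self,
      add_zero]
    rfl
  have full : (1 : cliff w) ∈ Submodule.span ℝ {z : cliff w | ∃ i, ∃ x ∈ (cliff w).part i,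
      ∃ y ∈ (cliff w).part i, z = x * φ 1 * y} := by
    have : (1 : cliff w) = 1 * φ 1 * 1 + u * φ 1 * u := by
      rw [φ1, hue, mul_assoc _ u u, huu]; noncomm_ring
    rw [this]
    exact add_mem
      (Submodule.subset_span ⟨0, 1, (cliff w).one_mem, 1, (cliff w).one_mem, rfl⟩)
      (Submodule.subset_span ⟨1, u, hu, u, hu, rfl⟩)
  exact ⟨⟨φ, hφ, mem_part_of_concentrated (f := (φ : E →ₗ[ℝ] cliff w)) fun x =>
    (cliff w).mul_mem_zero_of_even (hf x) hem, corner, full⟩⟩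

end

theorem quaternionHom_mem_even {A : SuperAlg ℝ} (B : QuaternionAlgebra.Basis A (-1 : ℝ) 0 (-1))
    (hi : B.i ∈ A.part 0) (hj : B.j ∈ A.part 0) (q : Quaternion ℝ) :
    quaternionHom B q ∈ A.part 0 := by
  rw [quaternionHom_apply]
  refine add_mem (add_mem (add_mem ?_ ?_) ?_) ?_
  · exact SetLike.algebraMap_mem_graded A.part _
  · exact Submodule.smul_mem _ _ hi
  · exact Submodule.smul_mem _ _ hj
  · rw [← B.i_mul_j]
    exact Submodule.smul_mem _ _ (A.mul_mem_zero_of_even hi hj)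

section

variable {n : Type} [Fintype n] [DecidableEq n] {w : n → ℝ}

theorem gen_mul_self_of_one {i : n} (h : w i = 1) : gen w i * gen w i = 1 := by
  rw [gen_mul_self, h, map_one]

theorem gen_mul_self_of_neg_one {i : n} (h : w i = -1) : gen w i * gen w i = -1 := by
  rw [gen_mul_self, h, map_neg, map_one]

/-- The Clifford superalgebra of the hyperbolic plane has the ground field as a corner, that of
`(1 + x y) / 2` for the two generators `x` and `y`. -/
theorem nonempty_corner_hyperbolic {x y : n} (hx : w x = 1) (hy : w y = -1)
    (h : ∀ i, i = x ∨ i = y) : Nonempty (CornerEmbedding (cliff w) (concentrated ℝ ℝ)) := by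
  have hxy : y ≠ x := by
    rintro rfl
    linarith
  have huu := gen_mul_self_of_one hx
  have hyy := gen_mul_self_of_neg_one hy
  have hyu := gen_mul_gen (w := w) hxy
  have hum := gen_mem (w := w) x
  have hym := gen_mem (w := w) y
  refine nonempty_cornerEmbedding_of_involution (E := ℝ) (Algebra.ofId ℝ _)
    (fun x => SetLike.algebraMap_mem_graded (cliff w).part x) hum huu
    ((cliff w).mul_mem_zero_of_odd hum hym) ?_ ?_ (fun x => Algebra.commutes _ _) ?_
  · rw [mul_assoc, mul_left_comm_of_anticommute hyu, hyy, mul_neg, mul_left_of_mul_self huu]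
    simp
  · rw [mul_assoc, hyu, mul_neg, neg_neg]
  · intro i
    rcases h i with rfl | rfl
    · exact Or.inl rfl
    · exact Or.inr ⟨hyu, 1, Or.inr (by rw [map_one, one_mul])⟩

/-- The Clifford superalgebra with four generators of square `1` has the quaternions as a corner:
with `ω` the product of the generators `a`, `b`, `c`, `d`, the corner of `(1 + ω) / 2` is generated
by `a b` and `b c`. -/
theorem nonempty_corner_four {i₀ i₁ i₂ i₃ : n} (hw : ∀ i, w i = 1)
    (h10 : i₁ ≠ i₀) (h20 : i₂ ≠ i₀) (h30 : i₃ ≠ i₀) (h21 : i₂ ≠ i₁) (h31 : i₃ ≠ i₁) (h32 : i₃ ≠ i₂)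
    (h : ∀ i, i = i₀ ∨ i = i₁ ∨ i = i₂ ∨ i = i₃) :
    Nonempty (CornerEmbedding (cliff w) quaternionSuperAlg) := by
  have ha := gen_mul_self_of_one (hw i₀)
  have hb := gen_mul_self_of_one (hw i₁)
  have hc := gen_mul_self_of_one (hw i₂)
  have hd := gen_mul_self_of_one (hw i₃)
  have ba := gen_mul_gen (w := w) h10
  have ca := gen_mul_gen (w := w) h20
  have da := gen_mul_gen (w := w) h30
  have cb := gen_mul_gen (w := w) h21
  have db := gen_mul_gen (w := w) h31
  have dc := gen_mul_gen (w := w) h32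
  have mem := gen_mem (w := w)
  have mem2 := fun i j : n => (cliff w).mul_mem_zero_of_odd (mem i) (mem j)
  obtain ⟨hvv, ⟨hav, -, -, -⟩, hiv, hjv, had⟩ :=
    volume_mul_self (Or.inl rfl) ha hb hc hd ba ca da cb db dc
  have hk : gen w i₀ * gen w i₁ * (gen w i₁ * gen w i₂) = gen w i₀ * gen w i₂ := by
    rw [mul_assoc, ← mul_assoc (gen w i₁), hb, one_mul]
  let Q := quaternionBasis (Or.inl rfl) ha hb hc ba ca cb
  refine nonempty_cornerEmbedding_of_involution (E := Quaternion ℝ) (quaternionHom Q)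
    (quaternionHom_mem_even Q (mem2 i₀ i₁) (mem2 i₁ i₂)) (mem i₀) ha
    (by rw [mul_assoc]; exact (cliff w).mul_mem_zero_of_even (mem2 i₀ i₁) (mem2 i₂ i₃))
    hvv hav ?_ ?_
  · intro x
    rw [quaternionHom_apply, ← Q.i_mul_j]
    have hi : Q.i * _ = _ * Q.i := hiv
    have hj : Q.j * _ = _ * Q.j := hjv
    have hij : Q.i * Q.j * (gen w i₀ * gen w i₁ * gen w i₂ * gen w i₃) =
        (gen w i₀ * gen w i₁ * gen w i₂ * gen w i₃) * (Q.i * Q.j) := by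
      rw [mul_assoc, hj, ← mul_assoc, hi, mul_assoc]
    rw [add_mul, add_mul, add_mul, smul_mul_assoc, smul_mul_assoc, smul_mul_assoc, hi, hj, hij,
      mul_add, mul_add, mul_add, mul_smul_comm, mul_smul_comm, mul_smul_comm, Algebra.commutes]
  · obtain ⟨⟨qi, hqi⟩, ⟨qj, hqj⟩, qk, hqk⟩ := exists_quaternionHom_eq Q
    intro i
    rcases h i with rfl | rfl | rfl | rfl
    · exact Or.inl rfl
    · exact Or.inr ⟨ba, qi, Or.inl hqi.symm⟩
    · exact Or.inr ⟨ca, qk, Or.inl (hk.symm.trans hqk.symm)⟩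
    · refine Or.inr ⟨da, -qj, Or.inr ?_⟩
      rw [map_neg, hqj]
      exact had

end

/-! ### Changing the sign of four squares -/

section

theorem mul_volume_mul_mul_volume {A : Type*} [Ring A] {v x y : A} (hv : v * v = 1)
    (hy : y * v = -(v * y)) : x * v * (y * v) = -(x * y) := by
  rw [hy, mul_neg, mul_assoc, ← mul_assoc v, hv, one_mul]

variable {n : Type} [Fintype n] [DecidableEq n] {w w' : n → ℝ}

/-- If four generators have the same square `s = ± 1`, then their products with the product `ω` of
all four are anticommuting elements with squares `-s`. They generate the algebra because their
product is again `ω`. -/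
theorem nonempty_cornerEmbedding_neg_four {s : ℝ} (hs : s = 1 ∨ s = -1) (hw : ∀ i, w i = -s)
    (hw' : ∀ i, w' i = s) {i₀ i₁ i₂ i₃ : n}
    (h10 : i₁ ≠ i₀) (h20 : i₂ ≠ i₀) (h30 : i₃ ≠ i₀) (h21 : i₂ ≠ i₁) (h31 : i₃ ≠ i₁) (h32 : i₃ ≠ i₂)
    (h : ∀ i, i = i₀ ∨ i = i₁ ∨ i = i₂ ∨ i = i₃) :
    Nonempty (CornerEmbedding (cliff w) (cliff w')) := by
  have hs' : algebraMap ℝ (cliff w') s = 1 ∨ algebraMap ℝ (cliff w') s = -1 := by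
    rcases hs with rfl | rfl
    · exact Or.inl (map_one _)
    · exact Or.inr (by rw [map_neg, map_one])
  have sq : ∀ i, gen w' i * gen w' i = algebraMap ℝ (cliff w') s := fun i => by
    rw [gen_mul_self, hw']
  obtain ⟨hvv, ⟨hv0, hv1, hv2, hv3⟩, -, -, -⟩ :=
    volume_mul_self hs' (sq i₀) (sq i₁) (sq i₂) (sq i₃) (gen_mul_gen h10) (gen_mul_gen h20)
      (gen_mul_gen h30) (gen_mul_gen h21) (gen_mul_gen h31) (gen_mul_gen h32)
  have hvm : gen w' i₀ * gen w' i₁ * gen w' i₂ * gen w' i₃ ∈ (cliff w').part 0 := by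
    rw [mul_assoc]
    exact (cliff w').mul_mem_zero_of_even ((cliff w').mul_mem_zero_of_odd (gen_mem _) (gen_mem _))
      ((cliff w').mul_mem_zero_of_odd (gen_mem _) (gen_mem _))
  have hprod : ∀ v : cliff w', v * v = 1 → gen w' i₁ * v = -(v * gen w' i₁) →
      gen w' i₃ * v = -(v * gen w' i₃) →
      gen w' i₀ * v * (gen w' i₁ * v) * (gen w' i₂ * v * (gen w' i₃ * v)) =
        gen w' i₀ * gen w' i₁ * gen w' i₂ * gen w' i₃ := fun v hv h1 h3 => by
    rw [mul_volume_mul_mul_volume hv h1, mul_volume_mul_mul_volume hv h3, neg_mul_neg,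
      ← mul_assoc]
  replace hprod := hprod _ hvv hv1 hv3
  generalize hv : gen w' i₀ * gen w' i₁ * gen w' i₂ * gen w' i₃ = v at *
  have anti : ∀ i, gen w' i * v = -(v * gen w' i) := fun i => by
    rcases h i with rfl | rfl | rfl | rfl <;> assumption
  let φ : cliff w →ₐ[ℝ] cliff w' := cliffLift w (fun i => gen w' i * v)
    (fun i => by
      rw [mul_volume_mul_mul_volume hvv (anti i), sq, hw, map_neg])
    (fun i j hij => by
      rw [mul_volume_mul_mul_volume hvv (anti j), mul_volume_mul_mul_volume hvv (anti i), neg_neg,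
        gen_mul_gen hij, neg_neg])
  have hφ : ∀ i, φ (gen w i) = gen w' i * v := cliffLift_gen _ _ _
  have hvr : v ∈ φ.range := by
    rw [← hprod, ← hφ, ← hφ, ← hφ, ← hφ, ← map_mul, ← map_mul, ← map_mul]
    exact ⟨_, rfl⟩
  have hgr : ∀ i, gen w' i ∈ φ.range := fun i => by
    have : gen w' i = φ (gen w i) * v := by rw [hφ, mul_assoc, hvv, mul_one]
    rw [this]
    exact φ.range.mul_mem ⟨_, rfl⟩ hvr
  have hsurj : Function.Surjective φ := cliff_mem_of_stable
    (L := Subalgebra.toSubmodule φ.range) (one_mem φ.range) fun i x hx => φ.range.mul_mem (hgr i) hx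
  have hinj : Function.Injective φ := (LinearMap.injective_iff_surjective_of_finrank_eq_finrank
    (f := φ.toLinearMap) (by rw [(cliff_finrank w).2, (cliff_finrank w').2])).mpr hsurj
  exact ⟨.ofIsoSymm (AlgEquiv.ofBijective φ ⟨hinj, hsurj⟩) (cliff_hom_even φ fun i => by
    rw [hφ]
    exact add_zero (1 : ZMod 2) ▸ (cliff w').mul_mem (gen_mem i) hvm)⟩

end

/-! ### Real Clifford superalgebras up to full corners -/

/-- The weights of the generators of `ℝ_{p,q,r}`. -/
def weight (p q r : ℕ) : Fin p ⊕ Fin q ⊕ Fin r → ℝ :=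
  Sum.elim (fun _ => 1) (Sum.elim (fun _ => -1) (fun _ => 0))

/-- Splitting the generators of a Clifford superalgebra into two groups. -/
def weightSumEquiv (a b c p q r : ℕ) : (Fin a ⊕ Fin b ⊕ Fin c) ⊕ (Fin p ⊕ Fin q ⊕ Fin r) ≃
    Fin (a + p) ⊕ Fin (b + q) ⊕ Fin (c + r) :=
  (Equiv.sumSumSumComm _ _ _ _).trans <| Equiv.sumCongr finSumFinEquiv <|
    (Equiv.sumSumSumComm _ _ _ _).trans <| Equiv.sumCongr finSumFinEquiv finSumFinEquiv

theorem weight_weightSumEquiv (a b c p q r : ℕ) (i) :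
    weight (a + p) (b + q) (c + r) (weightSumEquiv a b c p q r i) =
      Sum.elim (weight a b c) (weight p q r) i := by
  rcases i with (i | i | i) | (i | i | i) <;> rfl

/-- `ℝ_{a+p,b+q,c+r} ≅ ℝ_{a,b,c} ⊗ ℝ_{p,q,r}`. -/
noncomputable def realCliffordAdd (a b c p q r : ℕ) :
    CornerEmbedding (realClifford (a + p) (b + q) (c + r))
      ((realClifford a b c).tensor (realClifford p q r)) :=
  .trans (cliffReindex (weightSumEquiv a b c p q r).symm fun i => by
    refine (weight_weightSumEquiv a b c p q r _).symm.trans ?_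
    rw [Equiv.apply_symm_apply]
    rfl) (cliffSum _ _)

/-- `ℝ_{a,b,c} ⊗ ℝ_{p,q,r} ≅ ℝ_{a+p,b+q,c+r}`. -/
noncomputable def realCliffordAddSymm (a b c p q r : ℕ) :
    CornerEmbedding ((realClifford a b c).tensor (realClifford p q r))
      (realClifford (a + p) (b + q) (c + r)) :=
  .trans (cliffSumSymm _ _) (cliffReindex (weightSumEquiv a b c p q r)
    (weight_weightSumEquiv a b c p q r))

/-- The hyperbolic plane can be cancelled. -/
theorem nonempty_corner_cancel (p q r : ℕ) :
    Nonempty (CornerEmbedding (realClifford (p + 1) (q + 1) r) (realClifford p q r)) := by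
  obtain ⟨f⟩ : Nonempty (CornerEmbedding (realClifford 1 1 0) (concentrated ℝ ℝ)) :=
    nonempty_corner_hyperbolic (w := weight 1 1 0) (x := .inl 0) (y := .inr (.inl 0)) rfl rfl (by
      rintro (i | i | i)
      · exact Or.inl (by rw [Subsingleton.elim i 0])
      · exact Or.inr (by rw [Subsingleton.elim i 0])
      · exact i.elim0)
  have g := realCliffordAdd 1 1 0 p q r
  rw [Nat.add_comm 1 p, Nat.add_comm 1 q, Nat.zero_add] at g
  exact ⟨(g.trans (f.tensor _)).trans (.ground _)⟩

/-- Four generators of square `1` can be replaced by four of square `-1`, because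
`ℝ_{4,0,0} ≅ ℝ_{0,4,0}`. -/
theorem nonempty_corner_pos_to_neg (p q r : ℕ) :
    Nonempty (CornerEmbedding (realClifford (p + 4) q r) (realClifford p (q + 4) r)) := by
  let s : Fin 4 ⊕ Fin 0 ⊕ Fin 0 ≃ Fin 0 ⊕ Fin 4 ⊕ Fin 0 := (Equiv.sumAssoc _ _ _).symm.trans
    ((Equiv.sumCongr (Equiv.sumComm _ _) (Equiv.refl _)).trans (Equiv.sumAssoc _ _ _))
  obtain ⟨f⟩ : Nonempty (CornerEmbedding (cliff (weight 4 0 0))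
      (cliff (weight 0 4 0 ∘ s))) :=
    nonempty_cornerEmbedding_neg_four (s := -1) (Or.inr rfl)
      (by rintro (i | i | i); exacts [(neg_neg 1).symm, i.elim0, i.elim0])
      (by rintro (i | i | i); exacts [rfl, i.elim0, i.elim0])
      (i₀ := .inl 0) (i₁ := .inl 1) (i₂ := .inl 2) (i₃ := .inl 3)
      (by decide) (by decide) (by decide) (by decide) (by decide) (by decide) (by decide)
  have f' : CornerEmbedding (realClifford 4 0 0) (realClifford 0 4 0) :=
    f.trans (cliffReindex s fun _ => rfl)
  have g := realCliffordAdd 4 0 0 p q r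
  have g' := realCliffordAddSymm 0 4 0 p q r
  rw [Nat.zero_add, Nat.zero_add, Nat.add_comm] at g g'
  exact ⟨(g.trans (f'.tensor _)).trans g'⟩

theorem nonempty_corner_neg_to_pos (p q r : ℕ) :
    Nonempty (CornerEmbedding (realClifford p (q + 4) r) (realClifford (p + 4) q r)) := by
  let s : Fin 4 ⊕ Fin 0 ⊕ Fin 0 ≃ Fin 0 ⊕ Fin 4 ⊕ Fin 0 := (Equiv.sumAssoc _ _ _).symm.trans
    ((Equiv.sumCongr (Equiv.sumComm _ _) (Equiv.refl _)).trans (Equiv.sumAssoc _ _ _))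
  obtain ⟨f⟩ : Nonempty (CornerEmbedding (cliff (weight 0 4 0 ∘ s))
      (cliff (weight 4 0 0))) :=
    nonempty_cornerEmbedding_neg_four (s := 1) (Or.inl rfl)
      (by rintro (i | i | i); exacts [rfl, i.elim0, i.elim0])
      (by rintro (i | i | i); exacts [rfl, i.elim0, i.elim0])
      (i₀ := .inl 0) (i₁ := .inl 1) (i₂ := .inl 2) (i₃ := .inl 3)
      (by decide) (by decide) (by decide) (by decide) (by decide) (by decide) (by decide)
  have f' : CornerEmbedding (realClifford 0 4 0) (realClifford 4 0 0) :=
    (cliffReindex (w := weight 0 4 0) (w' := weight 0 4 0 ∘ s) s.symm fun i => by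
      rw [Function.comp_apply, s.apply_symm_apply]).trans f
  have g := realCliffordAdd 0 4 0 p q r
  have g' := realCliffordAddSymm 4 0 0 p q r
  rw [Nat.zero_add, Nat.zero_add, Nat.add_comm] at g g'
  exact ⟨(g.trans (f'.tensor _)).trans g'⟩

/-- Up to full corners, `ℝ_{p,q,r}` depends only on `r` and on `p - q` modulo `8`: hyperbolic planes
can be cancelled, and four generators can be moved between the positive and the negative ones. -/
theorem exists_corner_reduced (r : ℕ) : ∀ m p q : ℕ, p + q ≤ m → ∃ p' q',
    Nonempty (CornerEmbedding (realClifford p q r) (realClifford p' q' r)) ∧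
      (p : ℤ) - q ≡ p' - q' [ZMOD 8] ∧ (q' = 0 ∧ p' ≤ 4 ∨ p' = 0 ∧ q' ≤ 3) := by
  intro m
  induction m with
  | zero =>
    intro p q h
    exact ⟨p, q, ⟨.ofIsoSymm (AlgEquiv.refl) fun _ _ h => h⟩, rfl, by omega⟩
  | succ m ih =>
    intro p q h
    by_cases hr : q = 0 ∧ p ≤ 4 ∨ p = 0 ∧ q ≤ 3
    · exact ⟨p, q, ⟨.ofIsoSymm (AlgEquiv.refl) fun _ _ h => h⟩, rfl, hr⟩
    -- here the number of generators cannot decrease, but one move of four already suffices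
    by_cases hq : p = 0 ∧ q = 4
    · obtain ⟨rfl, rfl⟩ := hq
      exact ⟨4, 0, nonempty_corner_neg_to_pos 0 0 r, rfl, by omega⟩
    have step : ∃ p₁ q₁, p₁ + q₁ ≤ m ∧ (p : ℤ) - q ≡ p₁ - q₁ [ZMOD 8] ∧
        Nonempty (CornerEmbedding (realClifford p q r) (realClifford p₁ q₁ r)) := by
      simp only [Int.ModEq]
      match p, q with
      | p + 1, q + 1 => exact ⟨p, q, by omega, by omega, nonempty_corner_cancel p q r⟩
      | 0, q =>
        -- `(0, k + 5)`, then `(4, k + 1)`, then `(3, k)`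
        obtain ⟨k, rfl⟩ : ∃ k, q = k + 1 + 4 := ⟨q - 5, by omega⟩
        obtain ⟨f⟩ := nonempty_corner_neg_to_pos 0 (k + 1) r
        obtain ⟨g⟩ := nonempty_corner_cancel 3 k r
        exact ⟨3, k, by omega, by omega, ⟨f.trans g⟩⟩
      | p + 1, 0 =>
        -- `(k + 5, 0)`, then `(k + 1, 4)`, then `(k, 3)`
        obtain ⟨k, rfl⟩ : ∃ k, p = k + 4 := ⟨p - 4, by omega⟩
        obtain ⟨f⟩ := nonempty_corner_pos_to_neg (k + 1) 0 r
        obtain ⟨g⟩ := nonempty_corner_cancel k 3 r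
        exact ⟨k, 3, by omega, by omega, ⟨f.trans g⟩⟩
    obtain ⟨p₁, q₁, h₁, hm₁, ⟨f⟩⟩ := step
    obtain ⟨p', q', ⟨g⟩, hm, h'⟩ := ih p₁ q₁ h₁
    exact ⟨p', q', ⟨f.trans g⟩, hm₁.trans hm, h'⟩

/-! ### The reduced superalgebras -/

theorem nonempty_corner_grassmann (r : ℕ) :
    Nonempty (CornerEmbedding (realClifford 0 0 r) (grassmann r)) := by
  rw [grassmann_eq_cliff]
  exact ⟨cliffReindex ((Equiv.emptySum (Fin 0) _).trans (Equiv.emptySum (Fin 0) _)) (by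
    rintro (i | i | i)
    exacts [i.elim0, i.elim0, rfl])⟩

theorem nonempty_corner_tensor_grassmann (p q r : ℕ) :
    Nonempty (CornerEmbedding (realClifford p q r)
      ((realClifford p q 0).tensor (grassmann r))) := by
  rw [grassmann_eq_cliff]
  let s : Fin p ⊕ Fin q ⊕ Fin r ≃ (Fin p ⊕ Fin q ⊕ Fin 0) ⊕ Fin r :=
    ((Equiv.sumAssoc _ _ _).symm.trans (Equiv.sumCongr (Equiv.sumCongr (Equiv.refl _)
      (Equiv.sumEmpty _ _).symm) (Equiv.refl _)))
  exact ⟨.trans (cliffReindex s (w' := Sum.elim (weight p q 0) fun _ => 0) (by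
    rintro (i | i | i) <;> rfl)) (cliffSum _ _)⟩

theorem nonempty_corner_dPlus (i : ℕ) :
    Nonempty (CornerEmbedding (realClifford (i + 1) 0 0) (dPlus.tensorPow (i + 1))) := by
  induction i with
  | zero => exact ⟨.ofIsoSymm (AlgEquiv.refl) fun _ _ h => h⟩
  | succ i ih =>
    obtain ⟨f⟩ := ih
    exact ⟨(realCliffordAdd (i + 1) 0 0 1 0 0).trans (f.tensor dPlus)⟩

theorem nonempty_corner_dMinus (i : ℕ) :
    Nonempty (CornerEmbedding (realClifford 0 (i + 1) 0) (dMinus.tensorPow (i + 1))) := by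
  induction i with
  | zero => exact ⟨.ofIsoSymm (AlgEquiv.refl) fun _ _ h => h⟩
  | succ i ih =>
    obtain ⟨f⟩ := ih
    exact ⟨(realCliffordAdd 0 (i + 1) 0 0 1 0).trans (f.tensor dMinus)⟩

theorem nonempty_corner_quaternion :
    Nonempty (CornerEmbedding (realClifford 4 0 0) quaternionSuperAlg) :=
  nonempty_corner_four (w := weight 4 0 0)
    (by rintro (i | i | i); exacts [rfl, i.elim0, i.elim0])
    (i₀ := .inl 0) (i₁ := .inl 1) (i₂ := .inl 2) (i₃ := .inl 3)
    (by decide) (by decide) (by decide) (by decide) (by decide) (by decide) (by decide)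

/-- Each `ℝ_{p,q,r}` has the superalgebra that the residue of `p - q` modulo `8` prescribes as a
full corner. -/
theorem nonempty_corner_basic (p q r : ℕ) :
    ((p : ℤ) - q ≡ 0 [ZMOD 8] → Nonempty (CornerEmbedding (realClifford p q r) (grassmann r))) ∧
    ((p : ℤ) - q ≡ 4 [ZMOD 8] → Nonempty (CornerEmbedding (realClifford p q r)
      (quaternionSuperAlg.tensor (grassmann r)))) ∧
    (∀ i : ℕ, 1 ≤ i → i ≤ 3 → (p : ℤ) - q ≡ i [ZMOD 8] →
      Nonempty (CornerEmbedding (realClifford p q r)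
        ((dPlus.tensorPow i).tensor (grassmann r)))) ∧
    (∀ i : ℕ, 1 ≤ i → i ≤ 3 → (p : ℤ) - q ≡ -i [ZMOD 8] →
      Nonempty (CornerEmbedding (realClifford p q r)
        ((dMinus.tensorPow i).tensor (grassmann r)))) := by
  obtain ⟨p', q', ⟨f⟩, h, hr⟩ := exists_corner_reduced r (p + q) p q le_rfl
  simp only [Int.ModEq] at h ⊢
  refine ⟨fun h' => ?_, fun h' => ?_, fun i hi hi' h' => ?_, fun i hi hi' h' => ?_⟩
  · obtain ⟨rfl, rfl⟩ : p' = 0 ∧ q' = 0 := by omega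
    obtain ⟨g⟩ := nonempty_corner_grassmann r
    exact ⟨f.trans g⟩
  · obtain ⟨rfl, rfl⟩ : p' = 4 ∧ q' = 0 := by omega
    obtain ⟨g⟩ := nonempty_corner_tensor_grassmann 4 0 r
    obtain ⟨k⟩ := nonempty_corner_quaternion
    exact ⟨(f.trans g).trans (k.tensor _)⟩
  · obtain ⟨i, rfl⟩ : ∃ k, i = k + 1 := ⟨i - 1, by omega⟩
    obtain ⟨rfl, rfl⟩ : p' = i + 1 ∧ q' = 0 := by omega
    obtain ⟨g⟩ := nonempty_corner_tensor_grassmann (i + 1) 0 r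
    obtain ⟨k⟩ := nonempty_corner_dPlus i
    exact ⟨(f.trans g).trans (k.tensor _)⟩
  · obtain ⟨i, rfl⟩ : ∃ k, i = k + 1 := ⟨i - 1, by omega⟩
    obtain ⟨rfl, rfl⟩ : p' = 0 ∧ q' = i + 1 := by omega
    obtain ⟨g⟩ := nonempty_corner_tensor_grassmann 0 (i + 1) r
    obtain ⟨k⟩ := nonempty_corner_dMinus i
    exact ⟨(f.trans g).trans (k.tensor _)⟩

theorem realClifford_finite (p q r : ℕ) : Module.Finite ℝ (realClifford p q r) :=
  inferInstanceAs (Module.Finite ℝ (cliff (weight p q r)))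

theorem gradedEquivalent_sigma_of_corner {p q r : ℕ} {B : SuperAlg ℝ}
    (h : Nonempty (CornerEmbedding (realClifford p q r) B)) :
    (realClifford p q r).GradedEquivalent .sigma B := by
  obtain ⟨f⟩ := h
  exact f.gradedEquivalent_sigma (realClifford_finite p q r)

/-- For `π` the squares of the generators change sign, whence the exchange of `p` and `q`. -/
theorem gradedEquivalent_pi_of_corner {p q r : ℕ} {B : SuperAlg ℝ}
    (h : Nonempty (CornerEmbedding (realClifford q p r) B)) :
    (realClifford p q r).GradedEquivalent .pi B := by
  obtain ⟨f⟩ := h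
  let s : Fin p ⊕ Fin q ⊕ Fin r ≃ Fin q ⊕ Fin p ⊕ Fin r := (Equiv.sumAssoc _ _ _).symm.trans
    ((Equiv.sumCongr (Equiv.sumComm _ _) (Equiv.refl _)).trans (Equiv.sumAssoc _ _ _))
  have g : CornerEmbedding (cliff fun i => -weight p q r i) (realClifford q p r) :=
    cliffReindex s (w' := weight q p r) (by
      rintro (i | i | i)
      exacts [rfl, (neg_neg 1).symm, neg_zero.symm])
  exact Twist.gradedEquivalent_pi
    (cliffTwist (w := fun i => -weight p q r i) (w' := weight p q r) fun i => (neg_neg _).symm)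
    (g.trans f) (realClifford_finite p q r)

/-! ### Even idempotents of Clifford superalgebras -/

theorem SuperAlg.IsEvenConnected.of_corner {K : Type u} [Field K] {A B : SuperAlg K}
    (hA : A.IsEvenConnected) (c : CornerEmbedding A B) : B.IsEvenConnected :=
  hA.of_injective c.toHom c.injective (c.map_mem 0)

/-- A superalgebra whose even part is a division algebra has no even idempotents but `0` and `1`. -/
theorem isEvenConnected_of_divisionRing {E : Type} [DivisionRing E] [Algebra ℝ E]
    {A : SuperAlg ℝ} [Nontrivial A] (f : E →ₐ[ℝ] A) (h : ∀ x ∈ A.part 0, ∃ q, f q = x) :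
    A.IsEvenConnected := by
  intro e he hee
  obtain ⟨q, rfl⟩ := h e he
  have hq : q * q = q := f.toRingHom.injective ((map_mul f q q).trans hee)
  rcases (IsIdempotentElem.iff_eq_zero_or_one (p := q)).mp hq with rfl | rfl
  · exact Or.inl (map_zero f)
  · exact Or.inr (map_one f)

section

variable {n : Type} [Fintype n] [DecidableEq n] {w : n → ℝ}

/-- If the generators lie in `u E` for an odd `u` and an algebra `E` of even elements, and their
products with `u` lie in `E`, then the algebra is `E + u E`, and `E` is its even part. -/
theorem exists_algHom_eq_of_even {E : Type} [Ring E] [Algebra ℝ E] (f : E →ₐ[ℝ] cliff w)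
    (hf : ∀ x, f x ∈ (cliff w).part 0) {u : cliff w} (hu : u ∈ (cliff w).part 1)
    (h : ∀ i, (∃ q, gen w i = u * f q) ∧ ∃ q, gen w i * u = f q) (x : cliff w)
    (hx : x ∈ (cliff w).part 0) : ∃ q, f q = x := by
  have key : x ∈ LinearMap.range f.toLinearMap ⊔
      (LinearMap.range f.toLinearMap).map (LinearMap.mulLeft ℝ u) := by
    refine cliff_mem_of_stable (L := LinearMap.range f.toLinearMap ⊔
      (LinearMap.range f.toLinearMap).map (LinearMap.mulLeft ℝ u))
      (Submodule.mem_sup_left ⟨1, map_one f⟩) ?_ x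
    intro i x hx
    obtain ⟨_, ⟨y, rfl⟩, _, ⟨_, ⟨z, rfl⟩, rfl⟩, rfl⟩ := Submodule.mem_sup.mp hx
    obtain ⟨⟨q, hq⟩, q', hq'⟩ := h i
    refine Submodule.mem_sup.mpr ⟨_, ⟨q' * z, rfl⟩, _, ⟨_, ⟨q * y, rfl⟩, rfl⟩, ?_⟩
    change f (q' * z) + u * f (q * y) = gen w i * (f y + u * f z)
    rw [map_mul, map_mul, ← hq', ← mul_assoc u, ← hq, mul_add, mul_assoc, add_comm]
  obtain ⟨_, ⟨y, rfl⟩, _, ⟨_, ⟨z, rfl⟩, rfl⟩, rfl⟩ := Submodule.mem_sup.mp key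
  refine ⟨y, ?_⟩
  change f y + u * f z ∈ _ at hx
  change f y = f y + u * f z
  have h1 : u * f z ∈ (cliff w).part 1 := add_zero (1 : ZMod 2) ▸ (cliff w).mul_mem hu (hf z)
  have h0 : u * f z ∈ (cliff w).part 0 := by
    have := sub_mem hx (hf y)
    rwa [add_sub_cancel_left] at this
  rw [Submodule.disjoint_def.mp (cliff w).isCompl.disjoint _ h0 h1, add_zero]

/-- For three generators with the same square `± 1`, the even part is the algebra of quaternions. -/
theorem exists_quaternionHom_even {s : ℝ} (hs : s = 1 ∨ s = -1) (hw : ∀ i, w i = s) {i₀ i₁ i₂ : n}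
    (h10 : i₁ ≠ i₀) (h20 : i₂ ≠ i₀) (h21 : i₂ ≠ i₁) (h : ∀ i, i = i₀ ∨ i = i₁ ∨ i = i₂) :
    ∃ f : Quaternion ℝ →ₐ[ℝ] cliff w, (∀ q, f q ∈ (cliff w).part 0) ∧
      ∀ x ∈ (cliff w).part 0, ∃ q, f q = x := by
  have hs' : algebraMap ℝ (cliff w) s = 1 ∨ algebraMap ℝ (cliff w) s = -1 := by
    rcases hs with rfl | rfl
    · exact Or.inl (map_one _)
    · exact Or.inr (by rw [map_neg, map_one])
  have hss : s * s = 1 := by rcases hs with rfl | rfl <;> norm_num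
  have sq : ∀ i, gen w i * gen w i = algebraMap ℝ (cliff w) s := fun i => by
    rw [gen_mul_self, hw]
  let Q := quaternionBasis hs' (sq i₀) (sq i₁) (sq i₂) (gen_mul_gen h10) (gen_mul_gen h20)
    (gen_mul_gen h21)
  have hQ := quaternionHom_mem_even Q ((cliff w).mul_mem_zero_of_odd (gen_mem i₀) (gen_mem i₁))
    ((cliff w).mul_mem_zero_of_odd (gen_mem i₁) (gen_mem i₂))
  refine ⟨quaternionHom Q, hQ, exists_algHom_eq_of_even _ hQ (gen_mem i₀) ?_⟩
  obtain ⟨⟨qi, hqi⟩, -, qk, hqk⟩ := exists_quaternionHom_eq Q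
  have hk : gen w i₀ * gen w i₂ = s • quaternionHom Q qk := by
    rw [hqk]
    change _ = s • (gen w i₀ * gen w i₁ * (gen w i₁ * gen w i₂))
    rw [mul_assoc, mul_left_of_mul_self (sq i₁), ← Algebra.smul_def, mul_smul_comm, smul_smul, hss,
      one_smul]
  have cancel : ∀ x, x = gen w i₀ * (s • (gen w i₀ * x)) := fun x => by
    rw [mul_smul_comm, mul_left_of_mul_self (sq i₀), ← Algebra.smul_def, smul_smul, hss, one_smul]
  intro i
  rcases h i with rfl | rfl | rfl
  · exact ⟨⟨1, by rw [map_one, mul_one]⟩, algebraMap ℝ _ s, by rw [sq, AlgHom.commutes]⟩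
  · refine ⟨⟨s • qi, ?_⟩, -qi, ?_⟩
    · rw [map_smul, hqi]
      exact cancel _
    · rw [map_neg, hqi]
      exact gen_mul_gen h10
  · refine ⟨⟨qk, ?_⟩, -(s • qk), ?_⟩
    · rw [← one_smul ℝ (quaternionHom Q qk), ← hss, ← smul_smul, ← hk]
      exact cancel _
    · rw [map_neg, map_smul, ← hk]
      exact gen_mul_gen h20

/-- An even element of the skew tensor product with the dual numbers (an odd generator `ε` with
`ε² = 0`) is `a ⊗ 1 + b ⊗ ε`, with `b ⊗ ε` of square zero. Hence no new even idempotents appear. -/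
theorem SuperAlg.IsEvenConnected.tensor_dual {A : SuperAlg ℝ} (hA : A.IsEvenConnected) {i : n}
    (hw : ∀ j, w j = 0) (hi : ∀ j, j = i) : (A.tensor (cliff w)).IsEvenConnected := by
  have hεε : gen w i * gen w i = 0 := by rw [gen_mul_self, hw, map_zero]
  have hε : gen w i ∈ (cliff w).part 1 := gen_mem i
  have hεε0 : ∀ a ∈ A.part 1, tens a (gen w i) * tens a (gen w i) = 0 := fun a ha => by
    rw [tens_mul_tens a _ hε ha, hεε, tens_zero, smul_zero]
  have span : ∀ c : cliff w, ∃ k l : ℝ, c = k • 1 + l • gen w i := by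
    have h := cliff_mem_of_stable (w := w) (L := Submodule.span ℝ {1, gen w i})
      (Submodule.subset_span (by simp)) (by
        intro j x hx
        rw [hi j]
        obtain ⟨k, l, rfl⟩ := Submodule.mem_span_pair.mp hx
        rw [mul_add, mul_smul_comm, mul_smul_comm, mul_one, hεε, smul_zero, add_zero]
        exact Submodule.smul_mem _ _ (Submodule.subset_span (by simp)))
    intro c
    obtain ⟨k, l, h⟩ := Submodule.mem_span_pair.mp (h c)
    exact ⟨k, l, h.symm⟩
  have hom : ∀ j, ∀ c ∈ (cliff w).part j, (j = 0 ∧ ∃ k : ℝ, c = k • 1) ∨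
      (j = 1 ∧ ∃ k : ℝ, c = k • gen w i) := by
    intro j c hc
    obtain ⟨k, l, rfl⟩ := span c
    have hk : k • (1 : cliff w) ∈ (cliff w).part 0 := Submodule.smul_mem _ _ (cliff w).one_mem
    have hl : l • gen w i ∈ (cliff w).part 1 := Submodule.smul_mem _ _ hε
    have hd := Submodule.disjoint_def.mp (cliff w).isCompl.disjoint
    rcases ZMod.two_cases j with rfl | rfl
    · refine Or.inl ⟨rfl, k, ?_⟩
      rw [hd (l • gen w i) (by simpa using sub_mem hc hk) hl, add_zero]
    · refine Or.inr ⟨rfl, l, ?_⟩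
      rw [hd (k • 1) hk (by simpa using sub_mem hc hl), zero_add]
  intro e he hee
  obtain ⟨a, ha, b, hb, rfl⟩ : ∃ a ∈ A.part 0, ∃ b ∈ A.part 1,
      e = tens a 1 + tens b (gen w i) := by
    let T : cliff w → A →ₗ[ℝ] A.tensor (cliff w) := fun c =>
      { toFun := fun a => tens a c
        map_add' := fun a a' => add_tens a a' c
        map_smul' := fun k a => smul_tens k a c }
    have key : ∀ j j' a c, j + j' = 0 → a ∈ A.part j → c ∈ (cliff w).part j' →
        tens a c ∈ (A.part 0).map (T 1) ⊔ (A.part 1).map (T (gen w i)) := by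
      intro j j' a c hj ha hc
      rcases hom j' c hc with ⟨rfl, k, rfl⟩ | ⟨rfl, k, rfl⟩
      · obtain rfl : j = 0 := by rw [← add_zero j]; exact hj
        exact Submodule.mem_sup_left ⟨k • a, Submodule.smul_mem _ _ ha,
          (smul_tens k a 1).trans (tens_smul k a 1).symm⟩
      · obtain rfl : j = 1 := (by decide : ∀ j : ZMod 2, j + 1 = 0 → j = 1) j hj
        exact Submodule.mem_sup_right ⟨k • a, Submodule.smul_mem _ _ ha,
          (smul_tens k a _).trans (tens_smul k a _).symm⟩
    have hle : (A.tensor (cliff w)).part 0 ≤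
        (A.part 0).map (T 1) ⊔ (A.part 1).map (T (gen w i)) := by
      refine Submodule.span_le.mpr ?_
      rintro x ⟨j, j', a, c, hj, ha, hc, rfl⟩
      exact key j j' a c hj ha hc
    obtain ⟨_, ⟨a, ha, rfl⟩, _, ⟨b, hb, rfl⟩, h⟩ := Submodule.mem_sup.mp (hle he)
    exact ⟨a, ha, b, hb, h.symm⟩
  -- the linear map to `A` that kills `ε` respects the products that occur in `e * e`
  have haa : a * a = a := by
    let g : cliff w →ₐ[ℝ] ℝ := cliffLift w (fun _ => 0) (fun j => by simp [hw])
      fun _ _ _ => by simp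
    have hg : g (gen w i) = 0 := cliffLift_gen _ _ _ i
    let r : A.tensor (cliff w) →ₗ[ℝ] A := ((TensorProduct.rid ℝ A).toLinearMap ∘ₗ
      LinearMap.lTensor A g.toLinearMap : A ⊗[ℝ] cliff w →ₗ[ℝ] A)
    have hr : ∀ x c, r (tens x c) = g c • x := fun _ _ => rfl
    have h := congrArg r hee
    rw [add_mul, mul_add, mul_add, tens_mul_tens_of_even_right _ _ _ ha,
      tens_mul_tens_of_even_right _ _ _ ha, tens_mul_tens_of_even_left _ _ _ (cliff w).one_mem,
      hεε0 b hb, mul_one, mul_one, one_mul] at h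
    simpa only [map_add, hr, hg, zero_smul, add_zero, map_one, one_smul, map_zero] using h
  rcases hA a ha haa with rfl | rfl
  · rw [zero_tens, zero_add] at hee ⊢
    exact Or.inl (hee.symm.trans (hεε0 b hb))
  · rw [tens_one_one] at hee ⊢
    rw [add_mul, mul_add, mul_add, hεε0 b hb, one_mul, one_mul, mul_one, add_zero,
      add_eq_left] at hee
    exact Or.inr (by rw [hee, add_zero])

end

theorem isEvenConnected_add_dual {p q : ℕ} (h : (realClifford p q 0).IsEvenConnected) (r : ℕ) :
    (realClifford p q r).IsEvenConnected := by
  induction r with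
  | zero => exact h
  | succ r ih =>
    refine IsEvenConnected.of_corner (A := (realClifford p q r).tensor (realClifford 0 0 1)) ?_
      (realCliffordAddSymm p q r 0 0 1)
    refine ih.tensor_dual (w := weight 0 0 1) (i := .inr (.inr 0)) ?_ ?_
    · rintro (i | i | i)
      exacts [i.elim0, i.elim0, rfl]
    · decide

/-- `ℝ_{p,q,r}` is a subalgebra of `ℝ_{a,b,0} ⊗ ℝ_{p,q,r}`. -/
theorem isEvenConnected_of_add {a b p q r : ℕ}
    (h : (realClifford (a + p) (b + q) r).IsEvenConnected) :
    (realClifford p q r).IsEvenConnected := by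
  have : Nontrivial (realClifford a b 0) := inferInstanceAs (Nontrivial (cliff (weight a b 0)))
  have c := realCliffordAdd a b 0 p q r
  rw [Nat.zero_add] at c
  exact (h.of_corner c).of_injective
    (inclRight (realClifford a b 0) (realClifford p q r) :
      realClifford p q r →ₙₐ[ℝ] (realClifford a b 0).tensor (realClifford p q r))
    inclRight_injective (inclRight_mem 0)

theorem exists_quaternionHom_pos : ∃ f : Quaternion ℝ →ₐ[ℝ] realClifford 3 0 0,
    (∀ q, f q ∈ (realClifford 3 0 0).part 0) ∧ ∀ x ∈ (realClifford 3 0 0).part 0, ∃ q, f q = x :=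
  exists_quaternionHom_even (w := weight 3 0 0) (Or.inl rfl)
    (by rintro (i | i | i); exacts [rfl, i.elim0, i.elim0])
    (i₀ := .inl 0) (i₁ := .inl 1) (i₂ := .inl 2) (by decide) (by decide) (by decide) (by decide)

theorem exists_quaternionHom_neg : ∃ f : Quaternion ℝ →ₐ[ℝ] realClifford 0 3 0,
    (∀ q, f q ∈ (realClifford 0 3 0).part 0) ∧ ∀ x ∈ (realClifford 0 3 0).part 0, ∃ q, f q = x :=
  exists_quaternionHom_even (w := weight 0 3 0) (Or.inr rfl)
    (by rintro (i | i | i); exacts [i.elim0, rfl, i.elim0])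
    (i₀ := .inr (.inl 0)) (i₁ := .inr (.inl 1)) (i₂ := .inr (.inl 2))
    (by decide) (by decide) (by decide) (by decide)

instance (p q r : ℕ) : Nontrivial (realClifford p q r) :=
  inferInstanceAs (Nontrivial (cliff (weight p q r)))

theorem isEvenConnected_pos {p : ℕ} (hp : p ≤ 3) (r : ℕ) :
    (realClifford p 0 r).IsEvenConnected := by
  obtain ⟨f, -, h⟩ := exists_quaternionHom_pos
  have h3 := isEvenConnected_add_dual (isEvenConnected_of_divisionRing f h) r
  refine isEvenConnected_of_add (a := 3 - p) (b := 0) ?_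
  rwa [Nat.sub_add_cancel hp, Nat.zero_add]

theorem isEvenConnected_neg {q : ℕ} (hq : q ≤ 3) (r : ℕ) :
    (realClifford 0 q r).IsEvenConnected := by
  obtain ⟨f, -, h⟩ := exists_quaternionHom_neg
  have h3 := isEvenConnected_add_dual (isEvenConnected_of_divisionRing f h) r
  refine isEvenConnected_of_add (a := 0) (b := 3 - q) ?_
  rwa [Nat.sub_add_cancel hq, Nat.zero_add]

theorem isEvenConnected_concentrated_tensor {E : Type} [Ring E] [Algebra ℝ E] {A C : SuperAlg ℝ}
    (f : E →ₐ[ℝ] A) (hf : ∀ x, f x ∈ A.part 0) (inj : Function.Injective f)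
    (h : (A.tensor C).IsEvenConnected) : ((concentrated ℝ E).tensor C).IsEvenConnected := by
  let g : concentrated ℝ E →ₙₐ[ℝ] A := (f : E →ₙₐ[ℝ] A)
  have hg : ∀ i, ∀ b ∈ (concentrated ℝ E).part i, g b ∈ A.part i :=
    mem_part_of_concentrated (f := f.toLinearMap) hf
  exact h.of_injective
    { toFun := tensorMapLeft C (g : concentrated ℝ E →ₗ[ℝ] A)
      map_smul' := map_smul _
      map_zero' := map_zero _
      map_add' := map_add _
      map_mul' := tensorMapLeft_mul g hg }
    (tensorMapLeft_injective inj) (tensorMapLeft_mem hg 0)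

/-- `ℍ` is the even part of `ℝ_{3,0,0}`, whence `ℍ ⊗ Λ(r)` embeds into `ℝ_{3,0,0} ⊗ Λ(r)`. -/
theorem isEvenConnected_quaternion (r : ℕ) :
    (quaternionSuperAlg.tensor (grassmann r)).IsEvenConnected := by
  obtain ⟨f, hf, -⟩ := exists_quaternionHom_pos
  obtain ⟨c⟩ := nonempty_corner_tensor_grassmann 3 0 r
  exact isEvenConnected_concentrated_tensor f hf f.toRingHom.injective
    ((isEvenConnected_pos le_rfl r).of_corner c)

/-! ### The equivalences and the basic superalgebras -/

theorem mainTheorem1 (p q r : ℕ) :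
    -- `σ`-graded equivalence
    (((p : ℤ) - q ≡ 0 [ZMOD 8] →
        (realClifford p q r).GradedEquivalent .sigma (grassmann r)) ∧
      ((p : ℤ) - q ≡ 4 [ZMOD 8] →
        (realClifford p q r).GradedEquivalent .sigma (quaternionSuperAlg.tensor (grassmann r))) ∧
      (∀ i : ℕ, 1 ≤ i → i ≤ 3 → (p : ℤ) - q ≡ i [ZMOD 8] →
        (realClifford p q r).GradedEquivalent .sigma ((dPlus.tensorPow i).tensor (grassmann r))) ∧
      (∀ i : ℕ, 1 ≤ i → i ≤ 3 → (p : ℤ) - q ≡ -i [ZMOD 8] →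
        (realClifford p q r).GradedEquivalent .sigma
          ((dMinus.tensorPow i).tensor (grassmann r)))) ∧
    -- `π`-graded equivalence
    (((p : ℤ) - q ≡ 0 [ZMOD 8] →
        (realClifford p q r).GradedEquivalent .pi (grassmann r)) ∧
      ((p : ℤ) - q ≡ 4 [ZMOD 8] →
        (realClifford p q r).GradedEquivalent .pi (quaternionSuperAlg.tensor (grassmann r))) ∧
      (∀ i : ℕ, 1 ≤ i → i ≤ 3 → (p : ℤ) - q ≡ -i [ZMOD 8] →
        (realClifford p q r).GradedEquivalent .pi ((dPlus.tensorPow i).tensor (grassmann r))) ∧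
      (∀ i : ℕ, 1 ≤ i → i ≤ 3 → (p : ℤ) - q ≡ i [ZMOD 8] →
        (realClifford p q r).GradedEquivalent .pi
          ((dMinus.tensorPow i).tensor (grassmann r)))) ∧
    -- the superalgebras in the lists are `σ`- and `π`-graded basic
    (∀ S : SuperAlg.Shift,
      (grassmann r).IsGradedBasic S ∧
      (quaternionSuperAlg.tensor (grassmann r)).IsGradedBasic S ∧
      ∀ i : ℕ, 1 ≤ i → i ≤ 3 →
        ((dPlus.tensorPow i).tensor (grassmann r)).IsGradedBasic S ∧
        ((dMinus.tensorPow i).tensor (grassmann r)).IsGradedBasic S) := by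
  refine ⟨?_, ?_, fun S => ⟨?_, ?_, fun i h1 h3 => ⟨?_, ?_⟩⟩⟩
  · obtain ⟨h0, h4, hp, hm⟩ := nonempty_corner_basic p q r
    exact ⟨fun h => gradedEquivalent_sigma_of_corner (h0 h),
      fun h => gradedEquivalent_sigma_of_corner (h4 h),
      fun i h1 h3 h => gradedEquivalent_sigma_of_corner (hp i h1 h3 h),
      fun i h1 h3 h => gradedEquivalent_sigma_of_corner (hm i h1 h3 h)⟩
  · obtain ⟨h0, h4, hp, hm⟩ := nonempty_corner_basic q p r
    simp only [Int.ModEq] at h0 h4 hp hm ⊢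
    exact ⟨fun h => gradedEquivalent_pi_of_corner (h0 (by omega)),
      fun h => gradedEquivalent_pi_of_corner (h4 (by omega)),
      fun i h1 h3 h => gradedEquivalent_pi_of_corner (hp i h1 h3 (by omega)),
      fun i h1 h3 h => gradedEquivalent_pi_of_corner (hm i h1 h3 (by omega))⟩
  · obtain ⟨c⟩ := nonempty_corner_grassmann r
    exact ((isEvenConnected_pos (Nat.zero_le 3) r).of_corner c).isGradedBasic
      (gradedEquivalent_sigma_of_corner ⟨c⟩).2.1 S
  · exact (isEvenConnected_quaternion r).isGradedBasic (gradedEquivalent_sigma_of_corner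
      ((nonempty_corner_basic 4 0 r).2.1 rfl)).2.1 S
  · obtain ⟨c⟩ := (nonempty_corner_basic i 0 r).2.2.1 i h1 h3 (by simp)
    exact ((isEvenConnected_pos h3 r).of_corner c).isGradedBasic
      (gradedEquivalent_sigma_of_corner ⟨c⟩).2.1 S
  · obtain ⟨c⟩ := (nonempty_corner_basic 0 i r).2.2.2 i h1 h3 (by simp)
    exact ((isEvenConnected_neg h3 r).of_corner c).isGradedBasic
      (gradedEquivalent_sigma_of_corner ⟨c⟩).2.1 S
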